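/- **Setting.** Let $(\mathcal W\rightrightarrows E;\ \mathcal G\rightrightarrows M)$ be a VB-groupoid: $\mathcal W\rightrightarrows E$ and $\mathcal G\rightrightarrows M$ are Lie groupoids, $\mathcal W\to\mathcal G$ and $E\to M$ are smooth vector bundles, and projection, zero section, addition and scalar multiplications are morphisms of Lie groupoids. Write $\mathsf s,\mathsf t,\mathsf 1,\mathsf i$ for source, target, units and inversion of $\mathcal W\rightrightarrows E$, $\bar{\mathsf m}(w,w')=w\,w'^{-1}$ for the division map (defined when $\mathsf s(w)=\mathsf s(w')$), $\mathcal W^{(k)}$ for the manifold of composable $k$-tuples of arrows ($\mathsf s(w_i)=\mathsf t(w_{i+1})$), and $W=\ker(T\mathsf s)|_E\to E$ for the Lie algebroid of $\mathcal W\rightrightarrows E$. The deformation complex $(C_{\mathrm{def}}(\mathcal W),\delta)$ is defined as follows. For $k\ge 0$, $C^k_{\mathrm{def}}(\mathcal W)$ is the space of smooth maps $c:\mathcal W^{(k+1)}\to T\mathcal W$ with $c(w_0,\dots,w_k)\in T_{w_0}\mathcal W$ such that $T\mathsf s(c(w_0,\dots,w_k))$ does not depend on $w_0$ (for $k=0$: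 depends only on $\mathsf s(w_0)$), and $$\delta c(w_0,\dots,w_{k+1})=-T\bar{\mathsf m}\big(c(w_0w_1,w_2,\dots,w_{k+1}),c(w_1,\dots,w_{k+1})\big)+\sum_{i=1}^{k}(-1)^{i-1}c(w_0,\dots,w_iw_{i+1},\dots,w_{k+1})+(-1)^kc(w_0,\dots,w_k).$$ Moreover $C^{-1}_{\mathrm{def}}(\mathcal W)=\Gamma(W)$ and $\delta\alpha=\overleftarrow\alpha+\overrightarrow\alpha$, where $\overrightarrow\alpha_w=TR_w(\alpha_{\mathsf t(w)})$ and $\overleftarrow\alpha_w=TL_w(T\mathsf i(\alpha_{\mathsf s(w)}))$, with $R_w$ and $L_w$ right and left multiplication by $w$. For $\lambda>0$ let $h_\lambda$ be the fiberwise multiplication by $\lambda$ on $\mathcal W\to\mathcal G$ (and on $E \to M$); it is an automorphism of $\mathcal W\rightrightarrows E$ and acts on cochains by $(h_\lambda^*c)(w_0,\dots,w_k)=Th_\lambda^{-1}\big(c(\lambda w_0,\dots,\lambda w_k)\big)$ for $k\ge0$ and by $(h_\lambda^*\alpha)_e=Th_\lambda^{-1}(\alpha_{\lambda e})$ for $k=-1$.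 A cochain $c$ is *linear* if $h_\lambda^*c=c$ for all $\lambda>0$; $C_{\mathrm{def,lin}}(\mathcal W)$ is the space of linear deformation cochains. The cohomologies are denoted $H_{\mathrm{def}}(\mathcal W)$ and $H_{\mathrm{def,lin}}(\mathcal W)$. **Theorem.** $\delta$ maps $C_{\mathrm{def}}(\mathcal W)$ and $C_{\mathrm{def,lin}}(\mathcal W)$ to themselves and $\delta^2=0$. For every $c\in C_{\mathrm{def}}(\mathcal W)$ the pointwise limits $$c_{\mathrm{core}}=\lim_{\lambda\to0^+}\lambda\, h_\lambda^*c,\qquad c_{\mathrm{lin}}=\lim_{\lambda\to0^+}\big(h_\lambda^*c-\lambda^{-1}c_{\mathrm{core}}\big)$$ exist, $c_{\mathrm{core}}\in C_{\mathrm{def}}(\mathcal W)$ and $c_{\mathrm{lin}}\in C_{\mathrm{def,lin}}(\mathcal W)$. The linear map $\mathrm{lin}:C_{\mathrm{def}}(\mathcal W)\to C_{\mathrm{def,lin}}(\mathcal W)$, $c\mapsto c_{\mathrm{lin}}$, is a cochain map and restricts to the identity on $C_{\mathrm{def,lin}}(\mathcal W)$, i.e. it splits the inclusion $C_{\mathrm{def,lin}}(\mathcal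 W)\hookrightarrow C_{\mathrm{def}}(\mathcal W)$. In particular $$C_{\mathrm{def}}(\mathcal W)= C_{\mathrm{def,lin}}(\mathcal W)\oplus\ker(\mathrm{lin})$$ as cochain complexes, and the inclusion induces an injection $H_{\mathrm{def,lin}}(\mathcal W)\hookrightarrow H_{\mathrm{def}}(\mathcal W)$ in every degree. -/

import Mathlib

open Bundle Set Filter Topology
open scoped Manifold ContDiff

universe u

noncomputable section

section Tangent

variable {E H : Type*} [NormedAddCommGroup E] [NormedSpace ℝ E] [TopologicalSpace H]
  (I : ModelWithCorners ℝ E H) {G : Type*} [TopologicalSpace G] [ChartedSpace H G]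

/-- The identification of the tangent spaces at two equal points. (In Mathlib every tangent space
has the model vector space as underlying space, so this is the identity map.) -/
def tangentCast {x y : G} (_h : x = y) : TangentSpace I x →ₗ[ℝ] TangentSpace I y :=
  (LinearMap.id : E →ₗ[ℝ] E)

variable {I} in
theorem contMDiff_pi_eval {n : ℕ} (i : Fin n) :
    ContMDiff (ModelWithCorners.pi fun _ : Fin n => I) I ∞ (fun g : Fin n → G => g i) := by
  intro g
  rw [contMDiffAt_iff]
  refine ⟨(continuous_apply i).continuousAt, ?_⟩
  have h : ContDiffWithinAt ℝ ∞ (fun v : Fin n → E => v i)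
      (range (ModelWithCorners.pi fun _ : Fin n => I))
      (extChartAt (ModelWithCorners.pi fun _ : Fin n => I) g g) :=
    (contDiff_apply ℝ E i).contDiffWithinAt
  refine h.congr_of_eventuallyEq ?_ ?_
  · filter_upwards [extChartAt_target_mem_nhdsWithin (I := ModelWithCorners.pi fun _ => I) g]
      with y hy
    exact congrFun ((extChartAt (ModelWithCorners.pi fun _ : Fin n => I) g).right_inv hy) i
  · exact congrFun ((extChartAt (ModelWithCorners.pi fun _ : Fin n => I) g).right_inv
      (mem_extChartAt_target g)) i

variable {E' H' : Type*} [NormedAddCommGroup E'] [NormedSpace ℝ E'] [TopologicalSpace H']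
  {J : ModelWithCorners ℝ E' H'} {N : Type*} [TopologicalSpace N] [ChartedSpace H' N]
  [IsManifold I ∞ G] {I}

theorem contMDiffOn_add_along {b : N → G} {v w : ∀ x : N, TangentSpace I (b x)} {S : Set N}
    (hv : ContMDiffOn J I.tangent ∞ (fun x => (⟨b x, v x⟩ : TangentBundle I G)) S)
    (hw : ContMDiffOn J I.tangent ∞ (fun x => (⟨b x, w x⟩ : TangentBundle I G)) S) :
    ContMDiffOn J I.tangent ∞ (fun x => (⟨b x, v x + w x⟩ : TangentBundle I G)) S := by
  intro x hx
  have hv' := Bundle.contMDiffWithinAt_totalSpace.1 (hv x hx)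
  have hw' := Bundle.contMDiffWithinAt_totalSpace.1 (hw x hx)
  refine Bundle.contMDiffWithinAt_totalSpace.2 ⟨hv'.1, ?_⟩
  refine (hv'.2.add hw'.2).congr_of_eventuallyEq ?_ ?_
  · have hb : ContinuousWithinAt b S x := hv'.1.continuousWithinAt
    have hm := hb ((trivializationAt E (TangentSpace I : G → Type _) (b x)).open_baseSet.mem_nhds
      (mem_baseSet_trivializationAt E (TangentSpace I : G → Type _) (b x)))
    filter_upwards [hm] with y hy
    exact ((trivializationAt E (TangentSpace I : G → Type _) (b x)).linear ℝ hy).1 _ _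
  · exact ((trivializationAt E (TangentSpace I : G → Type _) (b x)).linear ℝ
      (mem_baseSet_trivializationAt E (TangentSpace I : G → Type _) (b x))).1 _ _

theorem contMDiffOn_smul_along {b : N → G} {v : ∀ x : N, TangentSpace I (b x)} {S : Set N} (r : ℝ)
    (hv : ContMDiffOn J I.tangent ∞ (fun x => (⟨b x, v x⟩ : TangentBundle I G)) S) :
    ContMDiffOn J I.tangent ∞ (fun x => (⟨b x, r • v x⟩ : TangentBundle I G)) S := by
  intro x hx
  have hv' := Bundle.contMDiffWithinAt_totalSpace.1 (hv x hx)
  refine Bundle.contMDiffWithinAt_totalSpace.2 ⟨hv'.1, ?_⟩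
  refine (ContMDiffWithinAt.smul (contMDiffWithinAt_const (I' := 𝓘(ℝ, ℝ)) (c := r)) hv'.2).congr_of_eventuallyEq ?_ ?_
  · have hb : ContinuousWithinAt b S x := hv'.1.continuousWithinAt
    have hm := hb ((trivializationAt E (TangentSpace I : G → Type _) (b x)).open_baseSet.mem_nhds
      (mem_baseSet_trivializationAt E (TangentSpace I : G → Type _) (b x)))
    filter_upwards [hm] with y hy
    exact ((trivializationAt E (TangentSpace I : G → Type _) (b x)).linear ℝ hy).2 _ _
  · exact ((trivializationAt E (TangentSpace I : G → Type _) (b x)).linear ℝ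
      (mem_baseSet_trivializationAt E (TangentSpace I : G → Type _) (b x))).2 _ _

theorem contMDiffOn_zero_along {b : N → G} {S : Set N} (hb : ContMDiffOn J I ∞ b S) :
    ContMDiffOn J I.tangent ∞ (fun x => (⟨b x, 0⟩ : TangentBundle I G)) S :=
  (Bundle.contMDiff_zeroSection ℝ (TangentSpace I : G → Type _)).comp_contMDiffOn hb

end Tangent

/-- A Lie groupoid `G ⇉ M`. The composition `mul g h` is meaningful for `s g = t h` only; its
values on other pairs are arbitrary and never used. Smoothness of a map on an embedded submanifold
such as `{(g, h) | s g = t h}` is `ContMDiffOn` on the corresponding subset of the ambient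
manifold. -/
structure LieGroupoid {E H E' H' : Type*} [NormedAddCommGroup E] [NormedSpace ℝ E]
    [TopologicalSpace H] [NormedAddCommGroup E'] [NormedSpace ℝ E'] [TopologicalSpace H']
    (I : ModelWithCorners ℝ E H) (J : ModelWithCorners ℝ E' H')
    (G M : Type u) [TopologicalSpace G] [ChartedSpace H G] [IsManifold I ∞ G]
    [TopologicalSpace M] [ChartedSpace H' M] [IsManifold J ∞ M] where
  s : G → M
  t : G → M
  one : M → G
  inv : G → G
  mul : G → G → G
  s_one : ∀ x, s (one x) = x
  t_one : ∀ x, t (one x) = x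
  s_inv : ∀ g, s (inv g) = t g
  t_inv : ∀ g, t (inv g) = s g
  s_mul : ∀ g h, s g = t h → s (mul g h) = s h
  t_mul : ∀ g h, s g = t h → t (mul g h) = t g
  mul_assoc : ∀ g h k, s g = t h → s h = t k → mul (mul g h) k = mul g (mul h k)
  one_mul : ∀ g, mul (one (t g)) g = g
  mul_one : ∀ g, mul g (one (s g)) = g
  inv_mul : ∀ g, mul (inv g) g = one (s g)
  mul_inv : ∀ g, mul g (inv g) = one (t g)
  submersion_s : Manifold.IsSubmersion I J ∞ s
  submersion_t : Manifold.IsSubmersion I J ∞ t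
  smooth_one : ContMDiff J I ∞ one
  smooth_inv : ContMDiff I I ∞ inv
  smooth_mul : ContMDiffOn (I.prod I) I ∞ (fun p : G × G => mul p.1 p.2) {p | s p.1 = t p.2}

namespace LieGroupoid

section Deformation

variable {E H E' H' : Type*} [NormedAddCommGroup E] [NormedSpace ℝ E]
  [TopologicalSpace H] [NormedAddCommGroup E'] [NormedSpace ℝ E'] [TopologicalSpace H']
  {I : ModelWithCorners ℝ E H} {J : ModelWithCorners ℝ E' H'}
  {G M : Type u} [TopologicalSpace G] [ChartedSpace H G] [IsManifold I ∞ G]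
  [TopologicalSpace M] [ChartedSpace H' M] [IsManifold J ∞ M]
  (𝒢 : LieGroupoid I J G M)

/-- The set of `(n + 1)`-tuples `(g₀, …, gₙ)` of composable arrows. -/
def composable (n : ℕ) : Set (Fin (n + 1) → G) :=
  {g | ∀ i : Fin n, 𝒢.s (g i.castSucc) = 𝒢.t (g i.succ)}

/-- The points on which a cochain of degree `n - 1` is evaluated: the points of `M` for `n = 0`,
and the `n`-tuples of composable arrows for `n > 0`. -/
def Pt : ℕ → Type u
  | 0 => M
  | n + 1 => 𝒢.composable n

/-- The arrow at which the value of a cochain is tangent: the unit `1ₓ` at `x`, respectively the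
first arrow `g₀` of `(g₀, …, gₙ)`. -/
def foot : ∀ n : ℕ, 𝒢.Pt n → G
  | 0, x => 𝒢.one x
  | _ + 1, g => g.1 0

/-- All set-theoretic sections; the deformation cochains are the members of `defCochains` below.
The index is shifted: `Cochain n` is meant for cochains of degree `n - 1`. -/
abbrev Cochain (n : ℕ) := ∀ p : 𝒢.Pt n, TangentSpace I (𝒢.foot n p)

open Classical in
/-- Extension by zero of a section over the composable tuples to all tuples. -/
def extendZero {n : ℕ} (c : 𝒢.Cochain (n + 1)) (g : Fin (n + 1) → G) : TangentSpace I (g 0) :=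
  if h : g ∈ 𝒢.composable n then c ⟨g, h⟩ else 0

theorem extendZero_of_mem {n : ℕ} {c : 𝒢.Cochain (n + 1)} {g : Fin (n + 1) → G}
    (h : g ∈ 𝒢.composable n) : 𝒢.extendZero c g = c ⟨g, h⟩ :=
  dif_pos h

/-- Evaluation of a cochain at a point of `M`. -/
def evalUnit (x : M) : 𝒢.Cochain 0 →ₗ[ℝ] TangentSpace I (𝒢.one x) :=
  LinearMap.proj (φ := fun p : 𝒢.Pt 0 => TangentSpace I (𝒢.foot 0 p)) x

/-- Evaluation of a cochain at a tuple of composable arrows. -/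
def evalTuple {n : ℕ} (g : 𝒢.composable n) : 𝒢.Cochain (n + 1) →ₗ[ℝ] TangentSpace I (g.1 0) :=
  LinearMap.proj (φ := fun p : 𝒢.Pt (n + 1) => TangentSpace I (𝒢.foot (n + 1) p)) g

/-- Degree `-1` deformation cochains: smooth sections of the Lie algebroid `A = ker(Ts)|_M`. -/
def IsAlgebroidSection (α : 𝒢.Cochain 0) : Prop :=
  (∀ x : M, mfderiv I J 𝒢.s (𝒢.one x) (α x) = 0) ∧
  ContMDiff J I.tangent ∞ (fun x : M => (⟨𝒢.one x, α x⟩ : TangentBundle I G))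

/-- Deformation cochains of degree `n ≥ 0`: smooth maps `c` from the manifold of composable
`(n + 1)`-tuples to `TG` with `c (g₀, …, gₙ)` tangent to `G` at `g₀` such that `Ts (c (g₀, …, gₙ))`
does not depend on `g₀`, i.e. depends only on `(g₁, …, gₙ)`, and on the point `s g₀` if `n = 0`
(for `n > 0` the equality `s g₀ = s g₀'` follows from `g₁ = g₁'`). -/
def IsDeformationCochain {n : ℕ} (c : 𝒢.Cochain (n + 1)) : Prop :=
  ContMDiffOn (ModelWithCorners.pi fun _ : Fin (n + 1) => I) I.tangent ∞
    (fun g : Fin (n + 1) → G => (⟨g 0, 𝒢.extendZero c g⟩ : TangentBundle I G))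
    (𝒢.composable n) ∧
  ∀ g g' : 𝒢.composable n, (∀ i : Fin n, g.1 i.succ = g'.1 i.succ) →
    ∀ h : 𝒢.s (g.1 0) = 𝒢.s (g'.1 0),
      tangentCast J h (mfderiv I J 𝒢.s (g.1 0) (c g)) = mfderiv I J 𝒢.s (g'.1 0) (c g')

/-- The space `C^{n-1}_def` of deformation cochains of degree `n - 1`. -/
def defCochains : ∀ n : ℕ, Submodule ℝ (𝒢.Cochain n)
  | 0 =>
    { carrier := {α | 𝒢.IsAlgebroidSection α}
      add_mem' := fun {α β} hα hβ => by
        refine ⟨fun x => ?_, ?_⟩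
        · have := (mfderiv I J 𝒢.s (𝒢.one x)).map_add (α x) (β x)
          exact this.trans (by rw [hα.1 x, hβ.1 x, add_zero])
        · exact contMDiffOn_univ.1
            (contMDiffOn_add_along (contMDiffOn_univ.2 hα.2) (contMDiffOn_univ.2 hβ.2))
      zero_mem' := by
        refine ⟨fun x => (mfderiv I J 𝒢.s (𝒢.one x)).map_zero, ?_⟩
        exact contMDiffOn_univ.1 (contMDiffOn_zero_along (contMDiffOn_univ.2 𝒢.smooth_one))
      smul_mem' := fun r α hα => by
        refine ⟨fun x => ?_, ?_⟩
        · have := (mfderiv I J 𝒢.s (𝒢.one x)).map_smul r (α x)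
          exact this.trans (by rw [hα.1 x, smul_zero])
        · exact contMDiffOn_univ.1 (contMDiffOn_smul_along r (contMDiffOn_univ.2 hα.2)) }
  | n + 1 =>
    { carrier := {c | 𝒢.IsDeformationCochain c}
      add_mem' := fun {c d} hc hd => by
        refine ⟨?_, fun g g' hg h => ?_⟩
        · refine (contMDiffOn_add_along hc.1 hd.1).congr fun g hg => ?_
          rw [𝒢.extendZero_of_mem hg, 𝒢.extendZero_of_mem hg, 𝒢.extendZero_of_mem hg]
          rfl
        · have h1 := (mfderiv I J 𝒢.s (g.1 0)).map_add (c g) (d g)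
          have h2 := (mfderiv I J 𝒢.s (g'.1 0)).map_add (c g') (d g')
          refine (congrArg (tangentCast J h) h1).trans (Eq.trans ?_ h2.symm)
          rw [map_add, hc.2 g g' hg h, hd.2 g g' hg h]
      zero_mem' := by
        refine ⟨?_, fun g g' hg h => ?_⟩
        · refine (contMDiffOn_zero_along (contMDiff_pi_eval (I := I) 0).contMDiffOn).congr
            fun g hg => ?_
          rw [𝒢.extendZero_of_mem hg]
          rfl
        · have h1 := (mfderiv I J 𝒢.s (g.1 0)).map_zero
          have h2 := (mfderiv I J 𝒢.s (g'.1 0)).map_zero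
          refine (congrArg (tangentCast J h) h1).trans (Eq.trans ?_ h2.symm)
          rw [map_zero]
      smul_mem' := fun r c hc => by
        refine ⟨?_, fun g g' hg h => ?_⟩
        · refine (contMDiffOn_smul_along r hc.1).congr fun g hg => ?_
          rw [𝒢.extendZero_of_mem hg, 𝒢.extendZero_of_mem hg]
          rfl
        · have h1 := (mfderiv I J 𝒢.s (g.1 0)).map_smul r (c g)
          have h2 := (mfderiv I J 𝒢.s (g'.1 0)).map_smul r (c g')
          refine (congrArg (tangentCast J h) h1).trans (Eq.trans ?_ h2.symm)
          rw [map_smul, hc.2 g g' hg h] }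

/-! ### The differential -/

/-- The tangent map at `(a, b)` of the division map `(a, b) ↦ a b⁻¹`, defined on the pairs of arrows
with the same source. The values on pairs `(u, v)` with `Ts u = Ts v`, which are the tangent vectors
to the submanifold `{s a = s b}`, do not depend on the choice made by `mfderivWithin`. -/
def tangentDiv (a b : G) :
    TangentSpace I a × TangentSpace I b →ₗ[ℝ] TangentSpace I (𝒢.mul a (𝒢.inv b)) :=
  (mfderivWithin (I.prod I) I (fun p : G × G => 𝒢.mul p.1 (𝒢.inv p.2))
    {p | 𝒢.s p.1 = 𝒢.s p.2} (a, b)).toLinearMap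

/-- The right-invariant vector field `g ↦ TR_g (α_{t g})`, where `R_g` is defined on
`{h | s h = t g}`. -/
def rightInvariant (g : G) : 𝒢.Cochain 0 →ₗ[ℝ] TangentSpace I g :=
  tangentCast I (𝒢.one_mul g) ∘ₗ
    (mfderivWithin I I (fun h => 𝒢.mul h g) {h | 𝒢.s h = 𝒢.t g} (𝒢.one (𝒢.t g))).toLinearMap ∘ₗ
      𝒢.evalUnit (𝒢.t g)

theorem inv_one (x : M) : 𝒢.inv (𝒢.one x) = 𝒢.one x := by
  have h := 𝒢.mul_one (𝒢.inv (𝒢.one x))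
  rw [𝒢.s_inv, 𝒢.t_one] at h
  rw [← h, 𝒢.inv_mul, 𝒢.s_one]

/-- The left-invariant vector field `g ↦ TL_g (Ti (α_{s g}))`, where `L_g` is defined on
`{h | t h = s g}`. -/
def leftInvariant (g : G) : 𝒢.Cochain 0 →ₗ[ℝ] TangentSpace I g :=
  tangentCast I (𝒢.mul_one g) ∘ₗ
    (mfderivWithin I I (fun h => 𝒢.mul g h) {h | 𝒢.t h = 𝒢.s g} (𝒢.one (𝒢.s g))).toLinearMap ∘ₗ
      tangentCast I (𝒢.inv_one (𝒢.s g)) ∘ₗ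
        (mfderiv I I 𝒢.inv (𝒢.one (𝒢.s g))).toLinearMap ∘ₗ
          𝒢.evalUnit (𝒢.s g)

/-- `(g₀, …, gₙ₊₁) ↦ (g₀, …, gⱼ gⱼ₊₁, …, gₙ₊₁)`. -/
def contract {n : ℕ} (j : Fin (n + 1)) (g : 𝒢.composable (n + 1)) : 𝒢.composable n :=
  ⟨Fin.contractNth j.castSucc 𝒢.mul g.1, fun i => by
    have h0 : 𝒢.s (g.1 i.castSucc.castSucc) = 𝒢.t (g.1 i.castSucc.succ) := g.2 i.castSucc
    have h1 : 𝒢.s (g.1 i.castSucc.succ) = 𝒢.t (g.1 i.succ.succ) := g.2 i.succ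
    have hc : i.succ.castSucc = i.castSucc.succ := rfl
    simp only [Fin.contractNth, Fin.val_castSucc, Fin.val_succ, hc]
    split_ifs <;> first | omega | simp only [𝒢.s_mul _ _ h0, 𝒢.t_mul _ _ h1, h0, h1]⟩

/-- `(g₀, …, gₙ₊₁) ↦ (g₁, …, gₙ₊₁)`. -/
def dropFirst {n : ℕ} (g : 𝒢.composable (n + 1)) : 𝒢.composable n :=
  ⟨fun i => g.1 i.succ, fun i => g.2 i.succ⟩

/-- `(g₀, …, gₙ₊₁) ↦ (g₀, …, gₙ)`. -/
def dropLast {n : ℕ} (g : 𝒢.composable (n + 1)) : 𝒢.composable n :=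
  ⟨fun i => g.1 i.castSucc, fun i => g.2 i.castSucc⟩

theorem div_contract {n : ℕ} (g : 𝒢.composable (n + 1)) :
    𝒢.mul ((𝒢.contract 0 g).1 0) (𝒢.inv ((𝒢.dropFirst g).1 0)) = g.1 0 := by
  have h : 𝒢.s (g.1 0) = 𝒢.t (g.1 1) := g.2 0
  have h1 : (𝒢.contract 0 g).1 0 = 𝒢.mul (g.1 0) (g.1 1) := rfl
  have h2 : (𝒢.dropFirst g).1 0 = g.1 1 := rfl
  rw [h1, h2, 𝒢.mul_assoc _ _ _ h (𝒢.t_inv _).symm, 𝒢.mul_inv, ← h, 𝒢.mul_one]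

theorem contract_succ_zero {n : ℕ} (i : Fin n) (g : 𝒢.composable (n + 1)) :
    (𝒢.contract i.succ g).1 0 = g.1 0 := by
  simp [contract, Fin.contractNth]

theorem dropLast_zero {n : ℕ} (g : 𝒢.composable (n + 1)) : (𝒢.dropLast g).1 0 = g.1 0 := rfl

/-- The differential `δ : C^{n-1} → C^n`. For `n = 0` it is `δα = ←α + →α`; for `c` of degree
`n ≥ 0` it is
`δc (g₀, …, gₙ₊₁) = - Tm̄ (c (g₀g₁, …, gₙ₊₁), c (g₁, …, gₙ₊₁))
  + ∑_{i=1}^{n} (-1)^{i-1} c (g₀, …, gᵢgᵢ₊₁, …, gₙ₊₁) + (-1)^n c (g₀, …, gₙ)`. -/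
def diff : ∀ n : ℕ, 𝒢.Cochain n →ₗ[ℝ] 𝒢.Cochain (n + 1)
  | 0 => LinearMap.pi fun g : 𝒢.composable 0 =>
      𝒢.leftInvariant (g.1 0) + 𝒢.rightInvariant (g.1 0)
  | n + 1 => LinearMap.pi fun g : 𝒢.composable (n + 1) =>
      -(tangentCast I (𝒢.div_contract g) ∘ₗ
          𝒢.tangentDiv ((𝒢.contract 0 g).1 0) ((𝒢.dropFirst g).1 0) ∘ₗ
            LinearMap.prod (𝒢.evalTuple (𝒢.contract 0 g)) (𝒢.evalTuple (𝒢.dropFirst g)))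
      + ∑ i : Fin n, (-1 : ℝ) ^ (i : ℕ) •
          (tangentCast I (𝒢.contract_succ_zero i g) ∘ₗ 𝒢.evalTuple (𝒢.contract i.succ g))
      + (-1 : ℝ) ^ n • (tangentCast I (𝒢.dropLast_zero g) ∘ₗ 𝒢.evalTuple (𝒢.dropLast g))

/-! ### Subcomplexes and cohomology

`D` is a graded subspace of the space of all sections, e.g. the deformation cochains. -/

/-- The cocycles of `D` in degree `n - 1`. -/
def cocycles (D : ∀ n : ℕ, Submodule ℝ (𝒢.Cochain n)) (n : ℕ) : Submodule ℝ (𝒢.Cochain n) :=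
  D n ⊓ LinearMap.ker (𝒢.diff n)

/-- The coboundaries of `D` in degree `n - 1`. -/
def coboundaries (D : ∀ n : ℕ, Submodule ℝ (𝒢.Cochain n)) : ∀ n : ℕ, Submodule ℝ (𝒢.Cochain n)
  | 0 => ⊥
  | n + 1 => (D n).map (𝒢.diff n)

/-- The cohomology of `D` in degree `n - 1`. -/
abbrev Cohomology (D : ∀ n : ℕ, Submodule ℝ (𝒢.Cochain n)) (n : ℕ) :=
  𝒢.cocycles D n ⧸ (𝒢.coboundaries D n).submoduleOf (𝒢.cocycles D n)

theorem cocycles_mono {D D' : ∀ n : ℕ, Submodule ℝ (𝒢.Cochain n)} (h : ∀ n, D n ≤ D' n) (n : ℕ) :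
    𝒢.cocycles D n ≤ 𝒢.cocycles D' n :=
  inf_le_inf_right _ (h n)

theorem coboundaries_mono {D D' : ∀ n : ℕ, Submodule ℝ (𝒢.Cochain n)} (h : ∀ n, D n ≤ D' n) :
    ∀ n : ℕ, 𝒢.coboundaries D n ≤ 𝒢.coboundaries D' n
  | 0 => le_rfl
  | n + 1 => Submodule.map_mono (h n)

/-- The map in cohomology induced by an inclusion `D ⊆ D'`. -/
def cohomologyMap {D D' : ∀ n : ℕ, Submodule ℝ (𝒢.Cochain n)} (h : ∀ n, D n ≤ D' n) (n : ℕ) :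
    𝒢.Cohomology D n →ₗ[ℝ] 𝒢.Cohomology D' n :=
  Submodule.mapQ _ _ (Submodule.inclusion (𝒢.cocycles_mono h n))
    fun _ hc => 𝒢.coboundaries_mono h n hc

end Deformation

section Morphisms

variable {E₁ H₁ E₁' H₁' E₂ H₂ E₂' H₂' : Type*}
  [NormedAddCommGroup E₁] [NormedSpace ℝ E₁] [TopologicalSpace H₁]
  [NormedAddCommGroup E₁'] [NormedSpace ℝ E₁'] [TopologicalSpace H₁']
  [NormedAddCommGroup E₂] [NormedSpace ℝ E₂] [TopologicalSpace H₂]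
  [NormedAddCommGroup E₂'] [NormedSpace ℝ E₂'] [TopologicalSpace H₂']
  {I₁ : ModelWithCorners ℝ E₁ H₁} {J₁ : ModelWithCorners ℝ E₁' H₁'}
  {I₂ : ModelWithCorners ℝ E₂ H₂} {J₂ : ModelWithCorners ℝ E₂' H₂'}
  {G₁ M₁ G₂ M₂ : Type u}
  [TopologicalSpace G₁] [ChartedSpace H₁ G₁] [IsManifold I₁ ∞ G₁]
  [TopologicalSpace M₁] [ChartedSpace H₁' M₁] [IsManifold J₁ ∞ M₁]
  [TopologicalSpace G₂] [ChartedSpace H₂ G₂] [IsManifold I₂ ∞ G₂]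
  [TopologicalSpace M₂] [ChartedSpace H₂' M₂] [IsManifold J₂ ∞ M₂]

/-- `Φ` is a morphism of Lie groupoids over `f`. -/
structure IsHom (𝒢₁ : LieGroupoid I₁ J₁ G₁ M₁) (𝒢₂ : LieGroupoid I₂ J₂ G₂ M₂)
    (Φ : G₁ → G₂) (f : M₁ → M₂) : Prop where
  smooth : ContMDiff I₁ I₂ ∞ Φ
  smooth_base : ContMDiff J₁ J₂ ∞ f
  map_s : ∀ g, 𝒢₂.s (Φ g) = f (𝒢₁.s g)
  map_t : ∀ g, 𝒢₂.t (Φ g) = f (𝒢₁.t g)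
  map_mul : ∀ g h, 𝒢₁.s g = 𝒢₁.t h → Φ (𝒢₁.mul g h) = 𝒢₂.mul (Φ g) (Φ h)
  map_one : ∀ x, Φ (𝒢₁.one x) = 𝒢₂.one (f x)
  map_inv : ∀ g, Φ (𝒢₁.inv g) = 𝒢₂.inv (Φ g)

/-- An automorphism of a Lie groupoid, together with its inverse. -/
structure Aut (𝒢 : LieGroupoid I₁ J₁ G₁ M₁) where
  toFun : G₁ → G₁
  base : M₁ → M₁
  invFun : G₁ → G₁
  invBase : M₁ → M₁
  isHom : 𝒢.IsHom 𝒢 toFun base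
  isHom_inv : 𝒢.IsHom 𝒢 invFun invBase
  left_inv : ∀ g, invFun (toFun g) = g
  right_inv : ∀ g, toFun (invFun g) = g
  base_left_inv : ∀ x, invBase (base x) = x
  base_right_inv : ∀ x, base (invBase x) = x

variable {𝒢 : LieGroupoid I₁ J₁ G₁ M₁} (Ψ : 𝒢.Aut)

/-- `(g₀, …, gₙ) ↦ (Ψ g₀, …, Ψ gₙ)`. -/
def Aut.mapTuple {n : ℕ} (g : 𝒢.composable n) : 𝒢.composable n :=
  ⟨fun i => Ψ.toFun (g.1 i), fun i => by
    rw [Ψ.isHom.map_s, Ψ.isHom.map_t, g.2 i]⟩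

theorem Aut.inv_one_base (x : M₁) : Ψ.invFun (𝒢.one (Ψ.base x)) = 𝒢.one x := by
  rw [← Ψ.isHom.map_one, Ψ.left_inv]

/-- The pull-back of cochains along an automorphism: in degree `-1`,
`(Ψ^* α)_x = TΨ⁻¹ (α_{f x})` where `f` is the map induced by `Ψ` on `M`; in degrees `≥ 0`,
`(Ψ^* c) (g₀, …, gₙ) = TΨ⁻¹ (c (Ψ g₀, …, Ψ gₙ))`. -/
def Aut.pullback : ∀ n : ℕ, 𝒢.Cochain n →ₗ[ℝ] 𝒢.Cochain n
  | 0 => LinearMap.pi fun x : M₁ =>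
      tangentCast I₁ (Ψ.inv_one_base x) ∘ₗ
        (mfderiv I₁ I₁ Ψ.invFun (𝒢.one (Ψ.base x))).toLinearMap ∘ₗ 𝒢.evalUnit (Ψ.base x)
  | n + 1 => LinearMap.pi fun g : 𝒢.composable n =>
      tangentCast I₁ (Ψ.left_inv (g.1 0)) ∘ₗ
        (mfderiv I₁ I₁ Ψ.invFun (Ψ.toFun (g.1 0))).toLinearMap ∘ₗ 𝒢.evalTuple (Ψ.mapTuple g)

end Morphisms

end LieGroupoid

section FiberOperations

variable {B : Type*} {F : Type*} {V : B → Type*} [∀ x, AddCommGroup (V x)] [∀ x, Module ℝ (V x)]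

/-- Fiberwise multiplication by `r` on the total space of a vector bundle. -/
def fiberSMul (r : ℝ) (w : TotalSpace F V) : TotalSpace F V := ⟨w.proj, r • w.2⟩

theorem fiberSMul_cancel {a b : ℝ} (h : a * b = 1) (w : TotalSpace F V) :
    fiberSMul a (fiberSMul b w) = w := by
  unfold fiberSMul
  rw [smul_smul, h, one_smul]

/-- Fiberwise addition of two points of the total space in the same fiber. -/
def fiberAdd (w w' : TotalSpace F V) (h : w.proj = w'.proj) : TotalSpace F V :=
  ⟨w.proj, w.2 + (h.symm ▸ w'.2 : V w.proj)⟩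

end FiberOperations

/-- A VB-groupoid `(W ⇉ E; G ⇉ M)`: two Lie groupoids and two vector bundles `W → G`, `E → M` such
that the projection, the zero section, the scalar multiplications and the addition
`W ×_G W → W` over `E ×_M E → E` are morphisms of Lie groupoids. (Smoothness of the addition holds
in any smooth vector bundle.) -/
structure VBGroupoid {EG HG EM HM : Type*} [NormedAddCommGroup EG] [NormedSpace ℝ EG]
    [TopologicalSpace HG] [NormedAddCommGroup EM] [NormedSpace ℝ EM] [TopologicalSpace HM]
    (IG : ModelWithCorners ℝ EG HG) (IM : ModelWithCorners ℝ EM HM)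
    {G M : Type u} [TopologicalSpace G] [ChartedSpace HG G] [IsManifold IG ∞ G]
    [TopologicalSpace M] [ChartedSpace HM M] [IsManifold IM ∞ M]
    (FW : Type*) [NormedAddCommGroup FW] [NormedSpace ℝ FW]
    (W : G → Type u) [∀ g, AddCommGroup (W g)] [∀ g, Module ℝ (W g)]
    [∀ g, TopologicalSpace (W g)] [TopologicalSpace (TotalSpace FW W)]
    [FiberBundle FW W] [VectorBundle ℝ FW W] [ContMDiffVectorBundle ∞ FW W IG]
    (FE : Type*) [NormedAddCommGroup FE] [NormedSpace ℝ FE]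
    (E : M → Type u) [∀ x, AddCommGroup (E x)] [∀ x, Module ℝ (E x)]
    [∀ x, TopologicalSpace (E x)] [TopologicalSpace (TotalSpace FE E)]
    [FiberBundle FE E] [VectorBundle ℝ FE E] [ContMDiffVectorBundle ∞ FE E IM] where
  total : LieGroupoid (IG.prod 𝓘(ℝ, FW)) (IM.prod 𝓘(ℝ, FE)) (TotalSpace FW W) (TotalSpace FE E)
  base : LieGroupoid IG IM G M
  proj_hom : total.IsHom base TotalSpace.proj TotalSpace.proj
  zero_hom : base.IsHom total (zeroSection FW W) (zeroSection FE E)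
  smul_hom : ∀ r : ℝ, total.IsHom total (fiberSMul r) (fiberSMul r)
  add_s : ∀ w w' (h : w.proj = w'.proj) (h' : (total.s w).proj = (total.s w').proj),
    total.s (fiberAdd w w' h) = fiberAdd (total.s w) (total.s w') h'
  add_t : ∀ w w' (h : w.proj = w'.proj) (h' : (total.t w).proj = (total.t w').proj),
    total.t (fiberAdd w w' h) = fiberAdd (total.t w) (total.t w') h'
  add_one : ∀ e e' (h : e.proj = e'.proj) (h' : (total.one e).proj = (total.one e').proj),
    total.one (fiberAdd e e' h) = fiberAdd (total.one e) (total.one e') h'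
  add_inv : ∀ w w' (h : w.proj = w'.proj) (h' : (total.inv w).proj = (total.inv w').proj),
    total.inv (fiberAdd w w' h) = fiberAdd (total.inv w) (total.inv w') h'
  add_mul : ∀ w₁ w₁' w₂ w₂' (h₁ : w₁.proj = w₁'.proj) (h₂ : w₂.proj = w₂'.proj)
    (h' : (total.mul w₁ w₂).proj = (total.mul w₁' w₂').proj),
    total.s w₁ = total.t w₂ → total.s w₁' = total.t w₂' →
    total.mul (fiberAdd w₁ w₁' h₁) (fiberAdd w₂ w₂' h₂) =
      fiberAdd (total.mul w₁ w₂) (total.mul w₁' w₂') h'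

namespace VBGroupoid

variable {EG HG EM HM : Type*} [NormedAddCommGroup EG] [NormedSpace ℝ EG]
  [TopologicalSpace HG] [NormedAddCommGroup EM] [NormedSpace ℝ EM] [TopologicalSpace HM]
  {IG : ModelWithCorners ℝ EG HG} {IM : ModelWithCorners ℝ EM HM}
  {G M : Type u} [TopologicalSpace G] [ChartedSpace HG G] [IsManifold IG ∞ G]
  [TopologicalSpace M] [ChartedSpace HM M] [IsManifold IM ∞ M]
  {FW : Type*} [NormedAddCommGroup FW] [NormedSpace ℝ FW]
  {W : G → Type u} [∀ g, AddCommGroup (W g)] [∀ g, Module ℝ (W g)]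
  [∀ g, TopologicalSpace (W g)] [TopologicalSpace (TotalSpace FW W)]
  [FiberBundle FW W] [VectorBundle ℝ FW W] [ContMDiffVectorBundle ∞ FW W IG]
  {FE : Type*} [NormedAddCommGroup FE] [NormedSpace ℝ FE]
  {E : M → Type u} [∀ x, AddCommGroup (E x)] [∀ x, Module ℝ (E x)]
  [∀ x, TopologicalSpace (E x)] [TopologicalSpace (TotalSpace FE E)]
  [FiberBundle FE E] [VectorBundle ℝ FE E] [ContMDiffVectorBundle ∞ FE E IM]
  (V : VBGroupoid IG IM FW W FE E)

/-- The homothety `h_r : W → W`, `r > 0`, as an automorphism of `W ⇉ E`. -/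
def homothety (r : Ioi (0 : ℝ)) : V.total.Aut where
  toFun := fiberSMul (r : ℝ)
  base := fiberSMul (r : ℝ)
  invFun := fiberSMul (r : ℝ)⁻¹
  invBase := fiberSMul (r : ℝ)⁻¹
  isHom := V.smul_hom r
  isHom_inv := V.smul_hom (r : ℝ)⁻¹
  left_inv := fiberSMul_cancel (inv_mul_cancel₀ (ne_of_gt r.2))
  right_inv := fiberSMul_cancel (mul_inv_cancel₀ (ne_of_gt r.2))
  base_left_inv := fiberSMul_cancel (inv_mul_cancel₀ (ne_of_gt r.2))
  base_right_inv := fiberSMul_cancel (mul_inv_cancel₀ (ne_of_gt r.2))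

/-- The action `c ↦ h_r^* c` on cochains of degree `n - 1`. -/
def hpull (r : Ioi (0 : ℝ)) (n : ℕ) : V.total.Cochain n →ₗ[ℝ] V.total.Cochain n :=
  (V.homothety r).pullback n

/-- The space `C^{n-1}_def(W)` of deformation cochains of `W ⇉ E` of degree `n - 1`. -/
abbrev defCochains (n : ℕ) : Submodule ℝ (V.total.Cochain n) := V.total.defCochains n

/-- The space `C^{n-1}_{def,lin}(W)` of linear deformation cochains of degree `n - 1`. -/
def linCochains (n : ℕ) : Submodule ℝ (V.total.Cochain n) where
  carrier := {c | c ∈ V.defCochains n ∧ ∀ r : Ioi (0 : ℝ), V.hpull r n c = c}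
  add_mem' := fun hc hd =>
    ⟨add_mem hc.1 hd.1, fun r => by rw [map_add, hc.2 r, hd.2 r]⟩
  zero_mem' := ⟨zero_mem _, fun r => map_zero _⟩
  smul_mem' := fun a c hc => ⟨Submodule.smul_mem _ a hc.1, fun r => by rw [map_smul, hc.2 r]⟩

theorem linCochains_le (n : ℕ) : V.linCochains n ≤ V.defCochains n := fun _ hc => hc.1

/-- The filter `r → 0`, `r > 0`. -/
def zeroPlus : Filter (Ioi (0 : ℝ)) := comap (fun r => (r : ℝ)) (𝓝 0)

/-- `c₀` is the pointwise limit `lim_{r → 0} r • h_r^* c`. -/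
def IsCorePart {n : ℕ} (c c₀ : V.total.Cochain n) : Prop :=
  ∀ p, Tendsto (fun r : Ioi (0 : ℝ) => (r : ℝ) • V.hpull r n c p) zeroPlus (𝓝 (c₀ p))

/-- `c₁` is the linearization of `c`: the limit `c_core = lim_{r → 0} r • h_r^* c` exists as a
deformation cochain, and `c₁` is the pointwise limit `lim_{r → 0} (h_r^* c - r⁻¹ • c_core)`. -/
def IsLinearization {n : ℕ} (c c₁ : V.total.Cochain n) : Prop :=
  ∃ c₀ ∈ V.defCochains n, V.IsCorePart c c₀ ∧
    ∀ p, Tendsto (fun r : Ioi (0 : ℝ) => V.hpull r n c p - (r : ℝ)⁻¹ • c₀ p) zeroPlus (𝓝 (c₁ p))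

end VBGroupoid

end

/-!
The tangent map of the division map `m̄ (g, h) = g h⁻¹` is computed on velocities: `Tm̄ (u, v)` is
the velocity of `γ η⁻¹` for any curves `γ`, `η` with velocities `u`, `v` and `s ∘ γ = s ∘ η`, and
such curves exist because `s` is a submersion. Identities between arrows thus become identities for
`Tm̄`, which give `δ² = 0` and the stability of deformation cochains under `δ`.

For the linearization, let `(a (λ), b (λ))` be the base and fiber components of `c (λ w₀, …, λ wₖ)`
in a bundle chart. They are smooth in `λ` up to `λ = 0`, and `h_λ^* c` has components
`(a (λ), λ⁻¹ b (λ))`. Hence `c_core = (0, b (0))` and `c_lin = (a (0), b' (0))`, which are again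
smooth. Since `h_λ^* h_μ^* = h_{λμ}^*`, the pull-back `h_μ^*` multiplies `c_core` by `μ⁻¹` and fixes
`c_lin`. Finally `δ` commutes with `h_λ^*` and with pointwise limits, hence with `lin`.
-/

section ParameterDerivative

variable {𝕜 E F : Type*} [NontriviallyNormedField 𝕜] [NormedAddCommGroup E] [NormedSpace 𝕜 E]
  [NormedAddCommGroup F] [NormedSpace 𝕜 F]

theorem contDiffWithinAt_deriv_fst_of_succ {n : ℕ} {f : 𝕜 × E → F} {S : Set E} {t₀ : 𝕜} {x₀ : E}
    (hx₀ : x₀ ∈ S) (hf : ContDiffWithinAt 𝕜 (n + 1) f (univ ×ˢ S) (t₀, x₀)) :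
    ContDiffWithinAt 𝕜 n (fun x => deriv (fun t => f (t, x)) t₀) S x₀ := by
  obtain ⟨u, hu, -, -, f', hf', hf'_smooth⟩ :=
    (contDiffWithinAt_succ_iff_hasFDerivWithinAt' (by simp)).1 hf
  rw [insert_eq_of_mem (show (t₀, x₀) ∈ univ ×ˢ S from ⟨mem_univ _, hx₀⟩)] at hu
  have hslice : ContDiffWithinAt 𝕜 n (fun x : E => (t₀, x)) S x₀ := by fun_prop
  have hmaps : MapsTo (fun x : E => (t₀, x)) S (univ ×ˢ S) := fun x hx => ⟨mem_univ _, hx⟩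
  have hderiv : ∀ x ∈ S, (t₀, x) ∈ u → deriv (fun t => f (t, x)) t₀ = f' (t₀, x) (1, 0) := by
    intro x hx hxu
    have hline : HasDerivAt (fun t : 𝕜 => (t, x)) ((1 : 𝕜), (0 : E)) t₀ :=
      (hasDerivAt_id t₀).prodMk (hasDerivAt_const _ _)
    exact ((hf' _ hxu).comp_hasDerivAt_of_eq t₀ hline
      (Eventually.of_forall fun t => ⟨mem_univ t, hx⟩) rfl).deriv
  refine ((hf'_smooth.comp x₀ hslice hmaps).clm_apply
    (contDiffWithinAt_const (c := ((1 : 𝕜), (0 : E))))).congr_of_eventuallyEq ?_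
      (hderiv x₀ hx₀ (mem_of_mem_nhdsWithin (hmaps hx₀) hu))
  filter_upwards [hslice.continuousWithinAt.tendsto_nhdsWithin hmaps hu, self_mem_nhdsWithin]
    with x hxu hx
  exact hderiv x hx hxu

theorem contDiffWithinAt_deriv_fst {f : 𝕜 × E → F} {S : Set E} {t₀ : 𝕜} {x₀ : E} (hx₀ : x₀ ∈ S)
    (hf : ContDiffWithinAt 𝕜 ∞ f (univ ×ˢ S) (t₀, x₀)) :
    ContDiffWithinAt 𝕜 ∞ (fun x => deriv (fun t => f (t, x)) t₀) S x₀ :=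
  contDiffWithinAt_infty.2 fun _ =>
    contDiffWithinAt_deriv_fst_of_succ hx₀ (hf.of_le (by exact_mod_cast le_top))

variable {E' H' : Type*} [NormedAddCommGroup E'] [NormedSpace 𝕜 E'] [TopologicalSpace H']
  {J : ModelWithCorners 𝕜 E' H'} {N : Type*} [TopologicalSpace N] [ChartedSpace H' N]

theorem contMDiffWithinAt_of_comp_extChartAt_symm {n : WithTop ℕ∞} {g : N → F} {S : Set N} {x₀ : N}
    (hx₀ : x₀ ∈ S) (hg : ContDiffWithinAt 𝕜 n (g ∘ (extChartAt J x₀).symm)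
      ((extChartAt J x₀).symm ⁻¹' S ∩ range J) (extChartAt J x₀ x₀)) :
    ContMDiffWithinAt J 𝓘(𝕜, F) n g S x₀ := by
  refine contMDiffWithinAt_iff.2 ⟨?_, hg⟩
  have hmaps : MapsTo (extChartAt J x₀) (S ∩ (extChartAt J x₀).source)
      ((extChartAt J x₀).symm ⁻¹' S ∩ range J) := fun x hx =>
    ⟨by rw [mem_preimage, (extChartAt J x₀).left_inv hx.2]; exact hx.1,
      extChartAt_target_subset_range x₀ ((extChartAt J x₀).map_source hx.2)⟩
  have hcomp := hg.continuousWithinAt.comp (continuousAt_extChartAt x₀).continuousWithinAt hmaps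
  refine (continuousWithinAt_inter (extChartAt_source_mem_nhds (I := J) x₀)).1
    (hcomp.congr_of_mem (fun x hx => ?_) ⟨hx₀, mem_extChartAt_source x₀⟩)
  simp only [Function.comp_apply, (extChartAt J x₀).left_inv hx.2]

theorem contMDiffWithinAt_deriv_fst {f : 𝕜 × N → F} {S : Set N} {t₀ : 𝕜} {x₀ : N} (hx₀ : x₀ ∈ S)
    (hf : ContMDiffWithinAt (𝓘(𝕜, 𝕜).prod J) 𝓘(𝕜, F) ∞ f (univ ×ˢ S) (t₀, x₀)) :
    ContMDiffWithinAt J 𝓘(𝕜, F) ∞ (fun x => deriv (fun t => f (t, x)) t₀) S x₀ := by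
  have hset : (extChartAt (𝓘(𝕜, 𝕜).prod J) (t₀, x₀)).symm ⁻¹' (univ ×ˢ S) ∩
      range (𝓘(𝕜, 𝕜).prod J) = univ ×ˢ ((extChartAt J x₀).symm ⁻¹' S ∩ range J) := by
    rw [ModelWithCorners.range_prod]
    ext ⟨t, y⟩
    simp only [extChartAt_prod, mem_inter_iff, mem_preimage, mem_prod, mem_univ, true_and,
      PartialEquiv.prod_symm, PartialEquiv.prod_coe, modelWithCornersSelf_coe, range_id]
  have hf_chart := (contMDiffWithinAt_iff.1 hf).2
  rw [hset] at hf_chart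
  exact contMDiffWithinAt_of_comp_extChartAt_symm hx₀ <|
    contDiffWithinAt_deriv_fst
      (f := extChartAt 𝓘(𝕜, F) (f (t₀, x₀)) ∘ f ∘ (extChartAt (𝓘(𝕜, 𝕜).prod J) (t₀, x₀)).symm)
      (x₀ := extChartAt J x₀ x₀) (by simpa using hx₀) hf_chart

end ParameterDerivative

section Pi

variable {𝕜 E H E' H' : Type*} [NontriviallyNormedField 𝕜]
  [NormedAddCommGroup E] [NormedSpace 𝕜 E] [TopologicalSpace H] {I : ModelWithCorners 𝕜 E H}
  [NormedAddCommGroup E'] [NormedSpace 𝕜 E'] [TopologicalSpace H'] {J : ModelWithCorners 𝕜 E' H'}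
  {G N : Type*} [TopologicalSpace G] [ChartedSpace H G] [TopologicalSpace N] [ChartedSpace H' N]

theorem contMDiffWithinAt_pi {ι : Type*} [Fintype ι] {n : WithTop ℕ∞} {f : N → ι → G} {S : Set N}
    {x : N} (hf : ∀ i, ContMDiffWithinAt J I n (fun y => f y i) S x) :
    ContMDiffWithinAt J (ModelWithCorners.pi fun _ : ι => I) n f S x := by
  refine contMDiffWithinAt_iff.2
    ⟨continuousWithinAt_pi.2 fun i => (hf i).continuousWithinAt, ?_⟩
  exact contDiffWithinAt_pi.2 fun i => (contMDiffWithinAt_iff.1 (hf i)).2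

end Pi

section Submersion

open Manifold (IsSubmersionAtOfComplement)

variable {𝕜 E H E' H' F : Type*} [NontriviallyNormedField 𝕜]
  [NormedAddCommGroup E] [NormedSpace 𝕜 E] [TopologicalSpace H]
  [NormedAddCommGroup E'] [NormedSpace 𝕜 E'] [TopologicalSpace H']
  [NormedAddCommGroup F] [NormedSpace 𝕜 F]
  {I : ModelWithCorners 𝕜 E H} {J : ModelWithCorners 𝕜 E' H'}
  {G M : Type*} [TopologicalSpace G] [ChartedSpace H G] [TopologicalSpace M] [ChartedSpace H' M]
  {n : WithTop ℕ∞} {f : G → M} {b : G}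

/-- The chart expression of `fiberTransport`: in charts around `b` and `f b` in which `f` is the
projection `(u, v) ↦ u`, the vector with the first component of `x` and the second component
of `g`. -/
noncomputable def fiberTransportCoord (h : IsSubmersionAtOfComplement F I J n f b) (p : M × G) :
    E :=
  h.equiv.symm (h.codChart.extend J p.1, (h.equiv (h.domChart.extend I p.2)).2)

/-- Fiber transport along a map `f` that is a submersion at `b`: moves a point `g` near `b` to the
fiber of `f` over a point `x` near `f b`. It serves to lift curves along submersions. -/
noncomputable def fiberTransport (h : IsSubmersionAtOfComplement F I J n f b) (p : M × G) : G :=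
  (h.domChart.extend I).symm (fiberTransportCoord h p)

theorem codChart_extend_apply (h : IsSubmersionAtOfComplement F I J n f b) {u : E}
    (hu : u ∈ (h.domChart.extend I).target) :
    h.codChart.extend J (f ((h.domChart.extend I).symm u)) = (h.equiv u).1 :=
  h.writtenInCharts hu

theorem fiberTransportCoord_self (h : IsSubmersionAtOfComplement F I J n f b) {g : G}
    (hg : g ∈ h.domChart.source) : fiberTransportCoord h (f g, g) = h.domChart.extend I g := by
  have hfg := codChart_extend_apply h ((h.domChart.extend I).map_source
    (by rwa [OpenPartialHomeomorph.extend_source]))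
  rw [h.domChart.extend_left_inv hg] at hfg
  rw [fiberTransportCoord, hfg]
  exact h.equiv.symm_apply_apply _

theorem contMDiffAt_fiberTransportCoord (h : IsSubmersionAtOfComplement F I J n f b) {p : M × G}
    (hp₁ : p.1 ∈ h.codChart.source) (hp₂ : p.2 ∈ h.domChart.source) :
    ContMDiffAt (J.prod I) 𝓘(𝕜, E) n (fiberTransportCoord h) p := by
  have hfst : ContMDiffAt (J.prod I) 𝓘(𝕜, E') n (fun p : M × G => h.codChart.extend J p.1) p :=
    (J.contMDiff.contMDiffAt.comp _
      (contMDiffAt_of_mem_maximalAtlas h.codChart_mem_maximalAtlas hp₁)).comp p contMDiffAt_fst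
  have hsnd : ContMDiffAt (J.prod I) 𝓘(𝕜, E) n (fun p : M × G => h.domChart.extend I p.2) p :=
    (I.contMDiff.contMDiffAt.comp _
      (contMDiffAt_of_mem_maximalAtlas h.domChart_mem_maximalAtlas hp₂)).comp p contMDiffAt_snd
  have hequiv : ContMDiff 𝓘(𝕜, E) 𝓘(𝕜, F) n (fun u => (h.equiv u).2) :=
    ((ContinuousLinearMap.snd 𝕜 E' F).comp (h.equiv : E →L[𝕜] E' × F)).contMDiff
  exact (h.equiv.symm : E' × F →L[𝕜] E).contMDiff.contMDiffAt.comp p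
    (hfst.prodMk_space (hequiv.contMDiffAt.comp p hsnd))

theorem eventually_mem_charts (h : IsSubmersionAtOfComplement F I J n f b) :
    ∀ᶠ p : M × G in 𝓝 (f b, b), p.1 ∈ h.codChart.source ∧ p.2 ∈ h.domChart.source :=
  prod_mem_nhds (h.codChart.open_source.mem_nhds h.mem_codChart_source)
    (h.domChart.open_source.mem_nhds h.mem_domChart_source)

theorem eventually_fiberTransport_self (h : IsSubmersionAtOfComplement F I J n f b) :
    ∀ᶠ g in 𝓝 b, fiberTransport h (f g, g) = g := by
  filter_upwards [h.domChart.open_source.mem_nhds h.mem_domChart_source] with g hg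
  rw [fiberTransport, fiberTransportCoord_self h hg, h.domChart.extend_left_inv hg]

variable [I.Boundaryless]

theorem eventually_fiberTransportCoord_mem_target (h : IsSubmersionAtOfComplement F I J n f b) :
    ∀ᶠ p in 𝓝 (f b, b), fiberTransportCoord h p ∈ (h.domChart.extend I).target := by
  refine (contMDiffAt_fiberTransportCoord h h.mem_codChart_source
    h.mem_domChart_source).continuousAt ?_
  rw [fiberTransportCoord_self h h.mem_domChart_source]
  exact h.domChart.isOpen_extend_target.mem_nhds
    ((h.domChart.extend I).map_source (by simpa using h.mem_domChart_source))

theorem eventually_contMDiffAt_fiberTransport (h : IsSubmersionAtOfComplement F I J n f b) :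
    ∀ᶠ p in 𝓝 (f b, b), ContMDiffAt (J.prod I) I n (fiberTransport h) p := by
  filter_upwards [eventually_mem_charts h, eventually_fiberTransportCoord_mem_target h]
    with p hp hp_target
  refine ContMDiffAt.comp p
    ((contMDiffOn_extend_symm h.domChart_mem_maximalAtlas).contMDiffAt ?_)
    (contMDiffAt_fiberTransportCoord h hp.1 hp.2)
  rw [← h.domChart.extend_target']
  exact h.domChart.isOpen_extend_target.mem_nhds hp_target

theorem eventually_apply_fiberTransport (h : IsSubmersionAtOfComplement F I J n f b) :
    ∀ᶠ p in 𝓝 (f b, b), f (fiberTransport h p) = p.1 := by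
  filter_upwards [eventually_mem_charts h, eventually_fiberTransportCoord_mem_target h]
    with p hp hp_target
  have hmem : fiberTransport h p ∈ h.domChart.source :=
    h.domChart.extend_source (I := I) ▸ (h.domChart.extend I).map_target hp_target
  have hcoord : h.codChart.extend J (f (fiberTransport h p)) = h.codChart.extend J p.1 :=
    (codChart_extend_apply h hp_target).trans (congrArg Prod.fst (h.equiv.apply_symm_apply _))
  refine (h.codChart.extend J).injOn ?_ ?_ hcoord
  · rw [h.codChart.extend_source]
    exact h.source_subset_preimage_source hmem
  · rw [h.codChart.extend_source]
    exact hp.1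

end Submersion

section Velocity

variable {E H E' H' : Type*} [NormedAddCommGroup E] [NormedSpace ℝ E] [TopologicalSpace H]
  [NormedAddCommGroup E'] [NormedSpace ℝ E'] [TopologicalSpace H']
  {I : ModelWithCorners ℝ E H} {J : ModelWithCorners ℝ E' H'}
  {G M : Type*} [TopologicalSpace G] [ChartedSpace H G] [TopologicalSpace M] [ChartedSpace H' M]

variable (I) in
/-- The curve `γ` passes through `x` at time `0` with velocity `v`. Velocities live in the model
space, which underlies every tangent space, so that no transport between the tangent spaces at
equal points is needed. -/
def HasVelocity (γ : ℝ → G) (x : G) (v : E) : Prop :=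
  γ 0 = x ∧ HasMFDerivAt 𝓘(ℝ, ℝ) I γ 0 (ContinuousLinearMap.toSpanSingleton ℝ v)

variable (I J) in
/-- The derivative of `f` at `x` as a map between the model spaces, which underlie the tangent
spaces. -/
noncomputable def modelDeriv (f : G → M) (x : G) : E →L[ℝ] E' := mfderiv I J f x

theorem modelDeriv_comp {E₂ H₂ P : Type*} [NormedAddCommGroup E₂] [NormedSpace ℝ E₂]
    [TopologicalSpace H₂] {K : ModelWithCorners ℝ E₂ H₂} [TopologicalSpace P] [ChartedSpace H₂ P]
    {g : M → P} {f : G → M} (x : G) (hg : MDifferentiableAt J K g (f x))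
    (hf : MDifferentiableAt I J f x) :
    modelDeriv I K (g ∘ f) x = (modelDeriv J K g (f x)).comp (modelDeriv I J f x) :=
  mfderiv_comp x hg hf

namespace HasVelocity

variable {γ : ℝ → G} {x : G} {v : E}

theorem unique {w : E} (hv : HasVelocity I γ x v) (hw : HasVelocity I γ x w) : v = w := by
  have hspan : ContinuousLinearMap.toSpanSingleton ℝ v = ContinuousLinearMap.toSpanSingleton ℝ w :=
    hasMFDerivAt_unique hv.2 hw.2
  simpa using congrArg (fun L : ℝ →L[ℝ] E => L 1) hspan

theorem congr {γ' : ℝ → G} (hv : HasVelocity I γ x v) (h : ∀ᶠ τ in 𝓝 0, γ' τ = γ τ) :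
    HasVelocity I γ' x v :=
  ⟨h.self_of_nhds.trans hv.1, hv.2.congr_of_eventuallyEq h⟩

theorem eventually (hv : HasVelocity I γ x v) {p : G → Prop} (hp : ∀ᶠ y in 𝓝 x, p y) :
    ∀ᶠ τ in 𝓝 0, p (γ τ) :=
  hv.2.continuousAt.eventually (hv.1.symm ▸ hp)

theorem const (x : G) : HasVelocity I (fun _ : ℝ => x) x (0 : E) := by
  have hspan := ContinuousLinearMap.toSpanSingleton_zero (M₁ := E) ℝ
  exact ⟨rfl, (congrArg (HasMFDerivAt 𝓘(ℝ, ℝ) I (fun _ : ℝ => x) 0) hspan).mpr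
    (hasMFDerivAt_const x (0 : ℝ))⟩

theorem comp_within (hv : HasVelocity I γ x v) {f : G → M} {S : Set G}
    (hf : MDifferentiableWithinAt I J f S x) (hS : ∀ᶠ τ in 𝓝 0, γ τ ∈ S) :
    HasVelocity J (fun τ => f (γ τ)) (f x) (mfderivWithin I J f S x v) := by
  obtain ⟨rfl, hγ⟩ := hv
  refine ⟨rfl, ?_⟩
  rw [← show (mfderivWithin I J f S (γ 0) : E →L[ℝ] E').comp
    (ContinuousLinearMap.toSpanSingleton ℝ v) = _ from ContinuousLinearMap.comp_toSpanSingleton _ _]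
  exact (hf.hasMFDerivWithinAt.comp (0 : ℝ) (hγ.hasMFDerivWithinAt (s := γ ⁻¹' S))
    subset_rfl).hasMFDerivAt hS

theorem comp (hv : HasVelocity I γ x v) {f : G → M} (hf : MDifferentiableAt I J f x) :
    HasVelocity J (fun τ => f (γ τ)) (f x) (modelDeriv I J f x v) := by
  have h := hv.comp_within (S := univ) hf.mdifferentiableWithinAt (by simp)
  rwa [mfderivWithin_univ] at h

theorem prodMk (hv : HasVelocity I γ x v) {γ' : ℝ → M} {x' : M} {v' : E'}
    (hv' : HasVelocity J γ' x' v') :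
    HasVelocity (I.prod J) (fun τ => (γ τ, γ' τ)) (x, x') (v, v') :=
  ⟨Prod.ext hv.1 hv'.1, hv.2.prodMk hv'.2⟩

theorem exists_curve [IsManifold I 1 G] [I.Boundaryless] (x : G) (v : E) :
    ∃ γ : ℝ → G, HasVelocity I γ x v := by
  have hline :
      HasVelocity 𝓘(ℝ, E) (fun τ : ℝ => extChartAt I x x + τ • v) (extChartAt I x x) v := by
    have h : HasDerivAt (fun τ : ℝ => extChartAt I x x + τ • v) v 0 := by
      simpa using ((hasDerivAt_id (0 : ℝ)).smul_const v).const_add (extChartAt I x x)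
    exact ⟨by simp, h.hasFDerivAt.hasMFDerivAt⟩
  have hcurve := hline.comp_within (mdifferentiableWithinAt_extChartAt_symm (I := I)
    (mem_extChartAt_target x)) (by simp [I.range_eq_univ])
  rw [mfderivWithin_range_extChartAt_symm, extChartAt_to_inv] at hcurve
  exact ⟨_, hcurve⟩

theorem exists_lift [IsManifold I 1 G] [I.Boundaryless] {n : WithTop ℕ∞} (hn : n ≠ 0) {f : G → M}
    {b : G} (hf : Manifold.IsSubmersionAt I J n f b) {η : ℝ → M}
    (hη : HasVelocity J η (f b) (modelDeriv I J f b v)) :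
    ∃ γ : ℝ → G, HasVelocity I γ b v ∧ ∀ᶠ τ in 𝓝 0, f (γ τ) = η τ := by
  obtain ⟨F, _, _, h⟩ := hf
  obtain ⟨γ, hγ⟩ := exists_curve (I := I) b v
  have hΘ : MDifferentiableAt (J.prod I) I (fiberTransport h) (f b, b) :=
    (eventually_contMDiffAt_fiberTransport h).self_of_nhds.mdifferentiableAt hn
  have hfb : MDifferentiableAt I J f b := h.contMDiffAt.mdifferentiableAt hn
  have hlift := (hη.prodMk hγ).comp hΘ
  have hself := ((hγ.comp hfb).prodMk hγ).comp hΘ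
  rw [(eventually_fiberTransport_self h).self_of_nhds] at hlift hself
  refine ⟨fun τ => fiberTransport h (η τ, γ τ), ?_,
    (hη.prodMk hγ).eventually (eventually_apply_fiberTransport h)⟩
  -- Moving the points of `γ` within their own fibers does not move them, which identifies the
  -- velocity of the lift.
  rwa [← hself.unique (hγ.congr (hγ.eventually (eventually_fiberTransport_self h)))]

end HasVelocity

end Velocity

namespace LieGroupoid

section GroupoidAlgebra

variable {E H E' H' : Type*} [NormedAddCommGroup E] [NormedSpace ℝ E]
  [TopologicalSpace H] [NormedAddCommGroup E'] [NormedSpace ℝ E'] [TopologicalSpace H']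
  {I : ModelWithCorners ℝ E H} {J : ModelWithCorners ℝ E' H'}
  {G M : Type u} [TopologicalSpace G] [ChartedSpace H G] [IsManifold I ∞ G]
  [TopologicalSpace M] [ChartedSpace H' M] [IsManifold J ∞ M]
  (𝒢 : LieGroupoid I J G M)

theorem mul_mul_inv_cancel {g h : G} (hgh : 𝒢.s g = 𝒢.t h) :
    𝒢.mul (𝒢.mul g h) (𝒢.inv h) = g := by
  rw [𝒢.mul_assoc _ _ _ hgh (𝒢.t_inv _).symm, 𝒢.mul_inv, ← hgh, 𝒢.mul_one]

theorem inv_mul_mul_cancel {g h : G} (hgh : 𝒢.s g = 𝒢.t h) :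
    𝒢.mul (𝒢.inv g) (𝒢.mul g h) = h := by
  rw [← 𝒢.mul_assoc _ _ _ (𝒢.s_inv _) hgh, 𝒢.inv_mul, hgh, 𝒢.one_mul]

theorem inv_inv (g : G) : 𝒢.inv (𝒢.inv g) = g := by
  have h := 𝒢.inv_mul_mul_cancel (g := 𝒢.inv g) (h := g) (𝒢.s_inv g)
  rwa [𝒢.inv_mul, ← 𝒢.t_inv, ← 𝒢.s_inv, 𝒢.mul_one] at h

theorem mul_inv_mul_cancel {g h : G} (hgh : 𝒢.s g = 𝒢.s h) :
    𝒢.mul (𝒢.mul g (𝒢.inv h)) h = g := by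
  have hcancel := 𝒢.mul_mul_inv_cancel (g := g) (h := 𝒢.inv h) (by rw [𝒢.t_inv, hgh])
  rwa [𝒢.inv_inv] at hcancel

theorem inv_mul_rev {g h : G} (hgh : 𝒢.s g = 𝒢.t h) :
    𝒢.inv (𝒢.mul g h) = 𝒢.mul (𝒢.inv h) (𝒢.inv g) := by
  have hinv : 𝒢.s (𝒢.inv h) = 𝒢.t (𝒢.inv g) := by rw [𝒢.s_inv, 𝒢.t_inv, hgh]
  have hmul : 𝒢.s (𝒢.mul g h) = 𝒢.t (𝒢.inv h) := by rw [𝒢.s_mul _ _ hgh, 𝒢.t_inv]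
  have hcancel := 𝒢.inv_mul_mul_cancel (hmul.trans (𝒢.t_mul _ _ hinv).symm)
  rwa [← 𝒢.mul_assoc _ _ _ hmul hinv, 𝒢.mul_mul_inv_cancel hgh, 𝒢.mul_inv, ← 𝒢.t_mul _ _ hgh,
    ← 𝒢.s_inv, 𝒢.mul_one] at hcancel

theorem s_div {a b : G} (hab : 𝒢.s a = 𝒢.s b) : 𝒢.s (𝒢.mul a (𝒢.inv b)) = 𝒢.t b := by
  rw [𝒢.s_mul _ _ (by rw [𝒢.t_inv, hab]), 𝒢.s_inv]

theorem div_div {a b c : G} (hac : 𝒢.s a = 𝒢.s c) (hbc : 𝒢.s b = 𝒢.s c) :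
    𝒢.mul (𝒢.mul a (𝒢.inv c)) (𝒢.inv (𝒢.mul b (𝒢.inv c))) = 𝒢.mul a (𝒢.inv b) := by
  rw [𝒢.inv_mul_rev (by rw [𝒢.t_inv, hbc]), 𝒢.inv_inv, ← 𝒢.mul_assoc _ c _
    (𝒢.s_div hac) (by rw [𝒢.t_inv, hbc]), 𝒢.mul_inv_mul_cancel hac]

end GroupoidAlgebra

section TangentMaps

variable {E H E' H' : Type*} [NormedAddCommGroup E] [NormedSpace ℝ E]
  [TopologicalSpace H] [NormedAddCommGroup E'] [NormedSpace ℝ E'] [TopologicalSpace H']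
  {I : ModelWithCorners ℝ E H} {J : ModelWithCorners ℝ E' H'}
  {G M : Type u} [TopologicalSpace G] [ChartedSpace H G] [IsManifold I ∞ G]
  [TopologicalSpace M] [ChartedSpace H' M] [IsManifold J ∞ M]

section

variable (𝒢 : LieGroupoid I J G M)

theorem contMDiff_s : ContMDiff I J ∞ 𝒢.s := 𝒢.submersion_s.contMDiff

theorem contMDiff_t : ContMDiff I J ∞ 𝒢.t := 𝒢.submersion_t.contMDiff

theorem contMDiffOn_div : ContMDiffOn (I.prod I) I ∞ (fun p : G × G => 𝒢.mul p.1 (𝒢.inv p.2))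
    {p | 𝒢.s p.1 = 𝒢.s p.2} :=
  𝒢.smooth_mul.comp (f := fun p : G × G => (p.1, 𝒢.inv p.2))
    (contMDiff_fst.prodMk (𝒢.smooth_inv.comp contMDiff_snd)).contMDiffOn
    fun _ hp => hp.trans (𝒢.t_inv _).symm

/-- The tangent map of the source map, between the model spaces. -/
noncomputable def tangentS (g : G) : E →L[ℝ] E' := modelDeriv I J 𝒢.s g

/-- The tangent map of the target map, between the model spaces. -/
noncomputable def tangentT (g : G) : E →L[ℝ] E' := modelDeriv I J 𝒢.t g

/-- `tangentDiv` as a continuous linear map between the model spaces. -/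
noncomputable def divL (a b : G) : E × E →L[ℝ] E :=
  mfderivWithin (I.prod I) I (fun p : G × G => 𝒢.mul p.1 (𝒢.inv p.2))
    {p | 𝒢.s p.1 = 𝒢.s p.2} (a, b)

end

variable {𝒢 : LieGroupoid I J G M} {a b : G} {u v : E}

theorem hasVelocity_s {γ : ℝ → G} (hu : HasVelocity I γ a u) :
    HasVelocity J (fun τ => 𝒢.s (γ τ)) (𝒢.s a) (𝒢.tangentS a u) :=
  hu.comp ((𝒢.contMDiff_s a).mdifferentiableAt (by simp))

theorem hasVelocity_t {γ : ℝ → G} (hu : HasVelocity I γ a u) :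
    HasVelocity J (fun τ => 𝒢.t (γ τ)) (𝒢.t a) (𝒢.tangentT a u) :=
  hu.comp ((𝒢.contMDiff_t a).mdifferentiableAt (by simp))

theorem hasVelocity_div {γ η : ℝ → G} (hu : HasVelocity I γ a u) (hv : HasVelocity I η b v)
    (hs : ∀ᶠ τ in 𝓝 0, 𝒢.s (γ τ) = 𝒢.s (η τ)) :
    HasVelocity I (fun τ => 𝒢.mul (γ τ) (𝒢.inv (η τ))) (𝒢.mul a (𝒢.inv b))
      (𝒢.divL a b (u, v)) := by
  have hab : 𝒢.s a = 𝒢.s b := hu.1 ▸ hv.1 ▸ hs.self_of_nhds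
  exact (hu.prodMk hv).comp_within
    ((𝒢.contMDiffOn_div (a, b) hab).mdifferentiableWithinAt (by simp)) hs

variable [I.Boundaryless]

theorem exists_lift_curve {γ : ℝ → G} (hu : HasVelocity I γ a u) (hab : 𝒢.s a = 𝒢.s b)
    (huv : 𝒢.tangentS a u = 𝒢.tangentS b v) :
    ∃ η : ℝ → G, HasVelocity I η b v ∧ ∀ᶠ τ in 𝓝 0, 𝒢.s (γ τ) = 𝒢.s (η τ) := by
  have hγ := hasVelocity_s (𝒢 := 𝒢) hu
  rw [hab, huv] at hγ
  obtain ⟨η, hη, hs⟩ := HasVelocity.exists_lift (by simp) (𝒢.submersion_s.isSubmersionAt b) hγ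
  exact ⟨η, hη, hs.mono fun τ hτ => hτ.symm⟩

theorem exists_curve_pair (hab : 𝒢.s a = 𝒢.s b) (huv : 𝒢.tangentS a u = 𝒢.tangentS b v) :
    ∃ γ η : ℝ → G, HasVelocity I γ a u ∧ HasVelocity I η b v ∧
      ∀ᶠ τ in 𝓝 0, 𝒢.s (γ τ) = 𝒢.s (η τ) := by
  obtain ⟨γ, hγ⟩ := HasVelocity.exists_curve (I := I) a u
  obtain ⟨η, hη, hs⟩ := exists_lift_curve hγ hab huv
  exact ⟨γ, η, hγ, hη, hs⟩

theorem tangentS_divL (hab : 𝒢.s a = 𝒢.s b) (huv : 𝒢.tangentS a u = 𝒢.tangentS b v) :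
    𝒢.tangentS (𝒢.mul a (𝒢.inv b)) (𝒢.divL a b (u, v)) = 𝒢.tangentT b v := by
  obtain ⟨γ, η, hγ, hη, hs⟩ := exists_curve_pair hab huv
  have hdiv := hasVelocity_s (𝒢 := 𝒢) (hasVelocity_div hγ hη hs)
  rw [𝒢.s_div hab] at hdiv
  exact hdiv.unique ((hasVelocity_t hη).congr (hs.mono fun τ hτ => 𝒢.s_div hτ))

theorem divL_divL {c : G} {w : E} (hac : 𝒢.s a = 𝒢.s c) (hbc : 𝒢.s b = 𝒢.s c)
    (huw : 𝒢.tangentS a u = 𝒢.tangentS c w) (hvw : 𝒢.tangentS b v = 𝒢.tangentS c w) :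
    𝒢.divL (𝒢.mul a (𝒢.inv c)) (𝒢.mul b (𝒢.inv c))
      (𝒢.divL a c (u, w), 𝒢.divL b c (v, w)) = 𝒢.divL a b (u, v) := by
  obtain ⟨γ, ζ, hγ, hζ, hγζ⟩ := exists_curve_pair hac huw
  obtain ⟨η, hη, hζη⟩ := exists_lift_curve hζ hbc.symm hvw.symm
  have hdiv := hasVelocity_div (hasVelocity_div hγ hζ hγζ)
    (hasVelocity_div hη hζ (hζη.mono fun τ hτ => hτ.symm)) (by
      filter_upwards [hγζ, hζη] with τ h₁ h₂ using (𝒢.s_div h₁).trans (𝒢.s_div h₂.symm).symm)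
  rw [𝒢.div_div hac hbc] at hdiv
  refine hdiv.unique ((hasVelocity_div hγ hη ?_).congr ?_)
  · filter_upwards [hγζ, hζη] with τ h₁ h₂ using h₁.trans h₂
  · filter_upwards [hγζ, hζη] with τ h₁ h₂ using 𝒢.div_div h₁ h₂.symm

theorem exists_contMDiffOn_extension_div (hab : 𝒢.s a = 𝒢.s b) :
    ∃ (U : Set (G × G)) (F : G × G → G), IsOpen U ∧ (a, b) ∈ U ∧
      ContMDiffOn (I.prod I) I ∞ F U ∧
        ∀ p ∈ U, 𝒢.s p.1 = 𝒢.s p.2 → F p = 𝒢.mul p.1 (𝒢.inv p.2) := by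
  obtain ⟨_, _, _, h⟩ := 𝒢.submersion_s.isSubmersionAt b
  have hq : ContMDiff (I.prod I) (J.prod I) ∞ fun p : G × G => (𝒢.s p.1, p.2) :=
    (𝒢.contMDiff_s.comp contMDiff_fst).prodMk contMDiff_snd
  have hq_lim : Tendsto (fun p : G × G => (𝒢.s p.1, p.2)) (𝓝 (a, b)) (𝓝 (𝒢.s b, b)) :=
    hab ▸ hq.continuous.tendsto (a, b)
  have hself : ∀ᶠ p : G × G in 𝓝 (a, b), fiberTransport h (𝒢.s p.2, p.2) = p.2 :=
    (continuous_snd.tendsto (a, b)).eventually (eventually_fiberTransport_self h)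
  obtain ⟨U, hU, hU_open, habU⟩ := eventually_nhds_iff.1
    (((hq_lim.eventually (eventually_contMDiffAt_fiberTransport h)).and
      (hq_lim.eventually (eventually_apply_fiberTransport h))).and hself)
  refine ⟨U, fun p => 𝒢.mul p.1 (𝒢.inv (fiberTransport h (𝒢.s p.1, p.2))), hU_open, habU, ?_, ?_⟩
  · refine 𝒢.contMDiffOn_div.comp
      (f := fun p : G × G => (p.1, fiberTransport h (𝒢.s p.1, p.2))) (fun p hp => ?_)
      fun p hp => (hU p hp).1.2.symm
    exact (contMDiffAt_fst.prodMk ((hU p hp).1.1.comp p (hq p))).contMDiffWithinAt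
  · intro p hp hs
    simp only [hs, (hU p hp).2]

theorem divL_eq_mfderivWithin {U : Set (G × G)} {F : G × G → G} (hU : IsOpen U) (habU : (a, b) ∈ U)
    (hF : MDifferentiableWithinAt (I.prod I) I F U (a, b))
    (hdiv : ∀ p ∈ U, 𝒢.s p.1 = 𝒢.s p.2 → F p = 𝒢.mul p.1 (𝒢.inv p.2)) (hab : 𝒢.s a = 𝒢.s b)
    (huv : 𝒢.tangentS a u = 𝒢.tangentS b v) :
    𝒢.divL a b (u, v) = mfderivWithin (I.prod I) I F U (a, b) (u, v) := by
  obtain ⟨γ, η, hγ, hη, hs⟩ := exists_curve_pair hab huv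
  have hpair := hγ.prodMk hη
  have hγηU : ∀ᶠ τ in 𝓝 0, (γ τ, η τ) ∈ U := hpair.eventually (hU.mem_nhds habU)
  have hFγη := hpair.comp_within hF hγηU
  rw [hdiv _ habU hab] at hFγη
  refine (hasVelocity_div hγ hη hs).unique (hFγη.congr ?_)
  filter_upwards [hs, hγηU] with τ hsτ hτU using (hdiv _ hτU hsτ).symm

theorem contMDiffOn_divL {E₁ H₁ : Type*} [NormedAddCommGroup E₁] [NormedSpace ℝ E₁]
    [TopologicalSpace H₁] {K : ModelWithCorners ℝ E₁ H₁} {N : Type*} [TopologicalSpace N]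
    [ChartedSpace H₁ N] {S : Set N} {a b : N → G} {u v : N → E}
    (hu : ContMDiffOn K I.tangent ∞ (fun x => (⟨a x, u x⟩ : TangentBundle I G)) S)
    (hv : ContMDiffOn K I.tangent ∞ (fun x => (⟨b x, v x⟩ : TangentBundle I G)) S)
    (hab : ∀ x ∈ S, 𝒢.s (a x) = 𝒢.s (b x))
    (huv : ∀ x ∈ S, 𝒢.tangentS (a x) (u x) = 𝒢.tangentS (b x) (v x)) :
    ContMDiffOn K I.tangent ∞ (fun x => (⟨𝒢.mul (a x) (𝒢.inv (b x)),
      𝒢.divL (a x) (b x) (u x, v x)⟩ : TangentBundle I G)) S := by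
  intro x₀ hx₀
  obtain ⟨U, F, hU, hx₀U, hF, hFdiv⟩ := exists_contMDiffOn_extension_div (hab x₀ hx₀)
  let pair : N → TangentBundle (I.prod I) (G × G) := fun x => ⟨(a x, b x), (u x, v x)⟩
  have hpair : ContMDiffWithinAt K (I.prod I).tangent ∞ pair S x₀ :=
    (contMDiff_equivTangentBundleProd_symm (I := I) (M := G) (I' := I) (M' := G)
      (n := ∞)).contMDiffAt.comp_contMDiffWithinAt x₀ ((hu x₀ hx₀).prodMk (hv x₀ hx₀))
  have hpairU : ∀ᶠ x in 𝓝[S] x₀, (a x, b x) ∈ U :=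
    (FiberBundle.continuous_proj (E × E) (TangentSpace (I.prod I) : G × G → Type _)).continuousAt
      |>.comp_continuousWithinAt hpair.continuousWithinAt (hU.mem_nhds hx₀U)
  have hvalue : ∀ x ∈ S, (a x, b x) ∈ U →
      (⟨𝒢.mul (a x) (𝒢.inv (b x)), 𝒢.divL (a x) (b x) (u x, v x)⟩ : TangentBundle I G) =
        tangentMapWithin (I.prod I) I F U (pair x) := by
    intro x hx hxU
    rw [divL_eq_mfderivWithin hU hxU ((hF _ hxU).mdifferentiableWithinAt (by simp)) hFdiv
      (hab x hx) (huv x hx)]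
    exact Bundle.TotalSpace.ext (hFdiv _ hxU (hab x hx)).symm HEq.rfl
  have hTF := (hF.contMDiffOn_tangentMapWithin (m := ∞) (by simp) hU.uniqueMDiffOn).contMDiffAt
    (x := pair x₀) (((FiberBundle.continuous_proj (E × E)
      (TangentSpace (I.prod I) : G × G → Type _)).isOpen_preimage _ hU).mem_nhds hx₀U)
  refine (hTF.comp_contMDiffWithinAt x₀ hpair).congr_of_eventuallyEq ?_ (hvalue x₀ hx₀ hx₀U)
  filter_upwards [self_mem_nhdsWithin, hpairU] with x hx hxU using hvalue x hx hxU

end TangentMaps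

section Morphisms

variable {E₁ H₁ E₁' H₁' E₂ H₂ E₂' H₂' : Type*}
  [NormedAddCommGroup E₁] [NormedSpace ℝ E₁] [TopologicalSpace H₁]
  [NormedAddCommGroup E₁'] [NormedSpace ℝ E₁'] [TopologicalSpace H₁']
  [NormedAddCommGroup E₂] [NormedSpace ℝ E₂] [TopologicalSpace H₂]
  [NormedAddCommGroup E₂'] [NormedSpace ℝ E₂'] [TopologicalSpace H₂']
  {I₁ : ModelWithCorners ℝ E₁ H₁} {J₁ : ModelWithCorners ℝ E₁' H₁'}
  {I₂ : ModelWithCorners ℝ E₂ H₂} {J₂ : ModelWithCorners ℝ E₂' H₂'}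
  {G₁ M₁ G₂ M₂ : Type u}
  [TopologicalSpace G₁] [ChartedSpace H₁ G₁] [IsManifold I₁ ∞ G₁]
  [TopologicalSpace M₁] [ChartedSpace H₁' M₁] [IsManifold J₁ ∞ M₁]
  [TopologicalSpace G₂] [ChartedSpace H₂ G₂] [IsManifold I₂ ∞ G₂]
  [TopologicalSpace M₂] [ChartedSpace H₂' M₂] [IsManifold J₂ ∞ M₂]
  {𝒢₁ : LieGroupoid I₁ J₁ G₁ M₁} {𝒢₂ : LieGroupoid I₂ J₂ G₂ M₂} {Φ : G₁ → G₂} {f : M₁ → M₂}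

namespace IsHom

theorem tangentS_modelDeriv (hΦ : 𝒢₁.IsHom 𝒢₂ Φ f) (a : G₁) (u : E₁) :
    𝒢₂.tangentS (Φ a) (modelDeriv I₁ I₂ Φ a u) =
      modelDeriv J₁ J₂ f (𝒢₁.s a) (𝒢₁.tangentS a u) := by
  have hleft := modelDeriv_comp a ((𝒢₂.contMDiff_s (Φ a)).mdifferentiableAt (by simp))
    ((hΦ.smooth a).mdifferentiableAt (by simp))
  have hright := modelDeriv_comp a ((hΦ.smooth_base (𝒢₁.s a)).mdifferentiableAt (by simp))
    ((𝒢₁.contMDiff_s a).mdifferentiableAt (by simp))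
  rw [show 𝒢₂.s ∘ Φ = f ∘ 𝒢₁.s from funext hΦ.map_s] at hleft
  exact DFunLike.congr_fun (hleft.symm.trans hright) u

theorem modelDeriv_divL [I₁.Boundaryless] (hΦ : 𝒢₁.IsHom 𝒢₂ Φ f) {a b : G₁} {u v : E₁}
    (hab : 𝒢₁.s a = 𝒢₁.s b) (huv : 𝒢₁.tangentS a u = 𝒢₁.tangentS b v) :
    modelDeriv I₁ I₂ Φ (𝒢₁.mul a (𝒢₁.inv b)) (𝒢₁.divL a b (u, v)) =
      𝒢₂.divL (Φ a) (Φ b) (modelDeriv I₁ I₂ Φ a u, modelDeriv I₁ I₂ Φ b v) := by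
  have hdiff : ∀ g, MDifferentiableAt I₁ I₂ Φ g := fun g =>
    (hΦ.smooth g).mdifferentiableAt (by simp)
  have hdiv : ∀ a b, 𝒢₁.s a = 𝒢₁.s b → Φ (𝒢₁.mul a (𝒢₁.inv b)) = 𝒢₂.mul (Φ a) (𝒢₂.inv (Φ b)) :=
    fun a b h => by rw [hΦ.map_mul _ _ (by rw [𝒢₁.t_inv, h]), hΦ.map_inv]
  obtain ⟨γ, η, hγ, hη, hs⟩ := exists_curve_pair hab huv
  have hleft := (hasVelocity_div hγ hη hs).comp (hdiff _)
  have hright := hasVelocity_div (𝒢 := 𝒢₂) (hγ.comp (hdiff _)) (hη.comp (hdiff _))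
    (hs.mono fun τ hτ => by rw [hΦ.map_s, hΦ.map_s, hτ])
  rw [hdiv a b hab] at hleft
  exact hleft.unique (hright.congr (hs.mono fun τ hτ => hdiv _ _ hτ))

end IsHom

end Morphisms

end LieGroupoid

theorem sum_alternating_sum_alternating_eq_zero {R A : Type*} [Ring R] [AddCommGroup A]
    [Module R A] {a : ℕ → ℕ → A} (ha : ∀ i j, i ≤ j → a i (j + 1) = a j i) (m : ℕ) :
    ∑ j ∈ Finset.range (m + 1), (-1 : R) ^ j • ∑ i ∈ Finset.range m, (-1 : R) ^ i • a i j = 0 := by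
  induction m with
  | zero => simp
  | succ m ih =>
    have hlast_inner : ∑ j ∈ Finset.range (m + 1),
        (-1 : R) ^ j • ∑ i ∈ Finset.range (m + 1), (-1 : R) ^ i • a i j =
          ∑ j ∈ Finset.range (m + 1), (-1 : R) ^ j • (-1 : R) ^ m • a m j := by
      simp_rw [Finset.sum_range_succ (fun i => (-1 : R) ^ i • a i _) m, smul_add,
        Finset.sum_add_distrib]
      rw [ih, zero_add]
    rw [Finset.sum_range_succ, hlast_inner, Finset.smul_sum, ← Finset.sum_add_distrib]
    refine Finset.sum_eq_zero fun j hj => ?_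
    rw [ha j m (Nat.lt_succ_iff.1 (Finset.mem_range.1 hj)), smul_smul, smul_smul, ← add_smul,
      ← pow_add, ← pow_add, add_right_comm, add_comm m j, pow_succ, mul_neg_one, add_neg_cancel,
      zero_smul]

section Tangent

variable {E H : Type*} [NormedAddCommGroup E] [NormedSpace ℝ E] [TopologicalSpace H]
  {I : ModelWithCorners ℝ E H} {G : Type*} [TopologicalSpace G] [ChartedSpace H G]

theorem tangentBundle_mk_congr {x y : G} {v w : E} (hxy : x = y) (hvw : v = w) :
    (⟨x, v⟩ : TangentBundle I G) = ⟨y, w⟩ := by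
  subst hxy hvw; rfl

variable {E' H' : Type*} [NormedAddCommGroup E'] [NormedSpace ℝ E'] [TopologicalSpace H']
  {J : ModelWithCorners ℝ E' H'} {N : Type*} [TopologicalSpace N] [ChartedSpace H' N]
  [IsManifold I ∞ G]

theorem contMDiffOn_sum_along {ι : Type*} {b : N → G} {v : ι → N → E} {S : Set N} (T : Finset ι)
    (hb : ContMDiffOn J I ∞ b S)
    (hv : ∀ j, ContMDiffOn J I.tangent ∞ (fun x => (⟨b x, v j x⟩ : TangentBundle I G)) S) :
    ContMDiffOn J I.tangent ∞ (fun x => (⟨b x, ∑ j ∈ T, v j x⟩ : TangentBundle I G)) S := by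
  classical
  induction T using Finset.induction_on with
  | empty => exact contMDiffOn_zero_along hb
  | insert j T hj ih =>
    exact (contMDiffOn_add_along (hv j) ih).congr fun x _ =>
      tangentBundle_mk_congr rfl (Finset.sum_insert (M := E) hj)

end Tangent

namespace LieGroupoid

section Differential

variable {E H E' H' : Type*} [NormedAddCommGroup E] [NormedSpace ℝ E]
  [TopologicalSpace H] [NormedAddCommGroup E'] [NormedSpace ℝ E'] [TopologicalSpace H']
  {I : ModelWithCorners ℝ E H} {J : ModelWithCorners ℝ E' H'}
  {G M : Type u} [TopologicalSpace G] [ChartedSpace H G] [IsManifold I ∞ G]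
  [TopologicalSpace M] [ChartedSpace H' M] [IsManifold J ∞ M]
  {𝒢 : LieGroupoid I J G M}

/-- The value of a cochain of degree `-1` at a point of `M`, as a vector of the model space. -/
def vecUnit (α : 𝒢.Cochain 0) (x : M) : E := α x

/-- The value of a cochain at a tuple of composable arrows, as a vector of the model space. -/
def vecTuple {n : ℕ} (c : 𝒢.Cochain (n + 1)) (g : 𝒢.composable n) : E := c g

theorem cochain_ext_tuple {n : ℕ} {c d : 𝒢.Cochain (n + 1)}
    (h : ∀ g, 𝒢.vecTuple c g = 𝒢.vecTuple d g) : c = d :=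
  funext h

theorem extendZero_eq_vecTuple {n : ℕ} (c : 𝒢.Cochain (n + 1)) {g : Fin (n + 1) → G}
    (hg : g ∈ 𝒢.composable n) : (𝒢.extendZero c g : E) = vecTuple c ⟨g, hg⟩ :=
  𝒢.extendZero_of_mem hg

/-- The condition on the source components in the definition of deformation cochains. -/
def IsSourceCompatible : ∀ {n : ℕ}, 𝒢.Cochain n → Prop
  | 0, α => ∀ x, 𝒢.tangentS (𝒢.one x) (𝒢.vecUnit α x) = 0
  | n + 1, c => ∀ g g' : 𝒢.composable n, (∀ i : Fin n, g.1 i.succ = g'.1 i.succ) →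
      𝒢.s (g.1 0) = 𝒢.s (g'.1 0) →
        𝒢.tangentS (g.1 0) (𝒢.vecTuple c g) = 𝒢.tangentS (g'.1 0) (𝒢.vecTuple c g')

/-- The smoothness condition in the definition of deformation cochains. -/
def IsSmoothCochain : ∀ {n : ℕ}, 𝒢.Cochain n → Prop
  | 0, α => ContMDiff J I.tangent ∞ (fun x : M => (⟨𝒢.one x, 𝒢.vecUnit α x⟩ : TangentBundle I G))
  | n + 1, c => ContMDiffOn (ModelWithCorners.pi fun _ : Fin (n + 1) => I) I.tangent ∞
      (fun g : Fin (n + 1) → G => (⟨g 0, 𝒢.extendZero c g⟩ : TangentBundle I G))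
      (𝒢.composable n)

theorem mem_defCochains {n : ℕ} {c : 𝒢.Cochain n} :
    c ∈ 𝒢.defCochains n ↔ 𝒢.IsSourceCompatible c ∧ 𝒢.IsSmoothCochain c := by
  cases n with
  | zero => exact Iff.rfl
  | succ n => exact and_comm

/-! ### Faces of tuples of composable arrows -/

/-- `(g₀, …, gₙ₊₁) ↦ (g₀, …, gⱼ gⱼ₊₁, …, gₙ₊₁)`, which omits the last arrow if `j > n`. -/
def faceFun (𝒢 : LieGroupoid I J G M) {n : ℕ} (j : ℕ) (g : Fin (n + 2) → G) : Fin (n + 1) → G :=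
  fun k => if (k : ℕ) < j then g k.castSucc
    else if (k : ℕ) = j then 𝒢.mul (g k.castSucc) (g k.succ) else g k.succ

theorem faceFun_mem {n : ℕ} (j : ℕ) {g : Fin (n + 2) → G} (hg : g ∈ 𝒢.composable (n + 1)) :
    𝒢.faceFun j g ∈ 𝒢.composable n := by
  intro i
  have hleft : 𝒢.s (g i.castSucc.castSucc) = 𝒢.t (g i.castSucc.succ) := hg i.castSucc
  have hright : 𝒢.s (g i.castSucc.succ) = 𝒢.t (g i.succ.succ) := hg i.succ
  simp only [faceFun, Fin.val_castSucc, Fin.val_succ, Fin.castSucc_succ]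
  split_ifs <;> first | omega | simp only [𝒢.s_mul _ _ hleft, 𝒢.t_mul _ _ hright, hleft, hright]

/-- `faceFun` on composable tuples. The cochain differential uses the faces with `j ≤ n + 1`. -/
def face {n : ℕ} (j : ℕ) (g : 𝒢.composable (n + 1)) : 𝒢.composable n :=
  ⟨𝒢.faceFun j g.1, faceFun_mem j g.2⟩

theorem dropLast_eq_face {n : ℕ} (g : 𝒢.composable (n + 1)) : 𝒢.dropLast g = face (n + 1) g :=
  Subtype.ext (funext fun k => by simp [face, faceFun, dropLast, k.2])

theorem face_zero_succ {n : ℕ} (g : 𝒢.composable (n + 1)) (i : Fin n) :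
    (face 0 g).1 i.succ = g.1 i.succ.succ := by
  simp [face, faceFun]

theorem face_succ_zero {n : ℕ} (j : ℕ) (g : 𝒢.composable (n + 1)) :
    (face (j + 1) g).1 0 = g.1 0 := by
  simp [face, faceFun]

theorem face_face {n : ℕ} {i j : ℕ} (hij : i ≤ j) (g : 𝒢.composable (n + 2)) :
    face i (face (j + 1) g) = face j (face i g) := by
  refine Subtype.ext (funext fun k => ?_)
  have hleft : 𝒢.s (g.1 k.castSucc.castSucc) = 𝒢.t (g.1 k.castSucc.succ) := g.2 k.castSucc
  have hright : 𝒢.s (g.1 k.castSucc.succ) = 𝒢.t (g.1 k.succ.succ) := g.2 k.succ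
  simp only [face, faceFun, Fin.val_castSucc, Fin.val_succ, Fin.castSucc_succ]
  split_ifs <;> first | omega | rfl | exact (𝒢.mul_assoc _ _ _ hleft hright).symm

theorem dropFirst_zero {n : ℕ} (g : 𝒢.composable (n + 1)) : (𝒢.dropFirst g).1 0 = g.1 1 := rfl

theorem dropFirst_face_succ {n : ℕ} (j : ℕ) (g : 𝒢.composable (n + 2)) :
    𝒢.dropFirst (face (j + 1) g) = face j (𝒢.dropFirst g) := by
  refine Subtype.ext (funext fun k => ?_)
  simp only [face, faceFun, dropFirst, Fin.val_succ, Fin.castSucc_succ]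
  split_ifs <;> first | omega | rfl

theorem dropFirst_face_zero {n : ℕ} (g : 𝒢.composable (n + 2)) :
    𝒢.dropFirst (face 0 g) = 𝒢.dropFirst (𝒢.dropFirst g) :=
  Subtype.ext (funext fun k => face_zero_succ g k)

theorem face_add_two_one {n : ℕ} (j : ℕ) (g : 𝒢.composable (n + 2)) :
    (face (j + 2) g).1 1 = g.1 1 := by
  rw [← dropFirst_zero, dropFirst_face_succ, face_succ_zero, dropFirst_zero]

theorem s_face_zero {n : ℕ} (g : 𝒢.composable (n + 1)) :
    𝒢.s ((face 0 g).1 0) = 𝒢.s (g.1 1) :=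
  𝒢.s_mul _ _ (g.2 0)

theorem div_face_zero {n : ℕ} (g : 𝒢.composable (n + 1)) :
    𝒢.mul ((face 0 g).1 0) (𝒢.inv (g.1 1)) = g.1 0 :=
  𝒢.mul_mul_inv_cancel (g.2 0)

theorem contMDiffOn_faceFun (𝒢 : LieGroupoid I J G M) {n : ℕ} (j : ℕ) :
    ContMDiffOn (ModelWithCorners.pi fun _ : Fin (n + 2) => I)
      (ModelWithCorners.pi fun _ : Fin (n + 1) => I) ∞ (𝒢.faceFun (n := n) j)
      (𝒢.composable (n + 1)) := by
  intro g hg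
  refine contMDiffWithinAt_pi fun k => ?_
  unfold faceFun
  rcases lt_trichotomy (k : ℕ) j with hlt | heq | hgt
  · simp only [hlt, if_true]
    exact contMDiff_pi_eval _ |>.contMDiffAt.contMDiffWithinAt
  · simp only [heq, if_true, if_false, lt_irrefl]
    exact (𝒢.smooth_mul (g k.castSucc, g k.succ) (hg k)).comp g
      (((contMDiff_pi_eval _).prodMk (contMDiff_pi_eval _)).contMDiffAt.contMDiffWithinAt)
      fun g (hg : g ∈ 𝒢.composable (n + 1)) => hg k
  · simp only [hgt.not_gt, hgt.ne', if_false]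
    exact (contMDiff_pi_eval _).contMDiffAt.contMDiffWithinAt

theorem IsSourceCompatible.tangentS_face_zero {n : ℕ} {c : 𝒢.Cochain (n + 1)}
    (hc : IsSourceCompatible c) (g : 𝒢.composable (n + 1)) :
    𝒢.tangentS ((face 0 g).1 0) (vecTuple c (face 0 g)) =
      𝒢.tangentS (g.1 1) (vecTuple c (𝒢.dropFirst g)) :=
  hc (face 0 g) (𝒢.dropFirst g) (fun i => face_zero_succ g i) (s_face_zero g)

theorem IsSourceCompatible.tangentS_face_succ {n : ℕ} {c : 𝒢.Cochain (n + 1)}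
    (hc : IsSourceCompatible c) (j : ℕ) {g g' : 𝒢.composable (n + 1)}
    (hgg' : 𝒢.dropFirst g = 𝒢.dropFirst g') (hs : 𝒢.s (g.1 0) = 𝒢.s (g'.1 0)) :
    𝒢.tangentS (g.1 0) (vecTuple c (face (j + 1) g)) =
      𝒢.tangentS (g'.1 0) (vecTuple c (face (j + 1) g')) := by
  have htail : ∀ k : Fin (n + 1), g.1 k.succ = g'.1 k.succ := congrFun (congrArg Subtype.val hgg')
  have hface := hc (face (j + 1) g) (face (j + 1) g')
    (fun i => by simp only [face, faceFun, htail, Fin.castSucc_succ])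
    (by rw [face_succ_zero, face_succ_zero, hs])
  rwa [face_succ_zero, face_succ_zero] at hface

theorem IsSmoothCochain.contMDiffOn_faceFun {n : ℕ} {c : 𝒢.Cochain (n + 1)}
    (hc : IsSmoothCochain c) (j : ℕ) :
    ContMDiffOn (ModelWithCorners.pi fun _ : Fin (n + 2) => I) I.tangent ∞
      (fun g => (⟨𝒢.faceFun j g 0, 𝒢.extendZero c (𝒢.faceFun j g)⟩ : TangentBundle I G))
      (𝒢.composable (n + 1)) :=
  ContMDiffOn.comp (t := 𝒢.composable n) hc (LieGroupoid.contMDiffOn_faceFun 𝒢 j)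
    fun _ hg => faceFun_mem j hg

theorem IsSmoothCochain.contMDiffOn_dropFirst {n : ℕ} {c : 𝒢.Cochain (n + 1)}
    (hc : IsSmoothCochain c) :
    ContMDiffOn (ModelWithCorners.pi fun _ : Fin (n + 2) => I) I.tangent ∞
      (fun g => (⟨g 1, 𝒢.extendZero c fun i => g i.succ⟩ : TangentBundle I G))
      (𝒢.composable (n + 1)) :=
  ContMDiffOn.comp (t := 𝒢.composable n) hc (f := fun g : Fin (n + 2) → G => fun i => g i.succ)
    (fun _ _ => contMDiffWithinAt_pi fun _ =>
      (contMDiff_pi_eval _).contMDiffAt.contMDiffWithinAt)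
    fun g (hg : g ∈ 𝒢.composable (n + 1)) i => hg i.succ

/-- The term `Tm̄ (c (g₀g₁, …, gₙ₊₁), c (g₁, …, gₙ₊₁))` of the differential. -/
noncomputable def divTerm {n : ℕ} (c : 𝒢.Cochain (n + 1)) (g : 𝒢.composable (n + 1)) : E :=
  𝒢.divL ((face 0 g).1 0) (g.1 1) (vecTuple c (face 0 g), vecTuple c (𝒢.dropFirst g))

theorem vecTuple_diff {n : ℕ} (c : 𝒢.Cochain (n + 1)) (g : 𝒢.composable (n + 1)) :
    vecTuple (𝒢.diff (n + 1) c) g = -divTerm c g +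
      ∑ j ∈ Finset.range (n + 1), (-1 : ℝ) ^ j • vecTuple c (face (j + 1) g) := by
  let contractTerm : Fin n → 𝒢.Cochain (n + 1) →ₗ[ℝ] E := fun i => (-1 : ℝ) ^ (i : ℕ) •
    (tangentCast I (𝒢.contract_succ_zero i g) ∘ₗ 𝒢.evalTuple (𝒢.contract i.succ g))
  have hdiff : vecTuple (𝒢.diff (n + 1) c) g = -divTerm c g + (∑ i : Fin n, contractTerm i) c +
      (-1 : ℝ) ^ n • vecTuple c (𝒢.dropLast g) := rfl
  rw [hdiff, Finset.sum_range_succ, dropLast_eq_face, ← add_assoc, LinearMap.sum_apply,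
    Finset.sum_range]
  rfl

theorem divTerm_face_add_two {n : ℕ} (c : 𝒢.Cochain (n + 1)) (j : ℕ) (g : 𝒢.composable (n + 2)) :
    divTerm c (face (j + 2) g) = 𝒢.divL ((face 0 g).1 0) (g.1 1)
      (vecTuple c (face (j + 1) (face 0 g)), vecTuple c (face (j + 1) (𝒢.dropFirst g))) := by
  rw [divTerm, face_add_two_one, face_face (Nat.zero_le _), dropFirst_face_succ, face_succ_zero]

theorem divTerm_diff {n : ℕ} (c : 𝒢.Cochain (n + 1)) (g : 𝒢.composable (n + 2)) :
    divTerm (𝒢.diff (n + 1) c) g =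
      -𝒢.divL ((face 0 g).1 0) (g.1 1) (divTerm c (face 0 g), divTerm c (𝒢.dropFirst g)) +
        ∑ j ∈ Finset.range (n + 1), (-1 : ℝ) ^ j • divTerm c (face (j + 2) g) := by
  have hpair : (vecTuple (𝒢.diff (n + 1) c) (face 0 g),
      vecTuple (𝒢.diff (n + 1) c) (𝒢.dropFirst g)) =
      -(divTerm c (face 0 g), divTerm c (𝒢.dropFirst g)) +
        ∑ j ∈ Finset.range (n + 1), (-1 : ℝ) ^ j •
          (vecTuple c (face (j + 1) (face 0 g)), vecTuple c (face (j + 1) (𝒢.dropFirst g))) := by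
    rw [vecTuple_diff, vecTuple_diff]
    ext <;> simp [Prod.fst_sum, Prod.snd_sum]
  rw [divTerm, hpair, map_add, map_neg, map_sum]
  simp only [map_smul, divTerm_face_add_two]

theorem sum_vecTuple_diff_face {n : ℕ} (c : 𝒢.Cochain (n + 1)) (g : 𝒢.composable (n + 2)) :
    ∑ j ∈ Finset.range (n + 2), (-1 : ℝ) ^ j • vecTuple (𝒢.diff (n + 1) c) (face (j + 1) g) =
      -∑ j ∈ Finset.range (n + 2), (-1 : ℝ) ^ j • divTerm c (face (j + 1) g) := by
  have hcancel := sum_alternating_sum_alternating_eq_zero (R := ℝ)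
    (a := fun i j => vecTuple c (face (i + 1) (face (j + 1) g)))
    (fun i j hij => by rw [face_face (Nat.succ_le_succ hij)]) (n + 1)
  rw [← add_zero (-∑ j ∈ _, _), ← hcancel, ← Finset.sum_neg_distrib, ← Finset.sum_add_distrib]
  refine Finset.sum_congr rfl fun j _ => ?_
  rw [vecTuple_diff, smul_add, smul_neg]

/-- `TL_g ∘ Ti` on the vectors tangent to the source fiber at the unit `1_{s g}`. -/
noncomputable def leftTranslate (𝒢 : LieGroupoid I J G M) (g : G) (u : E) : E :=
  𝒢.divL g (𝒢.one (𝒢.s g)) (0, u)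

/-- `TR_g` on the vectors tangent to the source fiber at the unit `1_{t g}`. -/
noncomputable def rightTranslate (𝒢 : LieGroupoid I J G M) (g : G) (u : E) : E :=
  𝒢.divL (𝒢.one (𝒢.t g)) (𝒢.inv g) (u, 0)

theorem hasVelocity_leftTranslate {g : G} {u : E} {γ : ℝ → G}
    (hγ : HasVelocity I γ (𝒢.one (𝒢.s g)) u) (hs : ∀ᶠ τ in 𝓝 0, 𝒢.s (γ τ) = 𝒢.s g) :
    HasVelocity I (fun τ => 𝒢.mul g (𝒢.inv (γ τ))) g (𝒢.leftTranslate g u) := by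
  have hdiv := hasVelocity_div (𝒢 := 𝒢) (HasVelocity.const g) hγ (hs.mono fun τ hτ => hτ.symm)
  rwa [𝒢.inv_one, 𝒢.mul_one] at hdiv

theorem hasVelocity_rightTranslate {g : G} {u : E} {γ : ℝ → G}
    (hγ : HasVelocity I γ (𝒢.one (𝒢.t g)) u) (hs : ∀ᶠ τ in 𝓝 0, 𝒢.s (γ τ) = 𝒢.t g) :
    HasVelocity I (fun τ => 𝒢.mul (γ τ) g) g (𝒢.rightTranslate g u) := by
  have hdiv := hasVelocity_div (𝒢 := 𝒢) hγ (HasVelocity.const (𝒢.inv g))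
    (hs.mono fun τ hτ => hτ.trans (𝒢.s_inv g).symm)
  simp only [𝒢.inv_inv, 𝒢.one_mul] at hdiv
  exact hdiv

theorem tangentS_leftTranslate [I.Boundaryless] {g : G} {u : E}
    (hu : 𝒢.tangentS (𝒢.one (𝒢.s g)) u = 0) :
    𝒢.tangentS g (𝒢.leftTranslate g u) = 𝒢.tangentT (𝒢.one (𝒢.s g)) u := by
  have hdiv := tangentS_divL (𝒢 := 𝒢) (u := 0) (𝒢.s_one (𝒢.s g)).symm (by rw [hu, map_zero])
  rwa [𝒢.inv_one, 𝒢.mul_one] at hdiv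

theorem tangentS_rightTranslate [I.Boundaryless] {g : G} {u : E}
    (hu : 𝒢.tangentS (𝒢.one (𝒢.t g)) u = 0) : 𝒢.tangentS g (𝒢.rightTranslate g u) = 0 := by
  have hdiv := tangentS_divL (𝒢 := 𝒢) (v := 0) ((𝒢.s_one (𝒢.t g)).trans (𝒢.s_inv g).symm)
    (by rw [hu, map_zero])
  rwa [𝒢.inv_inv, 𝒢.one_mul, map_zero] at hdiv

theorem contMDiff_leftTranslate [I.Boundaryless] {α : 𝒢.Cochain 0} (hα : IsSourceCompatible α)
    (hα_smooth : IsSmoothCochain α) :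
    ContMDiff I I.tangent ∞
      fun g => (⟨g, 𝒢.leftTranslate g (vecUnit α (𝒢.s g))⟩ : TangentBundle I G) := by
  have hdiv := contMDiffOn_divL (𝒢 := 𝒢) (S := univ) (contMDiffOn_zero_along contMDiffOn_id)
    (ContMDiff.comp hα_smooth 𝒢.contMDiff_s).contMDiffOn (fun g _ => (𝒢.s_one _).symm)
    fun g _ => (map_zero (𝒢.tangentS g)).trans (hα (𝒢.s g)).symm
  refine contMDiffOn_univ.1 (hdiv.congr fun g _ => tangentBundle_mk_congr ?_ rfl)
  simp only [id_eq, 𝒢.inv_one, 𝒢.mul_one]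

theorem contMDiff_rightTranslate [I.Boundaryless] {α : 𝒢.Cochain 0} (hα : IsSourceCompatible α)
    (hα_smooth : IsSmoothCochain α) :
    ContMDiff I I.tangent ∞
      fun g => (⟨g, 𝒢.rightTranslate g (vecUnit α (𝒢.t g))⟩ : TangentBundle I G) := by
  have hdiv := contMDiffOn_divL (𝒢 := 𝒢) (S := univ)
    (ContMDiff.comp hα_smooth 𝒢.contMDiff_t).contMDiffOn
    (contMDiffOn_zero_along 𝒢.smooth_inv.contMDiffOn)
    (fun g _ => (𝒢.s_one _).trans (𝒢.s_inv g).symm)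
    fun g _ => (hα (𝒢.t g)).trans (map_zero (𝒢.tangentS (𝒢.inv g))).symm
  refine contMDiffOn_univ.1 (hdiv.congr fun g _ => tangentBundle_mk_congr ?_ rfl)
  simp only [𝒢.inv_inv, 𝒢.one_mul]

variable [I.Boundaryless]

theorem exists_curve_unit {x : M} {u : E} (hu : 𝒢.tangentS (𝒢.one x) u = 0) :
    ∃ γ : ℝ → G, HasVelocity I γ (𝒢.one x) u ∧ ∀ᶠ τ in 𝓝 0, 𝒢.s (γ τ) = x := by
  have hconst := HasVelocity.const (I := J) (𝒢.s (𝒢.one x))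
  rw [← hu] at hconst
  obtain ⟨γ, hγ, hs⟩ := HasVelocity.exists_lift (by simp)
    (𝒢.submersion_s.isSubmersionAt (𝒢.one x)) hconst
  exact ⟨γ, hγ, hs.mono fun τ hτ => hτ.trans (𝒢.s_one x)⟩

theorem divL_leftTranslate_leftTranslate {g h : G} {u : E} (hgh : 𝒢.s g = 𝒢.t h)
    (hu : 𝒢.tangentS (𝒢.one (𝒢.s h)) u = 0) :
    𝒢.divL (𝒢.mul g h) h (𝒢.leftTranslate (𝒢.mul g h) u, 𝒢.leftTranslate h u) = 0 := by
  have hs := 𝒢.s_mul _ _ hgh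
  obtain ⟨γ, hγ, hγs⟩ := exists_curve_unit hu
  have hgh_div := hasVelocity_leftTranslate (𝒢 := 𝒢) (g := 𝒢.mul g h) (by rwa [hs])
    (by simpa only [hs] using hγs)
  have hdiv := hasVelocity_div (𝒢 := 𝒢) hgh_div (hasVelocity_leftTranslate hγ hγs) (by
    filter_upwards [hγs] with τ hτ
    rw [𝒢.s_div (hs.trans hτ.symm), 𝒢.s_div hτ.symm])
  rw [𝒢.mul_mul_inv_cancel hgh] at hdiv
  refine hdiv.unique ((HasVelocity.const g).congr ?_)
  filter_upwards [hγs] with τ hτ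
  rw [𝒢.div_div (hs.trans hτ.symm) hτ.symm, 𝒢.mul_mul_inv_cancel hgh]

theorem divL_rightTranslate_zero {g h : G} {u : E} (hgh : 𝒢.s g = 𝒢.t h)
    (hu : 𝒢.tangentS (𝒢.one (𝒢.t g)) u = 0) :
    𝒢.divL (𝒢.mul g h) h (𝒢.rightTranslate (𝒢.mul g h) u, 0) = 𝒢.rightTranslate g u := by
  have ht := 𝒢.t_mul _ _ hgh
  obtain ⟨γ, hγ, hγs⟩ := exists_curve_unit hu
  have hgh_mul := hasVelocity_rightTranslate (𝒢 := 𝒢) (g := 𝒢.mul g h) (by rwa [ht])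
    (by simpa only [ht] using hγs)
  have hdiv := hasVelocity_div (𝒢 := 𝒢) hgh_mul (HasVelocity.const h) (by
    filter_upwards [hγs] with τ hτ
    rw [𝒢.s_mul _ _ (hτ.trans ht.symm), 𝒢.s_mul _ _ hgh])
  rw [𝒢.mul_mul_inv_cancel hgh] at hdiv
  refine hdiv.unique ((hasVelocity_rightTranslate hγ hγs).congr ?_)
  filter_upwards [hγs] with τ hτ
  rw [← 𝒢.mul_assoc _ _ _ hτ hgh, 𝒢.mul_mul_inv_cancel ((𝒢.s_mul _ _ hτ).trans hgh)]

theorem divL_zero_rightTranslate {g h : G} {u : E} (hgh : 𝒢.s g = 𝒢.t h)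
    (hu : 𝒢.tangentS (𝒢.one (𝒢.t h)) u = 0) :
    𝒢.divL (𝒢.mul g h) h (0, 𝒢.rightTranslate h u) = 𝒢.leftTranslate g u := by
  have hs := 𝒢.s_mul _ _ hgh
  obtain ⟨γ, hγ, hγs⟩ := exists_curve_unit hu
  have hdiv := hasVelocity_div (𝒢 := 𝒢) (HasVelocity.const (𝒢.mul g h))
    (hasVelocity_rightTranslate hγ hγs) (by
      filter_upwards [hγs] with τ hτ
      rw [𝒢.s_mul _ _ hτ, hs])
  rw [𝒢.mul_mul_inv_cancel hgh] at hdiv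
  refine hdiv.unique ((hasVelocity_leftTranslate (γ := γ) (by rwa [hgh])
    (by simpa only [hgh] using hγs)).congr ?_)
  filter_upwards [hγs] with τ hτ
  rw [𝒢.inv_mul_rev hτ, ← 𝒢.mul_assoc _ _ _ (by rw [hs, 𝒢.t_inv])
    (by rw [𝒢.s_inv, 𝒢.t_inv, hτ]), 𝒢.mul_mul_inv_cancel hgh]

theorem leftInvariant_eq_leftTranslate {α : 𝒢.Cochain 0} (hα : IsSourceCompatible α) (g : G) :
    (𝒢.leftInvariant g α : E) = 𝒢.leftTranslate g (vecUnit α (𝒢.s g)) := by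
  obtain ⟨γ, hγ, hs⟩ := exists_curve_unit (hα (𝒢.s g))
  have hinv := hγ.comp ((𝒢.smooth_inv (𝒢.one (𝒢.s g))).mdifferentiableAt (by simp))
  rw [𝒢.inv_one] at hinv
  have hL : ContMDiffOn I I ∞ (fun h => 𝒢.mul g h) {h | 𝒢.t h = 𝒢.s g} :=
    𝒢.smooth_mul.comp (f := fun h : G => (g, h)) (contMDiff_const.prodMk contMDiff_id).contMDiffOn
      fun h hh => Eq.symm hh
  have hmul := hinv.comp_within
    ((hL (𝒢.one (𝒢.s g)) (𝒢.t_one _)).mdifferentiableWithinAt (by simp))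
    (hs.mono fun τ hτ => (𝒢.t_inv _).trans hτ)
  rw [𝒢.mul_one] at hmul
  exact hmul.unique (hasVelocity_leftTranslate hγ hs)

theorem rightInvariant_eq_rightTranslate {α : 𝒢.Cochain 0} (hα : IsSourceCompatible α) (g : G) :
    (𝒢.rightInvariant g α : E) = 𝒢.rightTranslate g (vecUnit α (𝒢.t g)) := by
  obtain ⟨γ, hγ, hs⟩ := exists_curve_unit (hα (𝒢.t g))
  have hR : ContMDiffOn I I ∞ (fun h => 𝒢.mul h g) {h | 𝒢.s h = 𝒢.t g} :=
    𝒢.smooth_mul.comp (f := fun h : G => (h, g)) (contMDiff_id.prodMk contMDiff_const).contMDiffOn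
      fun h hh => hh
  have hmul := hγ.comp_within
    ((hR (𝒢.one (𝒢.t g)) (𝒢.s_one _)).mdifferentiableWithinAt (by simp)) hs
  rw [𝒢.one_mul] at hmul
  exact hmul.unique (hasVelocity_rightTranslate hγ hs)

theorem vecTuple_diff_zero {α : 𝒢.Cochain 0} (hα : IsSourceCompatible α) (g : 𝒢.composable 0) :
    vecTuple (𝒢.diff 0 α) g = 𝒢.leftTranslate (g.1 0) (vecUnit α (𝒢.s (g.1 0))) +
      𝒢.rightTranslate (g.1 0) (vecUnit α (𝒢.t (g.1 0))) := by
  rw [← leftInvariant_eq_leftTranslate hα, ← rightInvariant_eq_rightTranslate hα]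
  rfl

/-! ### The differential squares to zero -/

theorem divTerm_diff_zero {α : 𝒢.Cochain 0} (hα : IsSourceCompatible α) (g : 𝒢.composable 1) :
    divTerm (𝒢.diff 0 α) g = vecTuple (𝒢.diff 0 α) (face 1 g) := by
  have hgh : 𝒢.s (g.1 0) = 𝒢.t (g.1 1) := g.2 0
  have hface : (face 0 g).1 0 = 𝒢.mul (g.1 0) (g.1 1) := rfl
  set p := g.1 0
  set q := g.1 1
  have hpair : (vecTuple (𝒢.diff 0 α) (face 0 g), vecTuple (𝒢.diff 0 α) (𝒢.dropFirst g)) =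
      (𝒢.leftTranslate (𝒢.mul p q) (vecUnit α (𝒢.s q)), 𝒢.leftTranslate q (vecUnit α (𝒢.s q))) +
        ((𝒢.rightTranslate (𝒢.mul p q) (vecUnit α (𝒢.t p)), 0) +
          (0, 𝒢.rightTranslate q (vecUnit α (𝒢.t q)))) := by
    rw [vecTuple_diff_zero hα, vecTuple_diff_zero hα, hface, 𝒢.s_mul _ _ hgh, 𝒢.t_mul _ _ hgh,
      dropFirst_zero]
    simp only [Prod.mk_add_mk, add_zero, zero_add]
    rfl
  rw [divTerm, hface, hpair, map_add, map_add, divL_leftTranslate_leftTranslate hgh (hα _),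
    divL_rightTranslate_zero hgh (hα _), divL_zero_rightTranslate hgh (hα _), zero_add, add_comm,
    vecTuple_diff_zero hα, face_succ_zero, ← hgh]

theorem divL_divTerm {n : ℕ} {c : 𝒢.Cochain (n + 1)} (hc : IsSourceCompatible c)
    (g : 𝒢.composable (n + 2)) :
    𝒢.divL ((face 0 g).1 0) (g.1 1) (divTerm c (face 0 g), divTerm c (𝒢.dropFirst g)) =
      divTerm c (face 1 g) := by
  have hface : (face 0 g).1 1 = g.1 2 := face_zero_succ g 0
  have hdrop : (𝒢.dropFirst g).1 1 = g.1 2 := rfl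
  have hface_s := s_face_zero (face 0 g)
  have hdrop_s := s_face_zero (𝒢.dropFirst g)
  have hface_ts := hc.tangentS_face_zero (face 0 g)
  have hdrop_ts := hc.tangentS_face_zero (𝒢.dropFirst g)
  have hface_div := div_face_zero (face 0 g)
  have hdrop_div := div_face_zero (𝒢.dropFirst g)
  rw [hface] at hface_s hface_ts hface_div
  rw [hdrop] at hdrop_s hdrop_ts hdrop_div
  rw [dropFirst_face_zero] at hface_ts
  have hcancel := divL_divL hface_s hdrop_s hface_ts hdrop_ts
  rw [hface_div, hdrop_div, dropFirst_zero] at hcancel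
  have hface_one : (face 1 g).1 1 = (face 0 (𝒢.dropFirst g)).1 0 := by
    rw [← dropFirst_zero, dropFirst_face_succ]
  rw [divTerm, divTerm, divTerm, hface, hdrop, dropFirst_face_zero, hcancel, hface_one,
    face_face (Nat.zero_le _), dropFirst_face_succ]

theorem diff_diff {n : ℕ} {c : 𝒢.Cochain n} (hc : IsSourceCompatible c) :
    𝒢.diff (n + 1) (𝒢.diff n c) = 0 := by
  refine cochain_ext_tuple fun g => ?_
  change _ = (0 : E)
  cases n with
  | zero =>
    rw [vecTuple_diff, divTerm_diff_zero hc, Finset.sum_range_one, pow_zero, one_smul,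
      neg_add_cancel]
  | succ n =>
    rw [vecTuple_diff, divTerm_diff, divL_divTerm hc, sum_vecTuple_diff_face,
      Finset.sum_range_succ' _ (n + 1)]
    simp only [pow_succ, mul_neg_one, neg_smul, Finset.sum_neg_distrib, pow_zero, one_smul,
      zero_add, add_assoc, Nat.reduceAdd]
    abel

/-! ### The differential preserves deformation cochains -/

theorem IsSourceCompatible.tangentS_divTerm {n : ℕ} {c : 𝒢.Cochain (n + 1)}
    (hc : IsSourceCompatible c) (g : 𝒢.composable (n + 1)) :
    𝒢.tangentS (g.1 0) (divTerm c g) = 𝒢.tangentT (g.1 1) (vecTuple c (𝒢.dropFirst g)) := by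
  have hdiv := tangentS_divL (s_face_zero g) (hc.tangentS_face_zero g)
  rwa [div_face_zero] at hdiv

theorem IsSourceCompatible.diff {n : ℕ} {c : 𝒢.Cochain n} (hc : IsSourceCompatible c) :
    IsSourceCompatible (𝒢.diff n c) := by
  intro g g' hg hs
  cases n with
  | zero =>
    rw [vecTuple_diff_zero hc, vecTuple_diff_zero hc, map_add, map_add,
      tangentS_leftTranslate (hc _), tangentS_leftTranslate (hc _), tangentS_rightTranslate (hc _),
      tangentS_rightTranslate (hc _), hs]
  | succ n =>
    have hdrop : 𝒢.dropFirst g = 𝒢.dropFirst g' := Subtype.ext (funext hg)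
    simp only [vecTuple_diff, map_add, map_neg, map_sum, map_smul, hc.tangentS_divTerm,
      hc.tangentS_face_succ _ hdrop hs, hdrop, show g.1 1 = g'.1 1 from hg 0]

theorem contMDiffOn_divTerm {n : ℕ} {c : 𝒢.Cochain (n + 1)} (hc : IsSourceCompatible c)
    (hc_smooth : IsSmoothCochain c) :
    ContMDiffOn (ModelWithCorners.pi fun _ : Fin (n + 2) => I) I.tangent ∞
      (fun g => (⟨g 0, 𝒢.divL (𝒢.faceFun 0 g 0) (g 1)
        (𝒢.extendZero c (𝒢.faceFun 0 g), 𝒢.extendZero c fun i => g i.succ)⟩ : TangentBundle I G))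
      (𝒢.composable (n + 1)) := by
  refine (contMDiffOn_divL (hc_smooth.contMDiffOn_faceFun 0) hc_smooth.contMDiffOn_dropFirst
    (fun g hg => s_face_zero ⟨g, hg⟩) fun g hg => ?_).congr
      fun g hg => tangentBundle_mk_congr (div_face_zero ⟨g, hg⟩).symm rfl
  rw [extendZero_eq_vecTuple c (faceFun_mem 0 hg), extendZero_eq_vecTuple c fun i => hg i.succ]
  exact hc.tangentS_face_zero ⟨g, hg⟩

theorem IsSmoothCochain.diff_zero {α : 𝒢.Cochain 0} (hα : IsSourceCompatible α)
    (hα_smooth : IsSmoothCochain α) : IsSmoothCochain (𝒢.diff 0 α) := by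
  have hproj : ContMDiff (ModelWithCorners.pi fun _ : Fin 1 => I) I ∞ fun g : Fin 1 → G => g 0 :=
    contMDiff_pi_eval 0
  refine (contMDiffOn_add_along ((contMDiff_leftTranslate hα hα_smooth).comp hproj).contMDiffOn
    ((contMDiff_rightTranslate hα hα_smooth).comp hproj).contMDiffOn).congr
      fun g hg => tangentBundle_mk_congr rfl ?_
  rw [extendZero_eq_vecTuple _ hg, vecTuple_diff_zero hα]
  rfl

theorem IsSmoothCochain.diff_succ {n : ℕ} {c : 𝒢.Cochain (n + 1)} (hc : IsSourceCompatible c)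
    (hc_smooth : IsSmoothCochain c) : IsSmoothCochain (𝒢.diff (n + 1) c) := by
  have hface : ∀ j, ContMDiffOn (ModelWithCorners.pi fun _ : Fin (n + 2) => I) I.tangent ∞
      (fun g => (⟨g 0, (-1 : ℝ) ^ j • 𝒢.extendZero c (𝒢.faceFun (j + 1) g)⟩ : TangentBundle I G))
      (𝒢.composable (n + 1)) := fun j =>
    contMDiffOn_smul_along _ ((hc_smooth.contMDiffOn_faceFun (j + 1)).congr fun g hg =>
      tangentBundle_mk_congr (face_succ_zero j ⟨g, hg⟩).symm rfl)
  refine (contMDiffOn_add_along (contMDiffOn_smul_along (-1) (contMDiffOn_divTerm hc hc_smooth))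
    (contMDiffOn_sum_along (Finset.range (n + 1)) (contMDiff_pi_eval 0).contMDiffOn hface)).congr
      fun g hg => tangentBundle_mk_congr rfl ?_
  rw [extendZero_eq_vecTuple _ hg, vecTuple_diff, divTerm, extendZero_eq_vecTuple c
    (faceFun_mem 0 hg), extendZero_eq_vecTuple c fun i => hg i.succ,
    ← neg_one_smul ℝ (𝒢.divL _ _ _)]
  refine congrArg _ (Finset.sum_congr rfl fun j _ => ?_)
  rw [extendZero_eq_vecTuple c (faceFun_mem (j + 1) hg)]
  rfl

theorem diff_mem_defCochains {n : ℕ} {c : 𝒢.Cochain n} (hc : c ∈ 𝒢.defCochains n) :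
    𝒢.diff n c ∈ 𝒢.defCochains (n + 1) := by
  rw [mem_defCochains] at hc ⊢
  cases n with
  | zero => exact ⟨hc.1.diff, IsSmoothCochain.diff_zero hc.1 hc.2⟩
  | succ n => exact ⟨hc.1.diff, IsSmoothCochain.diff_succ hc.1 hc.2⟩

end Differential

section Pullback

variable {E₁ H₁ E₁' H₁' E₂ H₂ E₂' H₂' E₃ H₃ E₃' H₃' : Type*}
  [NormedAddCommGroup E₁] [NormedSpace ℝ E₁] [TopologicalSpace H₁]
  [NormedAddCommGroup E₁'] [NormedSpace ℝ E₁'] [TopologicalSpace H₁']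
  [NormedAddCommGroup E₂] [NormedSpace ℝ E₂] [TopologicalSpace H₂]
  [NormedAddCommGroup E₂'] [NormedSpace ℝ E₂'] [TopologicalSpace H₂']
  [NormedAddCommGroup E₃] [NormedSpace ℝ E₃] [TopologicalSpace H₃]
  [NormedAddCommGroup E₃'] [NormedSpace ℝ E₃'] [TopologicalSpace H₃']
  {I₁ : ModelWithCorners ℝ E₁ H₁} {J₁ : ModelWithCorners ℝ E₁' H₁'}
  {I₂ : ModelWithCorners ℝ E₂ H₂} {J₂ : ModelWithCorners ℝ E₂' H₂'}
  {I₃ : ModelWithCorners ℝ E₃ H₃} {J₃ : ModelWithCorners ℝ E₃' H₃'}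
  {G₁ M₁ G₂ M₂ G₃ M₃ : Type u}
  [TopologicalSpace G₁] [ChartedSpace H₁ G₁] [IsManifold I₁ ∞ G₁]
  [TopologicalSpace M₁] [ChartedSpace H₁' M₁] [IsManifold J₁ ∞ M₁]
  [TopologicalSpace G₂] [ChartedSpace H₂ G₂] [IsManifold I₂ ∞ G₂]
  [TopologicalSpace M₂] [ChartedSpace H₂' M₂] [IsManifold J₂ ∞ M₂]
  [TopologicalSpace G₃] [ChartedSpace H₃ G₃] [IsManifold I₃ ∞ G₃]
  [TopologicalSpace M₃] [ChartedSpace H₃' M₃] [IsManifold J₃ ∞ M₃]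
  {𝒢₁ : LieGroupoid I₁ J₁ G₁ M₁} {𝒢₂ : LieGroupoid I₂ J₂ G₂ M₂} {𝒢₃ : LieGroupoid I₃ J₃ G₃ M₃}
  {Φ : G₁ → G₂} {f : M₁ → M₂}

theorem IsHom.comp {Ψ : G₂ → G₃} {f' : M₂ → M₃} (hΨ : 𝒢₂.IsHom 𝒢₃ Ψ f') (hΦ : 𝒢₁.IsHom 𝒢₂ Φ f) :
    𝒢₁.IsHom 𝒢₃ (Ψ ∘ Φ) (f' ∘ f) where
  smooth := hΨ.smooth.comp hΦ.smooth
  smooth_base := hΨ.smooth_base.comp hΦ.smooth_base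
  map_s g := (hΨ.map_s _).trans (congrArg f' (hΦ.map_s g))
  map_t g := (hΨ.map_t _).trans (congrArg f' (hΦ.map_t g))
  map_mul g h hgh := (congrArg Ψ (hΦ.map_mul g h hgh)).trans
    (hΨ.map_mul _ _ (by rw [hΦ.map_s, hΦ.map_t, hgh]))
  map_one x := (congrArg Ψ (hΦ.map_one x)).trans (hΨ.map_one _)
  map_inv g := (congrArg Ψ (hΦ.map_inv g)).trans (hΨ.map_inv _)

theorem IsHom.modelDeriv_leftTranslate [I₁.Boundaryless] (hΦ : 𝒢₁.IsHom 𝒢₂ Φ f) {g : G₁} {u : E₁}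
    (hu : 𝒢₁.tangentS (𝒢₁.one (𝒢₁.s g)) u = 0) :
    modelDeriv I₁ I₂ Φ g (𝒢₁.leftTranslate g u) =
      𝒢₂.leftTranslate (Φ g) (modelDeriv I₁ I₂ Φ (𝒢₁.one (𝒢₁.s g)) u) := by
  have hdiv := hΦ.modelDeriv_divL (u := 0) (𝒢₁.s_one (𝒢₁.s g)).symm (by rw [hu, map_zero])
  rwa [𝒢₁.inv_one, 𝒢₁.mul_one, map_zero, hΦ.map_one, ← hΦ.map_s] at hdiv

theorem IsHom.modelDeriv_rightTranslate [I₁.Boundaryless] (hΦ : 𝒢₁.IsHom 𝒢₂ Φ f) {g : G₁} {u : E₁}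
    (hu : 𝒢₁.tangentS (𝒢₁.one (𝒢₁.t g)) u = 0) :
    modelDeriv I₁ I₂ Φ g (𝒢₁.rightTranslate g u) =
      𝒢₂.rightTranslate (Φ g) (modelDeriv I₁ I₂ Φ (𝒢₁.one (𝒢₁.t g)) u) := by
  have hdiv := hΦ.modelDeriv_divL (v := 0) ((𝒢₁.s_one (𝒢₁.t g)).trans (𝒢₁.s_inv g).symm)
    (by rw [hu, map_zero])
  rwa [𝒢₁.inv_inv, 𝒢₁.one_mul, map_zero, hΦ.map_one, ← hΦ.map_t, hΦ.map_inv] at hdiv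

namespace Aut

/-- The automorphism `Φ ∘ Ψ`. -/
def trans (Ψ Φ : 𝒢₁.Aut) : 𝒢₁.Aut where
  toFun := Φ.toFun ∘ Ψ.toFun
  base := Φ.base ∘ Ψ.base
  invFun := Ψ.invFun ∘ Φ.invFun
  invBase := Ψ.invBase ∘ Φ.invBase
  isHom := Φ.isHom.comp Ψ.isHom
  isHom_inv := Ψ.isHom_inv.comp Φ.isHom_inv
  left_inv g := (congrArg Ψ.invFun (Φ.left_inv _)).trans (Ψ.left_inv g)
  right_inv g := (congrArg Φ.toFun (Ψ.right_inv _)).trans (Φ.right_inv g)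
  base_left_inv x := (congrArg Ψ.invBase (Φ.base_left_inv _)).trans (Ψ.base_left_inv x)
  base_right_inv x := (congrArg Φ.base (Ψ.base_right_inv _)).trans (Φ.base_right_inv x)

theorem vecUnit_pullback (Ψ : 𝒢₁.Aut) (α : 𝒢₁.Cochain 0) (x : M₁) :
    vecUnit (Ψ.pullback 0 α) x =
      modelDeriv I₁ I₁ Ψ.invFun (𝒢₁.one (Ψ.base x)) (vecUnit α (Ψ.base x)) := rfl

theorem vecTuple_pullback (Ψ : 𝒢₁.Aut) {n : ℕ} (c : 𝒢₁.Cochain (n + 1)) (g : 𝒢₁.composable n) :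
    vecTuple (Ψ.pullback (n + 1) c) g =
      modelDeriv I₁ I₁ Ψ.invFun (Ψ.toFun (g.1 0)) (vecTuple c (Ψ.mapTuple g)) := rfl

theorem mapTuple_apply (Ψ : 𝒢₁.Aut) {n : ℕ} (g : 𝒢₁.composable n) (i : Fin (n + 1)) :
    (Ψ.mapTuple g).1 i = Ψ.toFun (g.1 i) := rfl

theorem mapTuple_face (Ψ : 𝒢₁.Aut) {n : ℕ} (j : ℕ) (g : 𝒢₁.composable (n + 1)) :
    Ψ.mapTuple (face j g) = face j (Ψ.mapTuple g) := by
  refine Subtype.ext (funext fun k => ?_)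
  simp only [Aut.mapTuple, face, faceFun]
  split_ifs
  · rfl
  · exact Ψ.isHom.map_mul _ _ (g.2 k)
  · rfl

theorem modelDeriv_invFun_trans (Ψ Φ : 𝒢₁.Aut) (g : G₁) (v : E₁) :
    modelDeriv I₁ I₁ (Ψ.trans Φ).invFun g v =
      modelDeriv I₁ I₁ Ψ.invFun (Φ.invFun g) (modelDeriv I₁ I₁ Φ.invFun g v) :=
  DFunLike.congr_fun (modelDeriv_comp g ((Ψ.isHom_inv.smooth _).mdifferentiableAt (by simp))
    ((Φ.isHom_inv.smooth _).mdifferentiableAt (by simp))) v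

theorem pullback_trans (Ψ Φ : 𝒢₁.Aut) (n : ℕ) (c : 𝒢₁.Cochain n) :
    (Ψ.trans Φ).pullback n c = Ψ.pullback n (Φ.pullback n c) := by
  refine funext fun p => ?_
  cases n with
  | zero =>
    have hunit := modelDeriv_invFun_trans Ψ Φ (𝒢₁.one (Φ.base (Ψ.base p)))
      (vecUnit c (Φ.base (Ψ.base p)))
    rw [Φ.inv_one_base] at hunit
    exact hunit
  | succ n =>
    have htuple := modelDeriv_invFun_trans Ψ Φ (Φ.toFun (Ψ.toFun (p.1 0)))
      (vecTuple c (Φ.mapTuple (Ψ.mapTuple p)))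
    rw [Φ.left_inv] at htuple
    exact htuple

end Aut

variable (Ψ : 𝒢₁.Aut)

theorem IsSourceCompatible.pullback {n : ℕ} {c : 𝒢₁.Cochain n} (hc : IsSourceCompatible c) :
    IsSourceCompatible (Ψ.pullback n c) := by
  cases n with
  | zero =>
    intro x
    rw [Aut.vecUnit_pullback, ← Ψ.inv_one_base, Ψ.isHom_inv.tangentS_modelDeriv, hc, map_zero]
  | succ n =>
    intro g g' hg hs
    have htangentS : ∀ g : 𝒢₁.composable n,
        𝒢₁.tangentS (g.1 0) (vecTuple (Ψ.pullback (n + 1) c) g) =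
          modelDeriv J₁ J₁ Ψ.invBase (Ψ.base (𝒢₁.s (g.1 0)))
            (𝒢₁.tangentS (Ψ.toFun (g.1 0)) (vecTuple c (Ψ.mapTuple g))) := fun g => by
      have htangent := Ψ.isHom_inv.tangentS_modelDeriv (Ψ.toFun (g.1 0))
        (vecTuple c (Ψ.mapTuple g))
      rwa [Ψ.left_inv, Ψ.isHom.map_s] at htangent
    have hcompat := hc (Ψ.mapTuple g) (Ψ.mapTuple g') (fun i => congrArg Ψ.toFun (hg i))
      (by rw [Aut.mapTuple_apply, Aut.mapTuple_apply, Ψ.isHom.map_s, Ψ.isHom.map_s, hs])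
    rw [htangentS, htangentS, hs]
    exact congrArg _ hcompat

variable [I₁.Boundaryless]

theorem divTerm_pullback {n : ℕ} {c : 𝒢₁.Cochain (n + 1)} (hc : IsSourceCompatible c)
    (g : 𝒢₁.composable (n + 1)) :
    divTerm (Ψ.pullback (n + 1) c) g =
      modelDeriv I₁ I₁ Ψ.invFun (Ψ.toFun (g.1 0)) (divTerm c (Ψ.mapTuple g)) := by
  have hdiv := Ψ.isHom_inv.modelDeriv_divL (s_face_zero (Ψ.mapTuple g))
    (hc.tangentS_face_zero (Ψ.mapTuple g))
  rw [div_face_zero, ← Aut.mapTuple_face, Aut.mapTuple_apply, Aut.mapTuple_apply,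
    Aut.mapTuple_apply, Ψ.left_inv, Ψ.left_inv] at hdiv
  rw [divTerm, divTerm, ← Aut.mapTuple_face]
  exact hdiv.symm

theorem diff_pullback {n : ℕ} {c : 𝒢₁.Cochain n} (hc : IsSourceCompatible c) :
    𝒢₁.diff n (Ψ.pullback n c) = Ψ.pullback (n + 1) (𝒢₁.diff n c) := by
  refine cochain_ext_tuple fun g => ?_
  cases n with
  | zero =>
    rw [vecTuple_diff_zero (hc.pullback Ψ), Aut.vecTuple_pullback, vecTuple_diff_zero hc,
      Aut.mapTuple_apply, map_add, Ψ.isHom_inv.modelDeriv_leftTranslate (hc _),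
      Ψ.isHom_inv.modelDeriv_rightTranslate (hc _), Ψ.left_inv, Ψ.isHom.map_s, Ψ.isHom.map_t,
      Aut.vecUnit_pullback, Aut.vecUnit_pullback]
  | succ n =>
    rw [vecTuple_diff, Aut.vecTuple_pullback, vecTuple_diff, divTerm_pullback Ψ hc, map_add,
      map_neg, map_sum]
    congr 1
    refine Finset.sum_congr rfl fun j _ => ?_
    rw [Aut.vecTuple_pullback, map_smul, face_succ_zero, Aut.mapTuple_face]

end Pullback

section Limits

variable {E H E' H' : Type*} [NormedAddCommGroup E] [NormedSpace ℝ E]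
  [TopologicalSpace H] [NormedAddCommGroup E'] [NormedSpace ℝ E'] [TopologicalSpace H']
  {I : ModelWithCorners ℝ E H} {J : ModelWithCorners ℝ E' H'}
  {G M : Type u} [TopologicalSpace G] [ChartedSpace H G] [IsManifold I ∞ G]
  [TopologicalSpace M] [ChartedSpace H' M] [IsManifold J ∞ M]
  {𝒢 : LieGroupoid I J G M}

instance cochain_t2Space (n : ℕ) : T2Space (𝒢.Cochain n) :=
  haveI (p : 𝒢.Pt n) : T2Space (TangentSpace I (𝒢.foot n p)) := inferInstanceAs (T2Space E)
  inferInstance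

theorem continuous_vecUnit (x : M) : Continuous fun α : 𝒢.Cochain 0 => vecUnit α x :=
  continuous_apply (A := fun p : 𝒢.Pt 0 => TangentSpace I (𝒢.foot 0 p)) x

theorem continuous_vecTuple {n : ℕ} (g : 𝒢.composable n) :
    Continuous fun c : 𝒢.Cochain (n + 1) => vecTuple c g :=
  continuous_apply (A := fun p : 𝒢.Pt (n + 1) => TangentSpace I (𝒢.foot (n + 1) p)) g

theorem Aut.continuous_pullback (Ψ : 𝒢.Aut) (n : ℕ) : Continuous (Ψ.pullback n) := by
  refine continuous_pi fun p => ?_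
  cases n with
  | zero => exact (modelDeriv I I Ψ.invFun _).continuous.comp (continuous_vecUnit (Ψ.base p))
  | succ n => exact (modelDeriv I I Ψ.invFun _).continuous.comp (continuous_vecTuple (Ψ.mapTuple p))

theorem continuous_diff_zero : Continuous (𝒢.diff 0) := by
  refine continuous_pi fun g => Continuous.add (M := E) ?_ ?_
  · exact (ContinuousLinearMap.continuous (M₁ := E) (M₂ := E) _).comp
      ((modelDeriv I I 𝒢.inv _).continuous.comp (continuous_vecUnit (𝒢.s (g.1 0))))
  · exact (ContinuousLinearMap.continuous (M₁ := E) (M₂ := E) _).comp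
      (continuous_vecUnit (𝒢.t (g.1 0)))

theorem continuous_diff (n : ℕ) : Continuous (𝒢.diff n) := by
  cases n with
  | zero => exact continuous_diff_zero
  | succ n =>
    have hdiff : ∀ g, Continuous fun c => vecTuple (𝒢.diff (n + 1) c) g := fun g => by
      simp_rw [vecTuple_diff, divTerm]
      exact ((𝒢.divL _ _).continuous.comp
        ((continuous_vecTuple _).prodMk (continuous_vecTuple _))).neg.add
          (continuous_finsetSum _ fun j _ => (continuous_vecTuple _).const_smul _)
    exact continuous_pi hdiff

theorem isClosed_setOf_isSourceCompatible (n : ℕ) :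
    IsClosed {c : 𝒢.Cochain n | IsSourceCompatible c} := by
  cases n with
  | zero =>
    simp only [IsSourceCompatible, ofPred_forall]
    exact isClosed_iInter fun x => isClosed_eq
      ((𝒢.tangentS _).continuous.comp (continuous_vecUnit x)) continuous_const
  | succ n =>
    simp only [IsSourceCompatible, ofPred_forall]
    exact isClosed_iInter fun g => isClosed_iInter fun g' => isClosed_iInter fun _ =>
      isClosed_iInter fun _ => isClosed_eq
        ((𝒢.tangentS _).continuous.comp (continuous_vecTuple g))
        ((𝒢.tangentS _).continuous.comp (continuous_vecTuple g'))

theorem IsSourceCompatible.const_smul {n : ℕ} {c : 𝒢.Cochain n} (hc : IsSourceCompatible c)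
    (a : ℝ) : IsSourceCompatible (a • c) := by
  cases n with
  | zero =>
    intro x
    rw [show vecUnit (a • c) x = a • vecUnit c x from rfl, map_smul, hc, smul_zero]
  | succ n =>
    intro g g' hg hs
    have hsmul : ∀ g, vecTuple (a • c) g = a • vecTuple c g := fun _ => rfl
    simp only [hsmul, map_smul, hc g g' hg hs]

theorem IsSourceCompatible.sub {n : ℕ} {c d : 𝒢.Cochain n} (hc : IsSourceCompatible c)
    (hd : IsSourceCompatible d) : IsSourceCompatible (c - d) := by
  cases n with
  | zero =>
    intro x
    rw [show vecUnit (c - d) x = vecUnit c x - vecUnit d x from rfl, map_sub, hc, hd, sub_zero]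
  | succ n =>
    intro g g' hg hs
    have hsub : ∀ g, vecTuple (c - d) g = vecTuple c g - vecTuple d g := fun _ => rfl
    simp only [hsub, map_sub, hc g g' hg hs, hd g g' hg hs]

end Limits

end LieGroupoid

section TangentCoordinates

variable {E H E₁ H₁ : Type*} [NormedAddCommGroup E] [NormedSpace ℝ E]
  [TopologicalSpace H] [NormedAddCommGroup E₁] [NormedSpace ℝ E₁] [TopologicalSpace H₁]
  {I : ModelWithCorners ℝ E H} {L : ModelWithCorners ℝ E₁ H₁}
  {G N : Type*} [TopologicalSpace G] [ChartedSpace H G] [IsManifold I ∞ G]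
  [TopologicalSpace N] [ChartedSpace H₁ N]

/-- The derivative at `w` of the extended chart around `w₀`, which sends a tangent vector at `w` to
its components in that chart. -/
noncomputable def chartDeriv (I : ModelWithCorners ℝ E H) (w₀ w : G) : E →L[ℝ] E :=
  modelDeriv I 𝓘(ℝ, E) (extChartAt I w₀) w

theorem trivializationAt_tangent_snd {w₀ w : G} (hw : w ∈ (chartAt H w₀).source) (u : E) :
    (trivializationAt E (TangentSpace I : G → Type _) w₀ ⟨w, u⟩).2 = chartDeriv I w₀ w u := by
  have hcoord : (trivializationAt E (TangentSpace I : G → Type _) w₀).continuousLinearMapAt ℝ w u =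
      (trivializationAt E (TangentSpace I : G → Type _) w₀ ⟨w, u⟩).2 :=
    congrFun (Trivialization.coe_linearMapAt_of_mem (R := ℝ)
      (trivializationAt E (TangentSpace I : G → Type _) w₀) (by simpa using hw)) u
  rw [← hcoord, TangentBundle.continuousLinearMapAt_trivializationAt (I := I) hw]
  rfl

theorem contMDiffWithinAt_along_iff {b : N → G} {v : N → E} {S : Set N} {x₀ : N} {w₀ : G}
    (hw : b x₀ ∈ (chartAt H w₀).source) :
    ContMDiffWithinAt L I.tangent ∞ (fun x => (⟨b x, v x⟩ : TangentBundle I G)) S x₀ ↔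
      ContMDiffWithinAt L I ∞ b S x₀ ∧ ContMDiffWithinAt L 𝓘(ℝ, E) ∞
        (fun x => chartDeriv I w₀ (b x) (v x)) S x₀ := by
  rw [(trivializationAt E (TangentSpace I : G → Type _) w₀).contMDiffWithinAt_iff (IB := I)
    (by rw [Trivialization.mem_source]; simpa using hw)]
  refine and_congr_right fun hb => ?_
  refine Filter.EventuallyEq.contMDiffWithinAt_iff ?_ (trivializationAt_tangent_snd hw _)
  filter_upwards [hb.continuousWithinAt ((chartAt H w₀).open_source.mem_nhds hw)] with x hx
    using trivializationAt_tangent_snd hx _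

theorem chartDeriv_self (w : G) (u : E) : chartDeriv I w w u = u := by
  have : IsManifold I 1 G := IsManifold.of_le (n := ∞) (by norm_cast)
  exact DFunLike.congr_fun (mfderiv_extChartAt_self (I := I) (x := w)) u

end TangentCoordinates

namespace VBGroupoid

instance zeroPlus_neBot : zeroPlus.NeBot := by
  refine mem_closure_iff_comap_neBot.1 ?_
  rw [closure_Ioi]
  exact mem_Ici.2 le_rfl

theorem tendsto_val_zeroPlus : Tendsto (fun r : Ioi (0 : ℝ) => (r : ℝ)) zeroPlus (𝓝 0) :=
  tendsto_comap

theorem tendsto_val_zeroPlus_ne : Tendsto (fun r : Ioi (0 : ℝ) => (r : ℝ)) zeroPlus (𝓝[≠] 0) :=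
  tendsto_nhdsWithin_iff.2 ⟨tendsto_val_zeroPlus, Eventually.of_forall fun r => r.2.ne'⟩

end VBGroupoid

section ScaleSnd

open VBGroupoid

variable {F₁ F₂ : Type*} [NormedAddCommGroup F₁] [NormedSpace ℝ F₁]
  [NormedAddCommGroup F₂] [NormedSpace ℝ F₂]

variable (F₁ F₂) in
/-- The linear map `(x, y) ↦ (x, r • y)`, which is fiberwise multiplication by `r` in a chart of
the total space of a vector bundle. -/
noncomputable def scaleSnd (r : ℝ) : F₁ × F₂ →L[ℝ] F₁ × F₂ :=
  (ContinuousLinearMap.id ℝ F₁).prodMap (r • ContinuousLinearMap.id ℝ F₂)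

theorem scaleSnd_apply (r : ℝ) (p : F₁ × F₂) : scaleSnd F₁ F₂ r p = (p.1, r • p.2) := rfl

theorem tendsto_smul_scaleSnd {φ : ℝ → F₁ × F₂} (hφ : ContinuousAt φ 0) :
    Tendsto (fun r : Ioi (0 : ℝ) => (r : ℝ) • scaleSnd F₁ F₂ (r : ℝ)⁻¹ (φ r)) zeroPlus
      (𝓝 (0, (φ 0).2)) := by
  have hlim := hφ.tendsto.comp tendsto_val_zeroPlus
  have hfst := tendsto_val_zeroPlus.smul ((continuous_fst.tendsto _).comp hlim)
  rw [zero_smul] at hfst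
  refine (hfst.prodMk_nhds ((continuous_snd.tendsto _).comp hlim)).congr fun r => ?_
  exact Prod.ext rfl (smul_inv_smul₀ r.2.ne' _).symm

theorem tendsto_scaleSnd_sub {φ : ℝ → F₁ × F₂} (hφ : DifferentiableAt ℝ φ 0) :
    Tendsto (fun r : Ioi (0 : ℝ) => scaleSnd F₁ F₂ (r : ℝ)⁻¹ (φ r) - (r : ℝ)⁻¹ • (0, (φ 0).2))
      zeroPlus (𝓝 ((φ 0).1, deriv (fun r => (φ r).2) 0)) := by
  have hfst := (continuous_fst.tendsto _).comp (hφ.continuousAt.tendsto.comp tendsto_val_zeroPlus)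
  have hslope :=
    (hasDerivAt_iff_tendsto_slope_zero.1 hφ.snd.hasDerivAt).comp tendsto_val_zeroPlus_ne
  refine (hfst.prodMk_nhds hslope).congr fun r => Prod.ext ?_ ?_
  · simp [scaleSnd_apply]
  · simp [scaleSnd_apply, smul_sub]

end ScaleSnd

/-! ### Fiberwise multiplication in bundle charts -/

section FiberScaling

theorem fiberSMul_mul {B F : Type*} {V : B → Type*} [∀ x, AddCommGroup (V x)]
    [∀ x, Module ℝ (V x)] (a b : ℝ) (w : TotalSpace F V) :
    fiberSMul (a * b) w = fiberSMul a (fiberSMul b w) := by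
  rw [fiberSMul, mul_smul, fiberSMul, fiberSMul]

variable {EG HG : Type*} [NormedAddCommGroup EG] [NormedSpace ℝ EG] [TopologicalSpace HG]
  {IG : ModelWithCorners ℝ EG HG}
  {G : Type*} [TopologicalSpace G] [ChartedSpace HG G]
  {FW : Type*} [NormedAddCommGroup FW]
  {W : G → Type*} [∀ g, TopologicalSpace (W g)] [TopologicalSpace (TotalSpace FW W)]
  [FiberBundle FW W]

theorem mem_chartAt_totalSpace_iff {w₀ w : TotalSpace FW W} :
    w ∈ (chartAt (ModelProd HG FW) w₀).source ↔
      w.proj ∈ (trivializationAt FW W w₀.proj).baseSet ∧ w.proj ∈ (chartAt HG w₀.proj).source := by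
  rw [FiberBundle.chartedSpace_chartAt]
  simp only [mfld_simps]
  rw [Trivialization.mem_source]
  refine and_congr_right fun h => ?_
  rw [Trivialization.coe_fst' _ h]

variable [∀ g, AddCommGroup (W g)] [∀ g, Module ℝ (W g)]

theorem mem_chartAt_fiberSMul {w₀ w : TotalSpace FW W} (r : ℝ)
    (hw : w ∈ (chartAt (ModelProd HG FW) w₀).source) :
    fiberSMul r w ∈ (chartAt (ModelProd HG FW) w₀).source :=
  mem_chartAt_totalSpace_iff.2 (mem_chartAt_totalSpace_iff (w := w).1 hw)

variable [NormedSpace ℝ FW] [VectorBundle ℝ FW W]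

theorem trivializationAt_fiberSMul_snd {x₀ : G} (r : ℝ) {w : TotalSpace FW W}
    (hw : w.proj ∈ (trivializationAt FW W x₀).baseSet) :
    (trivializationAt FW W x₀ (fiberSMul r w)).2 = r • (trivializationAt FW W x₀ w).2 :=
  ((trivializationAt FW W x₀).linear ℝ hw).map_smul r w.2

theorem extChartAt_fiberSMul {w₀ w : TotalSpace FW W} (r : ℝ)
    (hw : w ∈ (chartAt (ModelProd HG FW) w₀).source) :
    extChartAt (IG.prod 𝓘(ℝ, FW)) w₀ (fiberSMul r w) =
      scaleSnd EG FW r (extChartAt (IG.prod 𝓘(ℝ, FW)) w₀ w) := by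
  have hbase : w.proj ∈ (trivializationAt FW W w₀.proj).baseSet :=
    (mem_chartAt_totalSpace_iff.1 hw).1
  have hbase_smul : (fiberSMul r w).proj ∈ (trivializationAt FW W w₀.proj).baseSet := hbase
  rw [FiberBundle.extChartAt]
  simp only [PartialEquiv.coe_trans, Function.comp_apply, PartialEquiv.prod_coe,
    PartialEquiv.refl_coe, id, scaleSnd_apply, OpenPartialHomeomorph.coe_toPartialEquiv,
    Trivialization.coe_coe]
  refine Prod.ext ?_ (trivializationAt_fiberSMul_snd r hbase)
  rw [Trivialization.coe_fst' _ hbase, Trivialization.coe_fst' _ hbase_smul]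
  rfl

theorem contMDiff_fiberSMul_prod :
    ContMDiff (𝓘(ℝ, ℝ).prod (IG.prod 𝓘(ℝ, FW))) (IG.prod 𝓘(ℝ, FW)) ∞
      (fun p : ℝ × TotalSpace FW W => fiberSMul p.1 p.2) := by
  intro p₀
  have hproj : ContMDiff (𝓘(ℝ, ℝ).prod (IG.prod 𝓘(ℝ, FW))) IG ∞
    (fun p : ℝ × TotalSpace FW W => p.2.proj) := (contMDiff_proj W).comp contMDiff_snd
  have hcomponents := (Bundle.contMDiffAt_totalSpace (F := FW) (E := W)).1
    (contMDiff_snd (I := 𝓘(ℝ, ℝ)) (J := IG.prod 𝓘(ℝ, FW)) (M := ℝ) (N := TotalSpace FW W)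
      (n := ∞) p₀)
  refine Bundle.contMDiffAt_totalSpace.2 ⟨hproj p₀, ?_⟩
  have hbase : ∀ᶠ p in 𝓝 p₀, p.2.proj ∈ (trivializationAt FW W p₀.2.proj).baseSet :=
    hproj.continuous.continuousAt ((trivializationAt FW W p₀.2.proj).open_baseSet.mem_nhds
      (mem_baseSet_trivializationAt FW W p₀.2.proj))
  refine (contMDiffAt_fst.smul hcomponents.2).congr_of_eventuallyEq ?_
  filter_upwards [hbase] with p hp using trivializationAt_fiberSMul_snd p.1 hp

theorem contMDiff_fiberSMul (r : ℝ) :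
    ContMDiff (IG.prod 𝓘(ℝ, FW)) (IG.prod 𝓘(ℝ, FW)) ∞
      (fiberSMul r : TotalSpace FW W → TotalSpace FW W) :=
  contMDiff_fiberSMul_prod.comp (contMDiff_const.prodMk contMDiff_id)

theorem contMDiff_fiberSMul_tuple (n : ℕ) :
    ContMDiff (𝓘(ℝ, ℝ).prod (ModelWithCorners.pi fun _ : Fin n => IG.prod 𝓘(ℝ, FW)))
      (ModelWithCorners.pi fun _ : Fin n => IG.prod 𝓘(ℝ, FW)) ∞
      (fun p : ℝ × (Fin n → TotalSpace FW W) => fun i => fiberSMul p.1 (p.2 i)) := by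
  intro p
  refine contMDiffWithinAt_univ.1 (contMDiffWithinAt_pi fun i => ?_)
  exact ((contMDiff_fiberSMul_prod (IG := IG) (W := W)).comp
    (contMDiff_fst.prodMk ((contMDiff_pi_eval i).comp contMDiff_snd)) p).contMDiffWithinAt

theorem chartDeriv_fiberSMul [IsManifold IG ∞ G] [ContMDiffVectorBundle ∞ FW W IG]
    {w₀ w : TotalSpace FW W} (r : ℝ)
    (hw : w ∈ (chartAt (ModelProd HG FW) w₀).source) (u : EG × FW) :
    chartDeriv (IG.prod 𝓘(ℝ, FW)) w₀ (fiberSMul r w)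
        (modelDeriv (IG.prod 𝓘(ℝ, FW)) (IG.prod 𝓘(ℝ, FW)) (fiberSMul r) w u) =
      scaleSnd EG FW r (chartDeriv (IG.prod 𝓘(ℝ, FW)) w₀ w u) := by
  have : IsManifold (IG.prod 𝓘(ℝ, FW)) ∞ (TotalSpace FW W) :=
    Bundle.TotalSpace.isManifold FW W
  have hchart : ∀ w ∈ (chartAt (ModelProd HG FW) w₀).source,
      MDifferentiableAt (IG.prod 𝓘(ℝ, FW)) 𝓘(ℝ, EG × FW) (extChartAt (IG.prod 𝓘(ℝ, FW)) w₀) w :=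
    fun w hw => (contMDiffAt_extChartAt' (n := ∞) hw).mdifferentiableAt (by simp)
  have hcomp_smul := modelDeriv_comp w (hchart _ (mem_chartAt_fiberSMul r hw))
    ((contMDiff_fiberSMul (IG := IG) (W := W) r w).mdifferentiableAt (by simp))
  have hcomp_scale := modelDeriv_comp w
    (scaleSnd EG FW r).differentiableAt.mdifferentiableAt (hchart w hw)
  have hscale : modelDeriv 𝓘(ℝ, EG × FW) 𝓘(ℝ, EG × FW) (scaleSnd EG FW r)
      (extChartAt (IG.prod 𝓘(ℝ, FW)) w₀ w) = scaleSnd EG FW r :=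
    mfderiv_eq_fderiv.trans (scaleSnd EG FW r).fderiv
  have hcongr : modelDeriv (IG.prod 𝓘(ℝ, FW)) 𝓘(ℝ, EG × FW)
        (extChartAt (IG.prod 𝓘(ℝ, FW)) w₀ ∘ fiberSMul r) w =
      modelDeriv (IG.prod 𝓘(ℝ, FW)) 𝓘(ℝ, EG × FW)
        (scaleSnd EG FW r ∘ extChartAt (IG.prod 𝓘(ℝ, FW)) w₀) w := by
    refine Filter.EventuallyEq.mfderiv_eq ?_
    filter_upwards [(chartAt (ModelProd HG FW) w₀).open_source.mem_nhds hw] with z hz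
      using extChartAt_fiberSMul r hz
  rw [hcomp_smul, hcomp_scale, hscale] at hcongr
  exact DFunLike.congr_fun hcongr u

end FiberScaling

/-! ### Core and linear parts of vector fields -/

section Linearization

open VBGroupoid

variable {EG HG : Type*} [NormedAddCommGroup EG] [NormedSpace ℝ EG] [TopologicalSpace HG]
  {IG : ModelWithCorners ℝ EG HG}
  {G : Type*} [TopologicalSpace G] [ChartedSpace HG G] [IsManifold IG ∞ G]
  {FW : Type*} [NormedAddCommGroup FW] [NormedSpace ℝ FW]
  {W : G → Type*} [∀ g, AddCommGroup (W g)] [∀ g, Module ℝ (W g)]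
  [∀ g, TopologicalSpace (W g)] [TopologicalSpace (TotalSpace FW W)]
  [FiberBundle FW W] [VectorBundle ℝ FW W] [ContMDiffVectorBundle ∞ FW W IG]
  {E₁ H₁ : Type*} [NormedAddCommGroup E₁] [NormedSpace ℝ E₁] [TopologicalSpace H₁]
  {L : ModelWithCorners ℝ E₁ H₁} {N : Type*} [TopologicalSpace N] [ChartedSpace H₁ N]

variable (IG L) in
/-- A vector field `v` along a map `b` from `S ⊆ N` to the total space of a vector bundle, where `b`
intertwines a family `sc` of self-maps of `N` with the fiberwise multiplications. It models a
cochain, with `N` the space of objects or of tuples of arrows and `sc` its fiberwise scaling. -/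
structure IsFieldAlongEquivariantMap (S : Set N) (sc : ℝ → N → N) (b : N → TotalSpace FW W)
    (v : N → EG × FW) : Prop where
  smooth_scale : ContMDiff (𝓘(ℝ, ℝ).prod L) L ∞ (fun p : ℝ × N => sc p.1 p.2)
  mapsTo_scale : ∀ r, MapsTo (sc r) S S
  equivariant : ∀ r x, b (sc r x) = fiberSMul r (b x)
  smooth : ContMDiffOn L (IG.prod 𝓘(ℝ, FW)).tangent ∞
    (fun x => (⟨b x, v x⟩ : TangentBundle (IG.prod 𝓘(ℝ, FW)) (TotalSpace FW W))) S

variable (IG) (sc : ℝ → N → N) (b : N → TotalSpace FW W) (v : N → EG × FW)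

/-- The pull-back `x ↦ Th_r⁻¹ (v (r x))` of a vector field `v` along `b` by the homothety `h_r`. -/
noncomputable def homothetyPullback (r : ℝ) (x : N) : EG × FW :=
  modelDeriv (IG.prod 𝓘(ℝ, FW)) (IG.prod 𝓘(ℝ, FW)) (fiberSMul r⁻¹) (b (sc r x)) (v (sc r x))

/-- The components of `v (r x)` in the bundle chart around `w₀`. -/
noncomputable def scaledComponents (w₀ : TotalSpace FW W) (r : ℝ) (x : N) : EG × FW :=
  chartDeriv (IG.prod 𝓘(ℝ, FW)) w₀ (b (sc r x)) (v (sc r x))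

/-- The coefficient of `r⁻¹` in the expansion of `homothetyPullback` at `r = 0`, computed in the
bundle chart around the foot point. -/
noncomputable def corePart (x : N) : EG × FW := (0, (scaledComponents IG sc b v (b x) 0 x).2)

/-- The constant coefficient in the expansion of `homothetyPullback` at `r = 0`, computed in the
bundle chart around the foot point. -/
noncomputable def linearPart (x : N) : EG × FW :=
  ((scaledComponents IG sc b v (b x) 0 x).1,
    deriv (fun r => (scaledComponents IG sc b v (b x) r x).2) 0)

namespace IsFieldAlongEquivariantMap

variable {IG sc b v} {S : Set N} {w₀ : TotalSpace FW W} {x : N}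

theorem chartDeriv_homothetyPullback (h : IsFieldAlongEquivariantMap IG L S sc b v) {r : ℝ}
    (hr : r ≠ 0) (hbx : b x ∈ (chartAt (ModelProd HG FW) w₀).source) :
    chartDeriv (IG.prod 𝓘(ℝ, FW)) w₀ (b x) (homothetyPullback IG sc b v r x) =
      scaleSnd EG FW r⁻¹ (scaledComponents IG sc b v w₀ r x) := by
  have hchart := chartDeriv_fiberSMul (IG := IG) (w₀ := w₀) (w := b (sc r x)) r⁻¹
    (by rw [h.equivariant]; exact mem_chartAt_fiberSMul r hbx) (v (sc r x))
  have hfoot : fiberSMul r⁻¹ (b (sc r x)) = b x := by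
    rw [h.equivariant, fiberSMul_cancel (inv_mul_cancel₀ hr)]
  rwa [hfoot] at hchart

theorem homothetyPullback_eq (h : IsFieldAlongEquivariantMap IG L S sc b v) {r : ℝ} (hr : r ≠ 0)
    (x : N) : homothetyPullback IG sc b v r x =
      scaleSnd EG FW r⁻¹ (scaledComponents IG sc b v (b x) r x) := by
  have : IsManifold (IG.prod 𝓘(ℝ, FW)) ∞ (TotalSpace FW W) := Bundle.TotalSpace.isManifold FW W
  rw [← h.chartDeriv_homothetyPullback hr (mem_chart_source _ _), chartDeriv_self]

theorem contMDiffWithinAt_scaledComponents (h : IsFieldAlongEquivariantMap IG L S sc b v)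
    (hx : x ∈ S) (hbx : b x ∈ (chartAt (ModelProd HG FW) w₀).source) :
    ContMDiffWithinAt (𝓘(ℝ, ℝ).prod L) 𝓘(ℝ, EG × FW) ∞
      (fun p : ℝ × N => scaledComponents IG sc b v w₀ p.1 p.2) (univ ×ˢ S) (0, x) := by
  have : IsManifold (IG.prod 𝓘(ℝ, FW)) ∞ (TotalSpace FW W) := Bundle.TotalSpace.isManifold FW W
  have hfield := (h.smooth (sc 0 x) (h.mapsTo_scale 0 hx)).comp (0, x)
    (h.smooth_scale (0, x)).contMDiffWithinAt
    (s := univ ×ˢ S) (fun p hp => h.mapsTo_scale p.1 hp.2)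
  exact ((contMDiffWithinAt_along_iff (b := fun p : ℝ × N => b (sc p.1 p.2))
    (v := fun p : ℝ × N => v (sc p.1 p.2)) (w₀ := w₀)
    (by simp only [h.equivariant]; exact mem_chartAt_fiberSMul _ hbx)).1 hfield).2

theorem differentiableAt_scaledComponents (h : IsFieldAlongEquivariantMap IG L S sc b v)
    (hx : x ∈ S) (hbx : b x ∈ (chartAt (ModelProd HG FW) w₀).source) :
    DifferentiableAt ℝ (fun r => scaledComponents IG sc b v w₀ r x) 0 := by
  have hsmooth := (h.contMDiffWithinAt_scaledComponents hx hbx).comp (0 : ℝ) (s := univ)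
    (f := fun r : ℝ => (r, x)) (contMDiffAt_id.prodMk contMDiffAt_const).contMDiffWithinAt
    (fun r _ => ⟨trivial, hx⟩)
  exact (contMDiffAt_iff_contDiffAt.1 (contMDiffWithinAt_univ.1 hsmooth)).differentiableAt
    (by simp)

theorem tendsto_corePart (h : IsFieldAlongEquivariantMap IG L S sc b v) (hx : x ∈ S) :
    Tendsto (fun r : Ioi (0 : ℝ) => (r : ℝ) • homothetyPullback IG sc b v r x) zeroPlus
      (𝓝 (corePart IG sc b v x)) := by
  refine (tendsto_smul_scaleSnd
    (h.differentiableAt_scaledComponents hx (mem_chart_source _ _)).continuousAt).congr fun r => ?_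
  rw [h.homothetyPullback_eq r.2.ne']

theorem tendsto_linearPart (h : IsFieldAlongEquivariantMap IG L S sc b v) (hx : x ∈ S) :
    Tendsto (fun r : Ioi (0 : ℝ) => homothetyPullback IG sc b v r x -
      (r : ℝ)⁻¹ • corePart IG sc b v x) zeroPlus (𝓝 (linearPart IG sc b v x)) := by
  refine (tendsto_scaleSnd_sub
    (h.differentiableAt_scaledComponents hx (mem_chart_source _ _))).congr fun r => ?_
  rw [h.homothetyPullback_eq r.2.ne', corePart]

-- In any chart, both sides are the limit of the same family, so the formulas that define the two
-- parts are valid in every bundle chart and not only in the one around the foot point.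
theorem chartDeriv_corePart (h : IsFieldAlongEquivariantMap IG L S sc b v) (hx : x ∈ S)
    (hbx : b x ∈ (chartAt (ModelProd HG FW) w₀).source) :
    chartDeriv (IG.prod 𝓘(ℝ, FW)) w₀ (b x) (corePart IG sc b v x) =
      (0, (scaledComponents IG sc b v w₀ 0 x).2) := by
  refine tendsto_nhds_unique
    (((chartDeriv (IG.prod 𝓘(ℝ, FW)) w₀ (b x)).continuous.tendsto _).comp
      (h.tendsto_corePart hx)) ?_
  refine (tendsto_smul_scaleSnd
    (h.differentiableAt_scaledComponents hx hbx).continuousAt).congr fun r => ?_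
  rw [Function.comp_apply, map_smul, h.chartDeriv_homothetyPullback r.2.ne' hbx]

theorem chartDeriv_linearPart (h : IsFieldAlongEquivariantMap IG L S sc b v) (hx : x ∈ S)
    (hbx : b x ∈ (chartAt (ModelProd HG FW) w₀).source) :
    chartDeriv (IG.prod 𝓘(ℝ, FW)) w₀ (b x) (linearPart IG sc b v x) =
      ((scaledComponents IG sc b v w₀ 0 x).1,
        deriv (fun r => (scaledComponents IG sc b v w₀ r x).2) 0) := by
  refine tendsto_nhds_unique
    (((chartDeriv (IG.prod 𝓘(ℝ, FW)) w₀ (b x)).continuous.tendsto _).comp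
      (h.tendsto_linearPart hx)) ?_
  refine (tendsto_scaleSnd_sub (h.differentiableAt_scaledComponents hx hbx)).congr fun r => ?_
  rw [Function.comp_apply, map_sub, map_smul, h.chartDeriv_homothetyPullback r.2.ne' hbx,
    h.chartDeriv_corePart hx hbx]

theorem contMDiffOn_of_chartDeriv (h : IsFieldAlongEquivariantMap IG L S sc b v)
    {u : N → EG × FW}
    (hu : ∀ x ∈ S, ∃ φ : N → EG × FW, ContMDiffWithinAt L 𝓘(ℝ, EG × FW) ∞ φ S x ∧
      ∀ y ∈ S, b y ∈ (chartAt (ModelProd HG FW) (b x)).source →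
        chartDeriv (IG.prod 𝓘(ℝ, FW)) (b x) (b y) (u y) = φ y) :
    ContMDiffOn L (IG.prod 𝓘(ℝ, FW)).tangent ∞
      (fun x => (⟨b x, u x⟩ : TangentBundle (IG.prod 𝓘(ℝ, FW)) (TotalSpace FW W))) S := by
  have : IsManifold (IG.prod 𝓘(ℝ, FW)) ∞ (TotalSpace FW W) := Bundle.TotalSpace.isManifold FW W
  intro x hx
  obtain ⟨φ, hφ, hcomponents⟩ := hu x hx
  have hfoot := mem_chart_source (ModelProd HG FW) (b x)
  have hb := ((contMDiffWithinAt_along_iff hfoot).1 (h.smooth x hx)).1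
  refine (contMDiffWithinAt_along_iff hfoot).2
    ⟨hb, hφ.congr_of_eventuallyEq ?_ (hcomponents x hx hfoot)⟩
  filter_upwards [eventually_mem_nhdsWithin, hb.continuousWithinAt
    ((chartAt (ModelProd HG FW) (b x)).open_source.mem_nhds hfoot)] with y hy hby
    using hcomponents y hy hby

theorem contMDiffWithinAt_scaledComponents_zero (h : IsFieldAlongEquivariantMap IG L S sc b v)
    (hx : x ∈ S) (hbx : b x ∈ (chartAt (ModelProd HG FW) w₀).source) :
    ContMDiffWithinAt L 𝓘(ℝ, EG × FW) ∞ (scaledComponents IG sc b v w₀ 0) S x :=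
  (h.contMDiffWithinAt_scaledComponents hx hbx).comp x (f := fun y => ((0 : ℝ), y))
    (contMDiffAt_const.prodMk contMDiffAt_id).contMDiffWithinAt (fun _ hy => ⟨trivial, hy⟩)

theorem contMDiffOn_corePart (h : IsFieldAlongEquivariantMap IG L S sc b v) :
    ContMDiffOn L (IG.prod 𝓘(ℝ, FW)).tangent ∞ (fun x => (⟨b x, corePart IG sc b v x⟩ :
      TangentBundle (IG.prod 𝓘(ℝ, FW)) (TotalSpace FW W))) S :=
  h.contMDiffOn_of_chartDeriv fun _ hx => ⟨_, contMDiffWithinAt_const.prodMk_space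
    (contDiff_snd.contMDiff.contMDiffAt.comp_contMDiffWithinAt _
      (h.contMDiffWithinAt_scaledComponents_zero hx (mem_chart_source _ _))),
    fun _ hy hby => h.chartDeriv_corePart hy hby⟩

theorem contMDiffOn_linearPart (h : IsFieldAlongEquivariantMap IG L S sc b v) :
    ContMDiffOn L (IG.prod 𝓘(ℝ, FW)).tangent ∞ (fun x => (⟨b x, linearPart IG sc b v x⟩ :
      TangentBundle (IG.prod 𝓘(ℝ, FW)) (TotalSpace FW W))) S :=
  h.contMDiffOn_of_chartDeriv fun _ hx => ⟨_, ContMDiffWithinAt.prodMk_space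
    (contDiff_fst.contMDiff.contMDiffAt.comp_contMDiffWithinAt _
      (h.contMDiffWithinAt_scaledComponents_zero hx (mem_chart_source _ _)))
    (contMDiffWithinAt_deriv_fst hx (contDiff_snd.contMDiff.contMDiffAt.comp_contMDiffWithinAt _
      (h.contMDiffWithinAt_scaledComponents hx (mem_chart_source _ _)))),
    fun _ hy hby => h.chartDeriv_linearPart hy hby⟩

end IsFieldAlongEquivariantMap

end Linearization

theorem isCompl_range_ker_of_comp_eq_id {R M N : Type*} [Ring R] [AddCommGroup M]
    [AddCommGroup N] [Module R M] [Module R N] {f : N →ₗ[R] M} {g : M →ₗ[R] N}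
    (h : f ∘ₗ g = LinearMap.id) : IsCompl (LinearMap.range g) (LinearMap.ker f) := by
  have hleft : ∀ x, f (g x) = x := LinearMap.congr_fun h
  have hidem : IsIdempotentElem (g ∘ₗ f) := LinearMap.ext fun x => congrArg g (hleft (f x))
  have hcompl := LinearMap.IsIdempotentElem.isCompl hidem
  rwa [LinearMap.range_comp_of_range_eq_top g
      (LinearMap.range_eq_top.2 (LinearMap.surjective_of_comp_eq_id g f h)),
    LinearMap.ker_comp_of_ker_eq_bot f (LinearMap.ker_eq_bot_of_inverse h)] at hcompl

/-! ### Linearization of deformation cochains -/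

namespace VBGroupoid

open LieGroupoid

variable {EG HG EM HM : Type*} [NormedAddCommGroup EG] [NormedSpace ℝ EG]
  [TopologicalSpace HG] [NormedAddCommGroup EM] [NormedSpace ℝ EM] [TopologicalSpace HM]
  {IG : ModelWithCorners ℝ EG HG} {IM : ModelWithCorners ℝ EM HM}
  {G M : Type u} [TopologicalSpace G] [ChartedSpace HG G] [IsManifold IG ∞ G]
  [TopologicalSpace M] [ChartedSpace HM M] [IsManifold IM ∞ M]
  {FW : Type*} [NormedAddCommGroup FW] [NormedSpace ℝ FW]
  {W : G → Type u} [∀ g, AddCommGroup (W g)] [∀ g, Module ℝ (W g)]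
  [∀ g, TopologicalSpace (W g)] [TopologicalSpace (TotalSpace FW W)]
  [FiberBundle FW W] [VectorBundle ℝ FW W] [ContMDiffVectorBundle ∞ FW W IG]
  {FE : Type*} [NormedAddCommGroup FE] [NormedSpace ℝ FE]
  {E : M → Type u} [∀ x, AddCommGroup (E x)] [∀ x, Module ℝ (E x)]
  [∀ x, TopologicalSpace (E x)] [TopologicalSpace (TotalSpace FE E)]
  [FiberBundle FE E] [VectorBundle ℝ FE E] [ContMDiffVectorBundle ∞ FE E IM]
  {V : VBGroupoid IG IM FW W FE E}

theorem isCorePart_iff_tendsto {n : ℕ} {c c₀ : V.total.Cochain n} :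
    V.IsCorePart c c₀ ↔
      Tendsto (fun r : Ioi (0 : ℝ) => (r : ℝ) • V.hpull r n c) zeroPlus (𝓝 c₀) :=
  tendsto_pi_nhds.symm

theorem isLinearization_iff_tendsto {n : ℕ} {c c₁ : V.total.Cochain n} :
    V.IsLinearization c c₁ ↔ ∃ c₀ ∈ V.defCochains n,
      Tendsto (fun r : Ioi (0 : ℝ) => (r : ℝ) • V.hpull r n c) zeroPlus (𝓝 c₀) ∧
      Tendsto (fun r : Ioi (0 : ℝ) => V.hpull r n c - (r : ℝ)⁻¹ • c₀) zeroPlus (𝓝 c₁) :=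
  exists_congr fun _ => and_congr_right fun _ =>
    and_congr isCorePart_iff_tendsto tendsto_pi_nhds.symm

namespace IsLinearization

theorem unique {n : ℕ} {c d d' : V.total.Cochain n} (h : V.IsLinearization c d)
    (h' : V.IsLinearization c d') : d = d' := by
  obtain ⟨c₀, -, hcore, hlin⟩ := isLinearization_iff_tendsto.1 h
  obtain ⟨c₀', -, hcore', hlin'⟩ := isLinearization_iff_tendsto.1 h'
  obtain rfl := tendsto_nhds_unique hcore hcore'
  exact tendsto_nhds_unique hlin hlin'

theorem add {n : ℕ} {c c' d d' : V.total.Cochain n} (h : V.IsLinearization c d)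
    (h' : V.IsLinearization c' d') : V.IsLinearization (c + c') (d + d') := by
  obtain ⟨c₀, hc₀, hcore, hlin⟩ := isLinearization_iff_tendsto.1 h
  obtain ⟨c₀', hc₀', hcore', hlin'⟩ := isLinearization_iff_tendsto.1 h'
  refine isLinearization_iff_tendsto.2 ⟨c₀ + c₀', add_mem hc₀ hc₀',
    (hcore.add hcore').congr fun r => ?_, (hlin.add hlin').congr fun r => ?_⟩
  · rw [map_add, smul_add]
  · rw [map_add, smul_add, add_sub_add_comm]

theorem const_smul {n : ℕ} {c d : V.total.Cochain n} (a : ℝ) (h : V.IsLinearization c d) :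
    V.IsLinearization (a • c) (a • d) := by
  obtain ⟨c₀, hc₀, hcore, hlin⟩ := isLinearization_iff_tendsto.1 h
  refine isLinearization_iff_tendsto.2 ⟨a • c₀, Submodule.smul_mem _ a hc₀,
    (hcore.const_smul a).congr fun r => ?_, (hlin.const_smul a).congr fun r => ?_⟩
  · rw [map_smul, smul_comm]
  · rw [map_smul, smul_sub, smul_comm a]

end IsLinearization

theorem isLinearization_self {n : ℕ} {c : V.total.Cochain n} (hc : c ∈ V.linCochains n) :
    V.IsLinearization c c := by
  refine isLinearization_iff_tendsto.2 ⟨0, zero_mem _, ?_, ?_⟩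
  · simpa only [hc.2, zero_smul] using tendsto_val_zeroPlus.smul_const c
  · simpa only [hc.2, smul_zero, sub_zero] using tendsto_const_nhds

/-- The product in the multiplicative monoid of positive real numbers, on the subtype that indexes
the homotheties. -/
def mulPos (r μ : Ioi (0 : ℝ)) : Ioi (0 : ℝ) := ⟨r * μ, mem_Ioi.2 (mul_pos r.2 μ.2)⟩

theorem coe_mulPos (r μ : Ioi (0 : ℝ)) : (mulPos r μ : ℝ) = r * μ := rfl

theorem tendsto_mulPos (μ : Ioi (0 : ℝ)) : Tendsto (fun r => mulPos r μ) zeroPlus zeroPlus := by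
  have hmul := tendsto_val_zeroPlus.mul_const (μ : ℝ)
  rw [zero_mul] at hmul
  exact tendsto_comap_iff.2 hmul

theorem homothety_trans (r μ : Ioi (0 : ℝ)) :
    (V.homothety μ).trans (V.homothety r) = V.homothety (mulPos r μ) := by
  simp only [Aut.trans, homothety, LieGroupoid.Aut.mk.injEq, funext_iff, Function.comp_apply,
    coe_mulPos, _root_.mul_inv_rev, fiberSMul_mul, implies_true, and_self]

theorem hpull_hpull (r μ : Ioi (0 : ℝ)) {n : ℕ} (c : V.total.Cochain n) :
    V.hpull μ n (V.hpull r n c) = V.hpull (mulPos r μ) n c := by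
  rw [hpull, hpull, ← Aut.pullback_trans, homothety_trans, hpull]

theorem IsCorePart.hpull_eq_smul {n : ℕ} {c c₀ : V.total.Cochain n} (h : V.IsCorePart c c₀)
    (μ : Ioi (0 : ℝ)) : V.hpull μ n c₀ = (μ : ℝ)⁻¹ • c₀ := by
  have hcore := isCorePart_iff_tendsto.1 h
  have hpulled := (((V.homothety μ).continuous_pullback n).tendsto c₀).comp hcore
  refine tendsto_nhds_unique hpulled
    (((hcore.comp (tendsto_mulPos μ)).const_smul (μ : ℝ)⁻¹).congr fun r => ?_)
  calc (μ : ℝ)⁻¹ • (mulPos r μ : ℝ) • V.hpull (mulPos r μ) n c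
      = (r : ℝ) • V.hpull (mulPos r μ) n c := by
        rw [coe_mulPos, mul_comm, mul_smul, inv_smul_smul₀ μ.2.ne']
    _ = V.hpull μ n ((r : ℝ) • V.hpull r n c) := by rw [map_smul, hpull_hpull]

theorem IsLinearization.hpull_eq {n : ℕ} {c c₁ : V.total.Cochain n} (h : V.IsLinearization c c₁)
    (μ : Ioi (0 : ℝ)) : V.hpull μ n c₁ = c₁ := by
  obtain ⟨c₀, -, hcore, hlin⟩ := isLinearization_iff_tendsto.1 h
  have hpulled := (((V.homothety μ).continuous_pullback n).tendsto c₁).comp hlin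
  refine tendsto_nhds_unique hpulled ((hlin.comp (tendsto_mulPos μ)).congr fun r => ?_)
  calc V.hpull (mulPos r μ) n c - (mulPos r μ : ℝ)⁻¹ • c₀
      = V.hpull μ n (V.hpull r n c) - (r : ℝ)⁻¹ • V.hpull μ n c₀ := by
        rw [hpull_hpull, (isCorePart_iff_tendsto.2 hcore).hpull_eq_smul, smul_smul, coe_mulPos,
          _root_.mul_inv]
    _ = V.hpull μ n (V.hpull r n c - (r : ℝ)⁻¹ • c₀) := by rw [map_sub, map_smul]

theorem composable_fiberSMul (r : ℝ) {n : ℕ} {g : Fin (n + 1) → TotalSpace FW W}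
    (hg : g ∈ V.total.composable n) : (fun i => fiberSMul r (g i)) ∈ V.total.composable n :=
  fun i => by rw [(V.smul_hom r).map_s, (V.smul_hom r).map_t, hg i]

theorem isFieldAlongEquivariantMap_vecUnit {α : V.total.Cochain 0} (hα : IsSmoothCochain α) :
    IsFieldAlongEquivariantMap IG (IM.prod 𝓘(ℝ, FE)) univ fiberSMul V.total.one (vecUnit α) where
  smooth_scale := contMDiff_fiberSMul_prod
  mapsTo_scale _ _ _ := trivial
  equivariant r x := ((V.smul_hom r).map_one x).symm
  smooth := contMDiffOn_univ.2 hα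

theorem isFieldAlongEquivariantMap_extendZero {n : ℕ} {c : V.total.Cochain (n + 1)}
    (hc : IsSmoothCochain c) :
    IsFieldAlongEquivariantMap IG (ModelWithCorners.pi fun _ : Fin (n + 1) => IG.prod 𝓘(ℝ, FW))
      (V.total.composable n) (fun r g i => fiberSMul r (g i)) (fun g => g 0)
      (V.total.extendZero c) where
  smooth_scale := contMDiff_fiberSMul_tuple (n + 1)
  mapsTo_scale r _ hg := composable_fiberSMul r hg
  equivariant _ _ := rfl
  smooth := hc

theorem vecTuple_hpull {n : ℕ} (r : Ioi (0 : ℝ)) (c : V.total.Cochain (n + 1))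
    (g : V.total.composable n) :
    vecTuple (V.hpull r (n + 1) c) g =
      homothetyPullback IG (fun r g i => fiberSMul r (g i)) (fun g => g 0) (V.total.extendZero c)
        (r : ℝ) g.1 :=
  congrArg _ (extendZero_eq_vecTuple c (composable_fiberSMul (r : ℝ) g.2)).symm

theorem exists_isSmoothCochain_tendsto {n : ℕ} {c : V.total.Cochain n} (hc : IsSmoothCochain c) :
    ∃ c₀ c₁ : V.total.Cochain n, IsSmoothCochain c₀ ∧ IsSmoothCochain c₁ ∧
      Tendsto (fun r : Ioi (0 : ℝ) => (r : ℝ) • V.hpull r n c) zeroPlus (𝓝 c₀) ∧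
      Tendsto (fun r : Ioi (0 : ℝ) => V.hpull r n c - (r : ℝ)⁻¹ • c₀) zeroPlus (𝓝 c₁) := by
  cases n with
  | zero =>
    have h := isFieldAlongEquivariantMap_vecUnit hc
    have hsmooth₀ := contMDiffOn_univ.1 h.contMDiffOn_corePart
    have hsmooth₁ := contMDiffOn_univ.1 h.contMDiffOn_linearPart
    exact ⟨corePart IG _ _ _, linearPart IG _ _ _, hsmooth₀, hsmooth₁,
      tendsto_pi_nhds.2 fun _ => h.tendsto_corePart trivial,
      tendsto_pi_nhds.2 fun _ => h.tendsto_linearPart trivial⟩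
  | succ n =>
    have h := isFieldAlongEquivariantMap_extendZero hc
    refine ⟨fun g => corePart IG _ _ _ g.1, fun g => linearPart IG _ _ _ g.1,
      h.contMDiffOn_corePart.congr fun g hg => ?_, h.contMDiffOn_linearPart.congr fun g hg => ?_,
      tendsto_pi_nhds.2 fun g => (h.tendsto_corePart g.2).congr fun r => ?_,
      tendsto_pi_nhds.2 fun g => (h.tendsto_linearPart g.2).congr fun r => ?_⟩
    · exact tangentBundle_mk_congr rfl (V.total.extendZero_of_mem hg)
    · exact tangentBundle_mk_congr rfl (V.total.extendZero_of_mem hg)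
    · exact congrArg ((r : ℝ) • ·) (vecTuple_hpull r c g).symm
    · exact congrArg (· - (r : ℝ)⁻¹ • corePart IG _ _ _ g.1) (vecTuple_hpull r c g).symm

theorem exists_isLinearization {n : ℕ} {c : V.total.Cochain n} (hc : c ∈ V.defCochains n) :
    ∃ c₁ ∈ V.linCochains n, V.IsLinearization c c₁ := by
  obtain ⟨hcompat, hsmooth⟩ := mem_defCochains.1 hc
  obtain ⟨c₀, c₁, hsmooth₀, hsmooth₁, hcore, hlin⟩ := exists_isSmoothCochain_tendsto hsmooth
  have hcompat_hpull (r : Ioi (0 : ℝ)) : IsSourceCompatible (V.hpull r n c) :=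
    hcompat.pullback (V.homothety r)
  have hcompat₀ : IsSourceCompatible c₀ := (isClosed_setOf_isSourceCompatible n).mem_of_tendsto
    hcore (Eventually.of_forall fun r => (hcompat_hpull r).const_smul r)
  have hcompat₁ : IsSourceCompatible c₁ := (isClosed_setOf_isSourceCompatible n).mem_of_tendsto
    hlin (Eventually.of_forall fun r => (hcompat_hpull r).sub (hcompat₀.const_smul _))
  have h : V.IsLinearization c c₁ := isLinearization_iff_tendsto.2
    ⟨c₀, mem_defCochains.2 ⟨hcompat₀, hsmooth₀⟩, hcore, hlin⟩
  exact ⟨c₁, ⟨mem_defCochains.2 ⟨hcompat₁, hsmooth₁⟩, h.hpull_eq⟩, h⟩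

variable (V) in
/-- The linearization map `lin : C_def → C_{def,lin}` in degree `n - 1`; as limits are unique, the
choice in its definition is immaterial. -/
noncomputable def linearization (n : ℕ) : V.defCochains n →ₗ[ℝ] V.linCochains n where
  toFun c := ⟨_, (exists_isLinearization c.2).choose_spec.1⟩
  map_add' c d := Subtype.ext <| (exists_isLinearization (c + d).2).choose_spec.2.unique <|
    (exists_isLinearization c.2).choose_spec.2.add (exists_isLinearization d.2).choose_spec.2
  map_smul' a c := Subtype.ext <| (exists_isLinearization (a • c).2).choose_spec.2.unique <|
    (exists_isLinearization c.2).choose_spec.2.const_smul a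

theorem isLinearization_linearization {n : ℕ} (c : V.defCochains n) :
    V.IsLinearization c.1 (V.linearization n c).1 :=
  (exists_isLinearization c.2).choose_spec.2

theorem linearization_comp_inclusion (n : ℕ) :
    V.linearization n ∘ₗ Submodule.inclusion (V.linCochains_le n) = LinearMap.id :=
  LinearMap.ext fun c =>
    Subtype.ext ((isLinearization_linearization _).unique (isLinearization_self c.2))

variable [IG.Boundaryless]

theorem diff_hpull {n : ℕ} {c : V.total.Cochain n} (hc : c ∈ V.defCochains n) (r : Ioi (0 : ℝ)) :
    V.total.diff n (V.hpull r n c) = V.hpull r (n + 1) (V.total.diff n c) :=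
  diff_pullback _ (mem_defCochains.1 hc).1

theorem diff_mem_linCochains {n : ℕ} {c : V.total.Cochain n} (hc : c ∈ V.linCochains n) :
    V.total.diff n c ∈ V.linCochains (n + 1) :=
  ⟨diff_mem_defCochains hc.1, fun r => by rw [← diff_hpull hc.1, hc.2 r]⟩

theorem IsLinearization.diff {n : ℕ} {c c₁ : V.total.Cochain n} (h : V.IsLinearization c c₁)
    (hc : c ∈ V.defCochains n) :
    V.IsLinearization (V.total.diff n c) (V.total.diff n c₁) := by
  obtain ⟨c₀, hc₀, hcore, hlin⟩ := isLinearization_iff_tendsto.1 h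
  refine isLinearization_iff_tendsto.2 ⟨V.total.diff n c₀, diff_mem_defCochains hc₀,
    (((continuous_diff n).tendsto c₀).comp hcore).congr fun r => ?_,
    (((continuous_diff n).tendsto c₁).comp hlin).congr fun r => ?_⟩
  · rw [Function.comp_apply, map_smul, diff_hpull hc]
  · rw [Function.comp_apply, map_sub, map_smul, diff_hpull hc]

theorem linearization_diff {n : ℕ} (c : V.defCochains n) :
    (V.linearization (n + 1) ⟨V.total.diff n c.1, diff_mem_defCochains c.2⟩).1 =
      V.total.diff n (V.linearization n c).1 :=
  (isLinearization_linearization _).unique ((isLinearization_linearization c).diff c.2)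

variable (V) in
theorem cohomologyMap_injective (n : ℕ) :
    Function.Injective (V.total.cohomologyMap V.linCochains_le n) := by
  refine (injective_iff_map_eq_zero _).2 fun x => ?_
  obtain ⟨c, rfl⟩ := Submodule.Quotient.mk_surjective _ x
  intro hx
  have hc : c.1 ∈ V.total.coboundaries V.defCochains n := (Submodule.Quotient.mk_eq_zero
    ((V.total.coboundaries V.defCochains n).submoduleOf (V.total.cocycles V.defCochains n))).1 hx
  refine (Submodule.Quotient.mk_eq_zero _).2 (?_ : c.1 ∈ V.total.coboundaries V.linCochains n)
  cases n with
  | zero => exact hc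
  | succ n =>
    obtain ⟨d, hd, hdc⟩ := hc
    refine ⟨(V.linearization n ⟨d, hd⟩).1, (V.linearization n ⟨d, hd⟩).2, ?_⟩
    have hlin : V.IsLinearization c.1 (V.total.diff n (V.linearization n ⟨d, hd⟩).1) :=
      hdc ▸ (isLinearization_linearization ⟨d, hd⟩).diff hd
    exact hlin.unique (isLinearization_self c.2.1)

end VBGroupoid

theorem mainTheorem3_general
    {EG HG EM HM : Type*} [NormedAddCommGroup EG] [NormedSpace ℝ EG]
    [TopologicalSpace HG] [NormedAddCommGroup EM] [NormedSpace ℝ EM] [TopologicalSpace HM]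
    {IG : ModelWithCorners ℝ EG HG} [IG.Boundaryless] {IM : ModelWithCorners ℝ EM HM}
    {G M : Type u} [TopologicalSpace G] [ChartedSpace HG G] [IsManifold IG ∞ G]
    [TopologicalSpace M] [ChartedSpace HM M] [IsManifold IM ∞ M]
    {FW : Type*} [NormedAddCommGroup FW] [NormedSpace ℝ FW]
    {W : G → Type u} [∀ g, AddCommGroup (W g)] [∀ g, Module ℝ (W g)]
    [∀ g, TopologicalSpace (W g)] [TopologicalSpace (TotalSpace FW W)]
    [FiberBundle FW W] [VectorBundle ℝ FW W] [ContMDiffVectorBundle ∞ FW W IG]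
    {FE : Type*} [NormedAddCommGroup FE] [NormedSpace ℝ FE]
    {E : M → Type u} [∀ x, AddCommGroup (E x)] [∀ x, Module ℝ (E x)]
    [∀ x, TopologicalSpace (E x)] [TopologicalSpace (TotalSpace FE E)]
    [FiberBundle FE E] [VectorBundle ℝ FE E] [ContMDiffVectorBundle ∞ FE E IM]
    (V : VBGroupoid IG IM FW W FE E) :
    ∃ (hdef : ∀ n, ∀ c ∈ V.defCochains n, V.total.diff n c ∈ V.defCochains (n + 1))
      (hlin : ∀ n, ∀ c ∈ V.linCochains n, V.total.diff n c ∈ V.linCochains (n + 1)),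
      (∀ n, ∀ c ∈ V.defCochains n, V.total.diff (n + 1) (V.total.diff n c) = 0) ∧
      ∃ lin : ∀ n, V.defCochains n →ₗ[ℝ] V.linCochains n,
        (∀ n (c : V.defCochains n), V.IsLinearization c.1 (lin n c).1) ∧
        (∀ n, lin (n + 1) ∘ₗ (V.total.diff n).restrict (hdef n) =
          (V.total.diff n).restrict (hlin n) ∘ₗ lin n) ∧
        (∀ n, lin n ∘ₗ Submodule.inclusion (V.linCochains_le n) = LinearMap.id) ∧
        (∀ n, IsCompl (LinearMap.range (Submodule.inclusion (V.linCochains_le n)))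
          (LinearMap.ker (lin n))) ∧
        (∀ n, ∀ c ∈ LinearMap.ker (lin n),
          (V.total.diff n).restrict (hdef n) c ∈ LinearMap.ker (lin (n + 1))) ∧
        (∀ n, Function.Injective (V.total.cohomologyMap V.linCochains_le n)) := by
  refine ⟨fun _ _ => LieGroupoid.diff_mem_defCochains, fun _ _ => VBGroupoid.diff_mem_linCochains,
    fun _ _ hc => LieGroupoid.diff_diff (LieGroupoid.mem_defCochains.1 hc).1,
    V.linearization, fun _ => VBGroupoid.isLinearization_linearization,
    fun _ => LinearMap.ext fun c => Subtype.ext (VBGroupoid.linearization_diff c),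
    VBGroupoid.linearization_comp_inclusion,
    fun n => isCompl_range_ker_of_comp_eq_id (VBGroupoid.linearization_comp_inclusion n),
    fun n c hc => ?_, V.cohomologyMap_injective⟩
  have hlin : V.linearization n c = 0 := hc
  refine LinearMap.mem_ker.2 (Subtype.ext ((VBGroupoid.linearization_diff c).trans ?_))
  rw [hlin]
  exact map_zero (V.total.diff n)

theorem mainTheorem3
    {EG HG EM HM : Type*} [NormedAddCommGroup EG] [NormedSpace ℝ EG] [FiniteDimensional ℝ EG]
    [TopologicalSpace HG]
    [NormedAddCommGroup EM] [NormedSpace ℝ EM] [FiniteDimensional ℝ EM] [TopologicalSpace HM]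
    {IG : ModelWithCorners ℝ EG HG} [IG.Boundaryless]
    {IM : ModelWithCorners ℝ EM HM} [IM.Boundaryless]
    {G M : Type u} [TopologicalSpace G] [ChartedSpace HG G] [IsManifold IG ∞ G]
    [TopologicalSpace M] [ChartedSpace HM M] [IsManifold IM ∞ M]
    {FW : Type*} [NormedAddCommGroup FW] [NormedSpace ℝ FW] [FiniteDimensional ℝ FW]
    {W : G → Type u} [∀ g, AddCommGroup (W g)] [∀ g, Module ℝ (W g)]
    [∀ g, TopologicalSpace (W g)] [TopologicalSpace (TotalSpace FW W)]
    [FiberBundle FW W] [VectorBundle ℝ FW W] [ContMDiffVectorBundle ∞ FW W IG]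
    {FE : Type*} [NormedAddCommGroup FE] [NormedSpace ℝ FE] [FiniteDimensional ℝ FE]
    {E : M → Type u} [∀ x, AddCommGroup (E x)] [∀ x, Module ℝ (E x)]
    [∀ x, TopologicalSpace (E x)] [TopologicalSpace (TotalSpace FE E)]
    [FiberBundle FE E] [VectorBundle ℝ FE E] [ContMDiffVectorBundle ∞ FE E IM]
    (V : VBGroupoid IG IM FW W FE E) :
    -- the differential restricts to deformation cochains and to linear deformation cochains
    ∃ (hdef : ∀ n, ∀ c ∈ V.defCochains n, V.total.diff n c ∈ V.defCochains (n + 1))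
      (hlin : ∀ n, ∀ c ∈ V.linCochains n, V.total.diff n c ∈ V.linCochains (n + 1)),
      -- both are cochain complexes
      (∀ n, ∀ c ∈ V.defCochains n, V.total.diff (n + 1) (V.total.diff n c) = 0) ∧
      -- the linearization map is well defined and linear, with values in linear cochains
      ∃ lin : ∀ n, V.defCochains n →ₗ[ℝ] V.linCochains n,
        (∀ n (c : V.defCochains n), V.IsLinearization c.1 (lin n c).1) ∧
        -- it is a cochain map
        (∀ n, lin (n + 1) ∘ₗ (V.total.diff n).restrict (hdef n) =
          (V.total.diff n).restrict (hlin n) ∘ₗ lin n) ∧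
        -- it splits the inclusion of linear deformation cochains
        (∀ n, lin n ∘ₗ Submodule.inclusion (V.linCochains_le n) = LinearMap.id) ∧
        -- direct sum decomposition into linear cochains and the kernel, as cochain complexes
        (∀ n, IsCompl (LinearMap.range (Submodule.inclusion (V.linCochains_le n)))
          (LinearMap.ker (lin n))) ∧
        (∀ n, ∀ c ∈ LinearMap.ker (lin n),
          (V.total.diff n).restrict (hdef n) c ∈ LinearMap.ker (lin (n + 1))) ∧
        -- the inclusion induces an injection in cohomology
        (∀ n, Function.Injective (V.total.cohomologyMap V.linCochains_le n)) :=
  mainTheorem3_general V
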